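/- Let $p$ be a prime such that $m=24/(p+1)$ is an integer. Let $\Lambda$ be the Leech lattice (the positive definite even unimodular lattice of rank $24$ without vectors of norm $2$), let $g$ be an automorphism of $\Lambda$ of cycle shape $1^mp^m$ (that is, with characteristic polynomial $(X-1)^m(X^p-1)^m$), and let $\Lambda^p$ be the sublattice of $\Lambda$ fixed by $g$. For a lattice $L$ write $L'$ for its dual, $x^2=(x,x)$ for the norm of $x$, and $L(n)$ for $L$ with all norms multiplied by $n$; let $II_{1,1}$ be $\mathbb Z^2$ with norm $(m_1,m_2)^2=-2m_1m_2$. Put $$M=\Lambda^p(-1)\oplus II_{1,1}(p)\oplus II_{1,1}.$$ Write $e(z)=e^{2\pi i z}$ and $q=e(\tau)$, let $\eta(\tau)=q^{1/24}\prod_{n>0}(1-q^n)$, and define, for $\tau$ in the upper half plane $\mathbb H$ and $0\le j<p$, $$f(\tau)=(\eta(\tau)\eta(p\tau))^{-m},\qquad g_j(\tau)=\frac1p\sum_{k=0}^{p-1}e(-jk/p)\,f\big((\tau+k)/p\big).$$ Then $f(\tau/p)=g_0(\tau)+\dots+g_{p-1}(\tau)$, and each $g_j$ has an expansion of the form $\sum_{n\in\mathbb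 Z}a(n)q^{n+j/p}$ (so the $g_j$ are the parts of $f(\tau/p)$ sorted by exponent class). Moreover $M$ is an even lattice, $M'/M$ is finite, and every $\gamma\in M'/M$ satisfies $\gamma^2/2\equiv j/p \pmod 1$ for some $0\le j<p$. Let $F=\sum_{\gamma\in M'/M}f_\gamma e^\gamma:\mathbb H\to\mathbb C[M'/M]$ be given by $$f_0=f+g_0,\qquad f_\gamma=g_j\ \text{ if } \gamma\ne0 \text{ and } \gamma^2/2\equiv j/p \pmod 1 .$$ Then $F$ is a modular form of weight $-m$ and representation $\rho_M$: with $(b^+,b^-)$ the signature of $M$ and $\sqrt i=e(1/8)$, for all $\gamma\in M'/M$ and $\tau\in\mathbb H$, $$f_\gamma(\tau+1)=e(\gamma^2/2)f_\gamma(\tau),\qquad f_\gamma(-1/\tau)=\frac{\sqrt i^{\,b^--b^+}}{\sqrt{|M'/M|}}\,\tau^{-m}\sum_{\delta\in M'/M}e(-(\gamma,\delta))f_\delta(\tau).$$ Furthermore $F$ is holomorphic on $\mathbb H$ and meromorphic at the cusps: each $f_\gamma$ is holomorphic on $\mathbb H$ and can be written $f_\gamma(\tau)=\sum_{n\in\mathbb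 Q}c_\gamma(n)q^n$ with $c_\gamma(n)=0$ for all $n$ below some bound. -/

import Mathlib

open scoped TensorProduct UpperHalfPlane MatrixGroups

noncomputable section

namespace FakeMonster

/-! ### Lattices

A lattice is a free `ℤ`-module of finite rank `L` with a symmetric bilinear form
`B : L × L → ℤ`; the norm of `x` is `x² = B x x`. -/

/-- `(L, B)` is an even (nondegenerate) lattice. -/
structure IsEvenLattice {L : Type*} [AddCommGroup L] (B : LinearMap.BilinForm ℤ L) : Prop where
  symm : ∀ x y, B x y = B y x
  even : ∀ x, Even (B x x)
  nondegenerate : B.Nondegenerate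

/-- The form of the orthogonal direct sum `L₁ ⊕ L₂`. -/
def orthoSum {L₁ L₂ : Type*} [AddCommGroup L₁] [AddCommGroup L₂]
    (B₁ : LinearMap.BilinForm ℤ L₁) (B₂ : LinearMap.BilinForm ℤ L₂) :
    LinearMap.BilinForm ℤ (L₁ × L₂) :=
  B₁.compl₁₂ (LinearMap.fst ℤ L₁ L₂) (LinearMap.fst ℤ L₁ L₂) +
    B₂.compl₁₂ (LinearMap.snd ℤ L₁ L₂) (LinearMap.snd ℤ L₁ L₂)

/-- The form of `L(n)`: all norms are multiplied by `n`. -/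
def scaled {L : Type*} [AddCommGroup L] (n : ℤ) (B : LinearMap.BilinForm ℤ L) :
    LinearMap.BilinForm ℤ L := n • B

/-- The form of `II_{1,1}`: the module `ℤ²` with `(m₁, m₂)² = -2 m₁ m₂`. -/
def hyperbolicPlane : LinearMap.BilinForm ℤ (ℤ × ℤ) :=
  LinearMap.mk₂ ℤ (fun x y => -(x.1 * y.2 + x.2 * y.1))
    (fun _ _ _ => by simp only [Prod.fst_add, Prod.snd_add]; ring)
    (fun _ _ _ => by simp only [Prod.smul_fst, Prod.smul_snd, smul_eq_mul]; ring)
    (fun _ _ _ => by simp only [Prod.fst_add, Prod.snd_add]; ring)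
    (fun _ _ _ => by simp only [Prod.smul_fst, Prod.smul_snd, smul_eq_mul]; ring)

section Dual

variable {L : Type*} [AddCommGroup L] (B : LinearMap.BilinForm ℤ L)

/-- The rational extension of the form to `ℚ ⊗ L`. -/
def ratForm : LinearMap.BilinForm ℚ (ℚ ⊗[ℤ] L) := LinearMap.BilinForm.baseChange ℚ B

/-- The lattice `L`, seen inside `ℚ ⊗ L`. -/
def latticeIn (L : Type*) [AddCommGroup L] : Submodule ℤ (ℚ ⊗[ℤ] L) :=
  LinearMap.range (TensorProduct.mk ℤ ℚ L 1)

/-- The dual lattice `L' = {x ∈ ℚ ⊗ L | (x, y) ∈ ℤ for all y ∈ L}`. -/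
def dualLattice : Submodule ℤ (ℚ ⊗[ℤ] L) := (ratForm B).dualSubmodule (latticeIn L)

/-- The discriminant group `L'/L`. -/
abbrev DiscGroup : Type _ := dualLattice B ⧸ (latticeIn L).submoduleOf (dualLattice B)

/-- The class in `L'/L` of an element of `L'`. -/
def discMk (x : dualLattice B) : DiscGroup B := Submodule.Quotient.mk x

/-- `(γ, δ)` for `γ, δ ∈ L'/L`, computed on representatives; only its class modulo `1` has a
meaning (see `discPair_discMk`). -/
def discPair (γ δ : DiscGroup B) : ℚ := ratForm B (γ.out : dualLattice B) (δ.out : dualLattice B)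

/-- `γ²/2` for `γ ∈ L'/L`, computed on a representative; only its class modulo `1` has a
meaning (see `discHalfNorm_discMk`). -/
def discHalfNorm (γ : DiscGroup B) : ℚ := discPair B γ γ / 2

/-- `b⁺`: the largest dimension of a positive definite subspace (over `ℚ`; for a rational form
this is the same number as over `ℝ`, by diagonalization). -/
def bPlus : ℕ := sigPos (ratForm B).toQuadraticMap

/-- `b⁻`: the largest dimension of a negative definite subspace. -/
def bMinus : ℕ := sigNeg (ratForm B).toQuadraticMap

variable {B}

lemma ratForm_symm (hB : ∀ x y, B x y = B y x) (x y : ℚ ⊗[ℤ] L) :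
    ratForm B x y = ratForm B y x :=
  (LinearMap.BilinForm.IsSymm.baseChange ℚ ⟨hB⟩).eq x y

lemma exists_int_of_mem {x y : ℚ ⊗[ℤ] L} (hx : x ∈ dualLattice B) (hy : y ∈ latticeIn L) :
    ∃ n : ℤ, ratForm B x y = n := by
  obtain ⟨n, hn⟩ := Submodule.mem_one.1 (hx y hy)
  exact ⟨n, by simpa using hn.symm⟩

lemma exists_out_eq (x : dualLattice B) :
    ∃ u ∈ latticeIn L, (((discMk B x).out : dualLattice B) : ℚ ⊗[ℤ] L) = x + u := by
  refine ⟨((discMk B x).out : dualLattice B) - x, ?_, by abel⟩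
  have h : (Submodule.Quotient.mk (discMk B x).out : DiscGroup B) = Submodule.Quotient.mk x :=
    Quotient.out_eq _
  exact (Submodule.Quotient.eq ((latticeIn L).submoduleOf (dualLattice B))).1 h

/-- The pairing modulo `1` does not depend on representatives. -/
lemma discPair_discMk (hB : ∀ x y, B x y = B y x) (x y : dualLattice B) :
    ∃ n : ℤ, discPair B (discMk B x) (discMk B y) = ratForm B x y + n := by
  obtain ⟨u, hu, hxu⟩ := exists_out_eq x
  obtain ⟨v, hv, hyv⟩ := exists_out_eq y
  obtain ⟨a, ha⟩ := exists_int_of_mem x.2 hv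
  obtain ⟨b, hb⟩ := exists_int_of_mem (discMk B y).out.2 hu
  refine ⟨a + b, ?_⟩
  rw [ratForm_symm hB, hyv] at hb
  simp only [discPair, hxu, hyv, map_add, LinearMap.add_apply] at hb ⊢
  push_cast
  linarith

/-- On an even lattice, half the norm modulo `1` does not depend on representatives. -/
lemma discHalfNorm_discMk (hB : IsEvenLattice B) (x : dualLattice B) :
    ∃ n : ℤ, discHalfNorm B (discMk B x) = ratForm B x x / 2 + n := by
  obtain ⟨u, hu, hxu⟩ := exists_out_eq x
  obtain ⟨a, ha⟩ := exists_int_of_mem x.2 hu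
  obtain ⟨w, rfl⟩ := hu
  obtain ⟨b, hb⟩ := hB.even w
  have hw : ratForm B ((1 : ℚ) ⊗ₜ[ℤ] w) ((1 : ℚ) ⊗ₜ[ℤ] w) = b + b := by
    simp [ratForm, LinearMap.BilinForm.baseChange_tmul, hb]
  have hs := ratForm_symm hB.symm (x : ℚ ⊗[ℤ] L) ((1 : ℚ) ⊗ₜ[ℤ] w)
  refine ⟨a + b, ?_⟩
  change ratForm B x ((1 : ℚ) ⊗ₜ[ℤ] w) = a at ha
  change ((discMk B x).out : ℚ ⊗[ℤ] L) = x + (1 : ℚ) ⊗ₜ[ℤ] w at hxu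
  simp only [discHalfNorm, discPair, hxu, map_add, LinearMap.add_apply, hw, ← hs, ha]
  push_cast
  ring

end Dual

/-! ### Vector valued modular forms -/

/-- `e(z) = exp(2πiz)`. -/
def e (z : ℂ) : ℂ := Complex.exp (2 * Real.pi * Complex.I * z)

section ModularForms

variable {L : Type*} [AddCommGroup L] (B : LinearMap.BilinForm ℤ L)

/-- The family `F = ∑ f_γ e^γ` of functions on `ℍ` is a modular form of weight `k` and type `ρ_M`
for the even lattice `M = (L, B)` of signature `(b⁺, b⁻)`. Here `√i = e(1/8)`. -/
def IsModularFormOfType (k : ℤ) (F : DiscGroup B → ℍ → ℂ) : Prop :=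
  (∀ γ τ, F γ (ModularGroup.T • τ) = e (discHalfNorm B γ) * F γ τ) ∧
  (∀ γ τ, F γ (ModularGroup.S • τ) =
    e (1 / 8) ^ ((bMinus B : ℤ) - (bPlus B : ℤ)) / (Real.sqrt (Nat.card (DiscGroup B)) : ℂ) *
      (τ : ℂ) ^ k * ∑ᶠ δ, e (-(discPair B γ δ : ℂ)) * F δ τ)

/-- Each component is holomorphic on `ℍ` and has an expansion `∑_{n ∈ ℚ} c(n) q^n` with
`c(n) = 0` for all `n` below some bound. -/
def IsMeromorphicAtCusps {D : Type*} (F : D → ℍ → ℂ) : Prop :=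
  ∀ γ, ∃ c : ℚ → ℂ, (∃ N : ℚ, ∀ n < N, c n = 0) ∧
    ∀ τ : ℍ, HasSum (fun n : ℚ => c n * e (n * (τ : ℂ))) (F γ τ)

/-- Each component is a holomorphic function on the upper half plane. -/
def IsHolomorphicOnH {D : Type*} (F : D → ℍ → ℂ) : Prop :=
  ∀ γ, MDifferentiable (modelWithCornersSelf ℂ ℂ) (modelWithCornersSelf ℂ ℂ) (F γ)

end ModularForms

/-! ### The Leech lattice and its sublattices `Λ^p` -/

/-- `(Λ, B)` is the Leech lattice: the positive definite even unimodular lattice of rank `24`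
without vectors of norm `2` (these properties determine it up to isomorphism). -/
structure IsLeechLattice {Λ : Type*} [AddCommGroup Λ] (B : LinearMap.BilinForm ℤ Λ) : Prop where
  finrank_eq : Module.finrank ℤ Λ = 24
  symm : ∀ x y, B x y = B y x
  even : ∀ x, Even (B x x)
  posDef : ∀ x, x ≠ 0 → 0 < B x x
  unimodular : dualLattice B = latticeIn Λ
  norm_ne_two : ∀ x, B x x ≠ 2

/-- The automorphism `g` has cycle shape `∏ a` (`a` in the multiset `c`): its characteristic
polynomial is `∏ (X^a - 1)`. -/
def HasCycleShape {Λ : Type*} [AddCommGroup Λ] [Module.Free ℤ Λ] [Module.Finite ℤ Λ]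
    (g : Λ ≃ₗ[ℤ] Λ) (c : Multiset ℕ) : Prop :=
  LinearMap.charpoly (g : Λ →ₗ[ℤ] Λ) = (c.map fun a => (Polynomial.X ^ a - 1)).prod

/-- The sublattice fixed by `g`. -/
def fixedSublattice {Λ : Type*} [AddCommGroup Λ] (g : Λ ≃ₗ[ℤ] Λ) : Submodule ℤ Λ :=
  LinearMap.eqLocus (g : Λ →ₗ[ℤ] Λ) LinearMap.id

/-- The form of `M = Λ^g(-1) ⊕ II_{1,1}(p) ⊕ II_{1,1}`, where `Λ^g` is the sublattice of `Λ`
fixed by `g`. -/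
def latticeM {Λ : Type*} [AddCommGroup Λ] (B : LinearMap.BilinForm ℤ Λ) (g : Λ ≃ₗ[ℤ] Λ) (p : ℕ) :
    LinearMap.BilinForm ℤ (fixedSublattice g × (ℤ × ℤ) × (ℤ × ℤ)) :=
  orthoSum (scaled (-1) (B.restrict (fixedSublattice g)))
    (orthoSum (scaled p hyperbolicPlane) hyperbolicPlane)

/-! ### The components of `F` -/

/-- `f(τ) = (η(τ) η(pτ))^{-m}`. -/
def etaProduct (p m : ℕ) (τ : ℂ) : ℂ :=
  (ModularForm.eta τ * ModularForm.eta (p * τ)) ^ (-(m : ℤ))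

/-- `g_j(τ) = (1/p) ∑_{k mod p} e(-jk/p) f((τ+k)/p)`: the part of `f(τ/p)` with exponents in
`j/p + ℤ`. -/
def etaPart (p m j : ℕ) (τ : ℂ) : ℂ :=
  1 / p * ∑ k ∈ Finset.range p, e (-(j * k / p)) * etaProduct p m ((τ + k) / p)

/-- The functions `g_0, …, g_{p-1}` are the parts of `f(τ/p)` sorted by exponent class:
`f(τ/p) = g_0(τ) + … + g_{p-1}(τ)`, and `g_j` has an expansion `∑_{n ∈ ℤ} a(n) q^{n + j/p}`. -/
def IsExponentDecomposition (p : ℕ) (f : ℂ → ℂ) (g : ℕ → ℂ → ℂ) : Prop :=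
  (∀ τ : ℍ, f (τ / p) = ∑ j ∈ Finset.range p, g j τ) ∧
  ∀ j < p, ∃ a : ℤ → ℂ, ∀ τ : ℍ, HasSum (fun n : ℤ => a n * e ((n + j / p) * (τ : ℂ))) (g j τ)

open Classical in
/-- The components of `F`: `f_0 = f + g_0`, and `f_γ = g_j` if `γ ≠ 0` and `γ²/2 = j/p mod 1`
(the sum picks out the unique such `j` with `0 ≤ j < p`). -/
def vectorF {L : Type*} [AddCommGroup L] (B : LinearMap.BilinForm ℤ L) (p m : ℕ)
    (γ : DiscGroup B) (τ : ℍ) : ℂ :=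
  if γ = 0 then etaProduct p m τ + etaPart p m 0 τ
  else ∑ j ∈ Finset.range p,
    if ∃ n : ℤ, discHalfNorm B γ = (j : ℚ) / p + n then etaPart p m j τ else 0

end FakeMonster

end

set_option linter.unusedSectionVars false

noncomputable section

namespace FakeMonster

section EtaProducts

open ModularForm
open Complex hiding eta
open UpperHalfPlane hiding I

/-! ### The exponential `e` -/

/-! Put D = M'/M, q(γ) = γ²/2 mod 1 and K = Λ^p. Once q is known to take values in (1/p)ℤ/ℤ, all
components have one shape: f_γ = [γ = 0] f(τ) + (1/p) ∑_k e(-k q(γ)) f((τ+k)/p), the sum over k mod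
p (`vectorF_eq`, `etaPart_eq`). Covariance under T, holomorphy and the expansions follow from this
and the product for η, because m(p+1) = 24 makes f a Laurent series in q with leading term q⁻¹. The
content of the theorem is the transformation under S, where an analytic and an arithmetic
computation must give the same answer.

Analytic side: S exchanges f(τ) and f(τ/p) up to explicit powers of τ, i and √p, and for k ≠ 0 it
sends f((τ+k)/p) to χ(k) τ^{-m} f((τ - k⁻¹)/p) (`etaFiber_neg_inv`). Here χ is trivial for even m
and the quadratic character for odd m. The multiplier of η is followed along a continued fraction
and the outcome is checked for the six possible primes.

Arithmetic side: completing the square turns ∑_δ e(-(γ,δ) - k q(δ)) into e(q(γ)/k) times the Gauss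
sum of -k·q. Milgram's formula evaluates the Gauss sum of q as √|D| e((b⁺-b⁻)/8) = √p^{m+2} (-i)^m,
and the one of t·q then carries the factor χ(t) (`sum_stdAddChar_mul_eq_etaChar`): for even m the
value is an integer, hence Galois invariant; for odd m one has p = 7 or 23, where t or -t is a
square, and rescaling by squares together with complex conjugation suffices. `vector_neg_inv`
compares the two sides. Milgram's formula comes from one dimensional Gauss sums, obtained from the
asymptotics of theta functions, by passing to an orthogonal sublattice.

What remains is |D| = p^{m+2} and p·q = 0, that is |K'/K| = p^m and p x²/2 ∈ ℤ on K'. Unimodularity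
identifies K'/K with a quotient of Λ whose order divides det(1-g) on Λ/K, which is p^m. The opposite
inequality uses that Λ has minimum 4, through Blichfeldt's packing bound. This suffices for p ≥ 5.
For p = 3 it leaves 3⁵, which contradicts Milgram's formula. For p = 2 the bound is applied to the
(-1)-eigenlattice N of rank 8, which has the same discriminant. Then N with its form halved is
unimodular of rank 8 without vectors of norm 1, hence even, and this gives the integrality of norms
on K' that is automatic only for odd p. -/

lemma e_add (a b : ℂ) : e (a + b) = e a * e b := by
  simp only [e, mul_add, Complex.exp_add]

lemma e_ne_zero (z : ℂ) : e z ≠ 0 := Complex.exp_ne_zero _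

lemma e_neg (a : ℂ) : e (-a) = (e a)⁻¹ := by
  simp only [e, mul_neg, Complex.exp_neg]

lemma e_int (n : ℤ) : e n = 1 := by
  rw [e, mul_comm]
  exact Complex.exp_int_mul_two_pi_mul_I n

lemma e_add_int (a : ℂ) (n : ℤ) : e (a + n) = e a := by rw [e_add, e_int, mul_one]

lemma e_pow (a : ℂ) (n : ℕ) : e a ^ n = e (n * a) := by
  simp only [e, ← Complex.exp_nat_mul]
  ring_nf

lemma e_zpow (a : ℂ) (n : ℤ) : e a ^ n = e (n * a) := by
  simp only [e, ← Complex.exp_int_mul]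
  ring_nf

lemma e_eq_of_sub_eq_int {a b : ℂ} (n : ℤ) (h : a = b + n) : e a = e b := by
  rw [h, e_add_int]

lemma e_half : e (1 / 2) = -1 := by
  rw [e, show (2 * Real.pi * I * (1 / 2) : ℂ) = Real.pi * I by ring, Complex.exp_pi_mul_I]

lemma e_quarter : e (1 / 4) = I := by
  rw [e, show (2 * Real.pi * I * (1 / 4) : ℂ) = Real.pi / 2 * I by ring, Complex.exp_pi_div_two_mul_I]

/-! ### Transformations of the eta function -/

lemma eta_add_int (z : ℂ) (n : ℤ) : eta (z + n) = e (n / 24) * eta z := by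
  have h1 : ∀ k, eta_q k (z + n) = eta_q k z := by
    intro k
    rw [eta_q_eq_cexp, eta_q_eq_cexp, Complex.exp_eq_exp_iff_exists_int]
    exact ⟨(k + 1) * n, by push_cast; ring⟩
  have h2 : Function.Periodic.qParam 24 (z + n) = e (n / 24) * Function.Periodic.qParam 24 z := by
    simp only [Function.Periodic.qParam, e, ← Complex.exp_add]
    congr 1
    push_cast
    ring
  simp only [eta, h1, h2, mul_assoc]

lemma eta_neg_inv {z : ℂ} (hz : 0 < z.im) : eta (-1 / z) = sqrt z / sqrt I * eta z := by
  have := eta_comp_eq_csqrt_I_inv (x := z) hz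
  simp only [Function.comp, Pi.smul_apply, Pi.mul_apply, smul_eq_mul] at this
  rw [this]
  ring

lemma sqrt_I : sqrt I = e (1 / 8) := by
  rw [sqrt_eq_exp I_ne_zero, Complex.log_I, e]
  congr 1
  ring

lemma sqrt_sq (z : ℂ) : sqrt z ^ 2 = z := by
  rcases eq_or_ne z 0 with rfl | hz
  · simp [sqrt]
  · rw [sqrt_eq_exp hz, ← Complex.exp_nat_mul]
    rw [show ((2 : ℕ) : ℂ) * (log z / 2) = log z by push_cast; ring, Complex.exp_log hz]

/-- No sign is lost: if the arguments of u/v and v added up to more than π, the principal argument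
of u would be negative, although u lies in the upper half plane. -/
lemma sqrt_div_mul_sqrt {u v : ℂ} (hu : 0 < u.im) (hv : 0 < v.im) (huv : 0 < (u / v).im) :
    sqrt (u / v) * sqrt v = sqrt u := by
  have hv0 : v ≠ 0 := by rintro rfl; simp at hv
  have hu0 : u ≠ 0 := by rintro rfl; simp at hu
  have huv0 : u / v ≠ 0 := div_ne_zero hu0 hv0
  rw [sqrt_eq_exp hv0, sqrt_eq_exp hu0, sqrt_eq_exp huv0, ← Complex.exp_add]
  have h1 : log u = log (u / v) + log v := by
    rw [← Complex.log_mul huv0 hv0, div_mul_cancel₀ _ hv0]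
    have a1 := Complex.arg_nonneg_iff.2 huv.le
    have a2 := Complex.arg_nonneg_iff.2 hv.le
    have a3 := Complex.arg_lt_pi_iff.2 (Or.inr huv.ne')
    have a4 := Complex.arg_lt_pi_iff.2 (Or.inr hv.ne')
    refine ⟨by linarith [Real.pi_pos], ?_⟩
    by_contra! hgt
    have h3 : Complex.arg ((u / v) * v) = (u / v).arg + v.arg - 2 * Real.pi := by
      rw [← Complex.arg_coe_angle_toReal_eq_arg, Complex.arg_mul_coe_angle huv0 hv0,
        ← Real.Angle.coe_add, Real.Angle.toReal_coe_eq_self_sub_two_pi_iff.2 ⟨hgt, by linarith⟩]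
    rw [div_mul_cancel₀ _ hv0] at h3
    have := Complex.arg_nonneg_iff.2 hu.le
    linarith
  rw [h1]
  ring_nf

lemma im_int_mul_add_int (a b : ℤ) (z : ℂ) : ((a : ℂ) * z + b).im = a * z.im := by simp

lemma im_int_mul_add_int_pos {a : ℤ} (ha : 0 < a) (b : ℤ) {z : ℂ} (hz : 0 < z.im) :
    0 < ((a : ℂ) * z + b).im := by
  rw [im_int_mul_add_int]
  positivity

/-- `η` transforms under `(a, b; c, d)` with multiplier `e((N - 3)/24)`. -/
def EtaTransform (a b c d N : ℤ) : Prop :=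
  ∀ z : ℂ, 0 < z.im → eta ((a * z + b) / (c * z + d)) =
    e (N / 24) * (sqrt (c * z + d) / sqrt I) * eta z

lemma etaTransform_one : EtaTransform 1 0 0 1 3 := by
  intro z _
  have h1 : sqrt 1 = 1 := by simp [sqrt]
  simp only [Int.cast_one, Int.cast_zero, Int.cast_ofNat, one_mul, zero_mul, zero_add, add_zero,
    div_one, h1, sqrt_I]
  rw [show (3 / 24 : ℂ) = 1 / 8 by norm_num, mul_one_div, div_self (e_ne_zero _), one_mul]

/-- Multiplication of the matrix by TⁿS on the left. S brings the factor √w/√i at w = (az+b)/(cz+d),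
whose numerator merges with √(cz+d) into √(az+b). Tⁿ adds n to the exponent, and the surplus 1/√i
subtracts 3. -/
lemma EtaTransform.step {a b c d N : ℤ} (h : EtaTransform a b c d N) (hdet : a * d - b * c = 1)
    (ha : 0 < a) (hc : 0 < c ∨ c = 0 ∧ d = 1) (n : ℤ) :
    EtaTransform (n * a - c) (n * b - d) a b (n + N - 3) := by
  intro z hz
  have hau : 0 < ((a : ℂ) * z + b).im := im_int_mul_add_int_pos ha b hz
  have hau0 : (a : ℂ) * z + b ≠ 0 := by intro h0; simp [h0] at hau
  have hcv0 : (c : ℂ) * z + d ≠ 0 := by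
    rcases hc with hc | ⟨rfl, rfl⟩
    · intro h0
      have : 0 < ((c : ℂ) * z + d).im := im_int_mul_add_int_pos hc d hz
      simp [h0] at this
    · simp
  have hw : 0 < (((a : ℂ) * z + b) / (c * z + d)).im := by
    have : ((a : ℂ) * z + b) / (c * z + d) =
        ((a : ℂ) * z + b) * (starRingEnd ℂ) (c * z + d) / (normSq (c * z + d) : ℂ) := by
      rw [div_eq_div_iff hcv0 (by exact_mod_cast (normSq_pos.2 hcv0).ne'), normSq_eq_conj_mul_self]
      ring
    rw [this, div_ofReal_im]
    apply div_pos _ (normSq_pos.2 hcv0)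
    have hd : (a : ℝ) * d - b * c = 1 := by exact_mod_cast hdet
    have : ((a : ℂ) * z + b).re = a * z.re + b := by simp
    simp only [mul_im, add_im, add_re, mul_re, intCast_im, intCast_re, conj_im, conj_re, zero_mul,
      sub_zero, add_zero]
    nlinarith [hd, hz]
  have hs : sqrt (((a : ℂ) * z + b) / (c * z + d)) * sqrt (c * z + d) = sqrt (a * z + b) := by
    rcases hc with hc | ⟨rfl, rfl⟩
    · exact sqrt_div_mul_sqrt hau (im_int_mul_add_int_pos hc d hz) hw
    · simp [sqrt]
  have h1 : (((n * a - c : ℤ) : ℂ) * z + ((n * b - d : ℤ) : ℂ)) / (a * z + b) =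
      -1 / (((a : ℂ) * z + b) / (c * z + d)) + n := by
    rw [div_div_eq_mul_div, div_add' _ _ _ hau0]
    push_cast
    ring
  rw [h1, eta_add_int, eta_neg_inv hw, h z hz, ← hs]
  have h2 : e (((n + N - 3 : ℤ) : ℂ) / 24) = e (n / 24) * e (N / 24) * (sqrt I)⁻¹ := by
    rw [sqrt_I, ← e_neg, ← e_add, ← e_add]
    congr 1
    push_cast
    ring
  rw [h2]
  ring

/-- The matrix `∏ Tⁿ S` over a word `n₁, n₂, …`, with the corresponding exponent of the
multiplier of `η`. -/
def etaWord : List ℤ → ℤ × ℤ × ℤ × ℤ × ℤ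
  | [] => (1, 0, 0, 1, 3)
  | n :: l =>
    let w := etaWord l
    (n * w.1 - w.2.2.1, n * w.2.1 - w.2.2.2.1, w.1, w.2.1, n + w.2.2.2.2 - 3)

/-- Entries at least 2 preserve 0 ≤ c < a, so every bottom row met on the way satisfies the
positivity that `EtaTransform.step` needs for a consistent branch of the square root. -/
lemma etaWord_spec (l : List ℤ) (hl : ∀ n ∈ l, 2 ≤ n) :
    let w := etaWord l
    EtaTransform w.1 w.2.1 w.2.2.1 w.2.2.2.1 w.2.2.2.2 ∧
      w.1 * w.2.2.2.1 - w.2.1 * w.2.2.1 = 1 ∧ w.2.2.1 < w.1 ∧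
      (0 < w.2.2.1 ∨ w.2.2.1 = 0 ∧ w.2.2.2.1 = 1) := by
  induction l with
  | nil => exact ⟨etaTransform_one, by norm_num [etaWord], by norm_num [etaWord],
      Or.inr (by norm_num [etaWord])⟩
  | cons n l ih =>
    obtain ⟨h1, h2, h3, h4⟩ := ih fun k hk => hl k (List.mem_cons_of_mem _ hk)
    have hn := hl n List.mem_cons_self
    have ha : 0 < (etaWord l).1 := by rcases h4 with h | ⟨h, -⟩ <;> linarith
    refine ⟨h1.step h2 ha h4 n, ?_, ?_, Or.inl ha⟩
    · simp only [etaWord]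
      linear_combination h2
    · simp only [etaWord]
      nlinarith

/-- The negative-regular continued fraction of `a / c`. -/
def negContFrac : ℕ → ℤ → ℤ → List ℤ
  | 0, _, _ => []
  | fuel + 1, a, c =>
    if c = 0 then [] else -(-a / c) :: negContFrac fuel c (-(-a / c) * c - a)

/-- Arithmetic of the multiplier of `η(τ)η(pτ)` at the matrix `(k, *; p, d)`. -/
def etaWordCheck (p m : ℕ) (k : ℤ) : Prop :=
  let l := negContFrac (p + 1) p (p - k)
  let w := etaWord l
  (∀ n ∈ l, 2 ≤ n) ∧ w.1 = p ∧ w.2.2.1 = p - k ∧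
    (m * (w.2.2.2.2 - 2 + k + w.2.1 - 6)) % 24 =
      if m % 2 = 0 ∨ ∃ x ∈ Finset.range p, ((x : ℤ) * x - k) % p = 0 then 0 else 12

instance (p m : ℕ) (k : ℤ) : Decidable (etaWordCheck p m k) := by
  unfold etaWordCheck; infer_instance

/-- Only p = 2, 3, 5, 7, 11, 23 occur, so this is a finite computation. It replaces a general
formula for the multiplier of η by Dedekind sums. -/
lemma etaWordCheck_of_mul_eq {p m : ℕ} (hp : p.Prime) (hm : m * (p + 1) = 24) :
    ∀ k ∈ Finset.range p, k ≠ 0 → etaWordCheck p m k := by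
  have hp1 : p + 1 ∣ 24 := ⟨m, by rw [← hm, mul_comm]⟩
  have hp24 : p ≤ 23 := by have := Nat.le_of_dvd (by norm_num) hp1; omega
  have hm24 : m = 24 / (p + 1) := by rw [← hm]; simp
  subst hm24
  clear hm
  interval_cases p <;> first
    | (exfalso; revert hp; decide)
    | (exfalso; revert hp1; decide)
    | decide

lemma sqrt_mul_self (z : ℂ) : sqrt z * sqrt z = z := by rw [← sq, sqrt_sq]

lemma sqrt_ofReal_mul {r : ℝ} (hr : 0 < r) {z : ℂ} (hz : z ≠ 0) :
    sqrt (r * z) = (Real.sqrt r : ℂ) * sqrt z := by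
  have hr0 : (r : ℂ) ≠ 0 := by exact_mod_cast hr.ne'
  rw [sqrt_eq_exp (mul_ne_zero hr0 hz), sqrt_eq_exp hz, Complex.log_ofReal_mul hr hz, add_div,
    Complex.exp_add]
  congr 1
  rw [Real.sqrt_eq_rpow, Real.rpow_def_of_pos hr, ofReal_exp]
  push_cast
  ring_nf

lemma ofReal_sqrt_natCast_mul_self (p : ℕ) : (Real.sqrt p : ℂ) * (Real.sqrt p : ℂ) = p := by
  rw [← ofReal_mul, Real.mul_self_sqrt (Nat.cast_nonneg p), ofReal_natCast]

/-- The values `f((τ + k)/p)` for `k` modulo `p`. -/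
def etaFiber (p m : ℕ) (τ : ℂ) (k : ZMod p) : ℂ := etaProduct p m ((τ + k.val) / p)

/-- The quadratic character governing `(η(τ)η(pτ))^m`. -/
def etaChar (p m : ℕ) (k : ZMod p) : ℂ :=
  open Classical in if m % 2 = 0 ∨ IsSquare k then 1 else -1

/-! ### The functions f((τ + k)/p) under T and S. -/

section

variable {p m : ℕ}

/-- The 24th roots of unity from the two η factors combine to the exponent -m(p+1)n/24 = -n. -/
lemma etaProduct_add_int (hm : m * (p + 1) = 24) (z : ℂ) (n : ℤ) :
    etaProduct p m (z + n) = etaProduct p m z := by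
  rw [etaProduct, etaProduct, eta_add_int, show (p : ℂ) * (z + n) = p * z + ((p * n : ℤ) : ℂ) by
    push_cast; ring, eta_add_int, mul_mul_mul_comm, mul_zpow, ← e_add, e_zpow]
  have : e (((-(m : ℤ) : ℤ) : ℂ) * ((n : ℂ) / 24 + ((p * n : ℤ) : ℂ) / 24)) = 1 := by
    have hm' : (m : ℂ) * (p + 1) = 24 := by exact_mod_cast hm
    rw [← e_int (-n)]
    congr 1
    push_cast
    linear_combination (-(n : ℂ) / 24) * hm'
  rw [this, one_mul]

lemma etaProduct_div_eq_etaFiber (hp : p ≠ 0) (hm : m * (p + 1) = 24) (τ : ℂ) (n : ℤ) :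
    etaProduct p m ((τ + n) / p) = etaFiber p m τ n := by
  have : NeZero p := ⟨hp⟩
  have hp0 : (p : ℂ) ≠ 0 := by exact_mod_cast hp
  have h1 : (((n : ZMod p).val : ℕ) : ℤ) = n % p := ZMod.val_intCast n
  have h2 : n = p * (n / p) + ((n : ZMod p).val : ℕ) := by
    rw [h1]; exact (Int.mul_ediv_add_emod n p).symm
  have h3 : (n : ℂ) = p * ((n / p : ℤ) : ℂ) + ((n : ZMod p).val : ℂ) := by exact_mod_cast h2
  rw [etaFiber, ← etaProduct_add_int hm ((τ + ((n : ZMod p).val : ℕ)) / p) (n / p)]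
  congr 1
  rw [div_add' _ _ _ hp0, h3]
  congr 1
  ring

lemma etaFiber_zero (τ : ℂ) : etaFiber p m τ 0 = etaProduct p m (τ / p) := by
  simp [etaFiber]

/-- Inversion sends η(τ) and η(p · ) at -1/τ to η(τ) and η(τ/p), which are the two factors of f at
τ/p in the other order. -/
lemma etaProduct_neg_inv (hp : 0 < p) {τ : ℂ} (hτ : 0 < τ.im) :
    etaProduct p m (-1 / τ) = (τ / (Real.sqrt p * I)) ^ (-(m : ℤ)) * etaProduct p m (τ / p) := by
  have hp0 : (p : ℂ) ≠ 0 := by exact_mod_cast hp.ne'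
  have hs0 : (Real.sqrt p : ℂ) ≠ 0 := by
    exact_mod_cast (Real.sqrt_pos.2 (Nat.cast_pos.2 hp)).ne'
  have hτ0 : τ ≠ 0 := by rintro rfl; simp at hτ
  have h1 : 0 < (τ / p).im := by
    rw [div_natCast_im]; positivity
  rw [etaProduct, etaProduct, ← mul_zpow]
  congr 1
  rw [eta_neg_inv hτ, show (p : ℂ) * (-1 / τ) = -1 / (τ / p) by field_simp, eta_neg_inv h1,
    mul_div_cancel₀ _ hp0]
  have h2 : sqrt τ = (Real.sqrt p : ℂ) * sqrt (τ / p) := by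
    rw [← ofReal_natCast, ← sqrt_ofReal_mul (Nat.cast_pos.2 hp) (div_ne_zero hτ0 (by simpa using hp0)),
      ofReal_natCast, mul_div_cancel₀ _ hp0]
  have h3 : sqrt (τ / p) = sqrt τ / Real.sqrt p := by rw [h2]; field_simp
  rw [h3]
  have h4 := sqrt_mul_self τ
  have h5 := sqrt_mul_self I
  have h6 : sqrt I ≠ 0 := by rw [sqrt_I]; exact e_ne_zero _
  rw [show τ / (Real.sqrt p * I) = (sqrt τ * sqrt τ) / (Real.sqrt p * (sqrt I * sqrt I)) by
    rw [h4, h5]]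
  field_simp

lemma etaFiber_neg_inv_zero (hp : 0 < p) {τ : ℂ} (hτ : 0 < τ.im) :
    etaFiber p m (-1 / τ) 0 = (Real.sqrt p * τ / I) ^ (-(m : ℤ)) * etaProduct p m τ := by
  have hp0 : (p : ℂ) ≠ 0 := by exact_mod_cast hp.ne'
  have hs0 : (Real.sqrt p : ℂ) ≠ 0 := by
    exact_mod_cast (Real.sqrt_pos.2 (Nat.cast_pos.2 hp)).ne'
  have h1 : 0 < ((p : ℂ) * τ).im := by
    have : ((p : ℂ) * τ).im = p * τ.im := by simp
    rw [this]
    positivity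
  rw [etaFiber_zero, show -1 / τ / p = -1 / (p * τ) by rw [div_div, mul_comm],
    etaProduct_neg_inv hp h1, mul_div_cancel_left₀ _ hp0]
  congr 2
  rw [← ofReal_sqrt_natCast_mul_self]
  field_simp

/-- The point (-1/τ + k)/p is the image of (τ - b)/p under an integral matrix of determinant 1 with
first column (k, p), where b is an inverse of k mod p. So S permutes the nonzero k by k ↦ -1/k, and
only the root of unity has to be computed. -/
lemma etaFiber_neg_inv (hp : p.Prime) (hm : m * (p + 1) = 24) {τ : ℂ} (hτ : 0 < τ.im)
    {k : ZMod p} (hk : k ≠ 0) :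
    etaFiber p m (-1 / τ) k = etaChar p m k * τ ^ (-(m : ℤ)) * etaFiber p m τ (-k⁻¹) := by
  have : Fact p.Prime := ⟨hp⟩
  have hp0 : (p : ℂ) ≠ 0 := by exact_mod_cast hp.ne_zero
  have hτ0 : τ ≠ 0 := by rintro rfl; simp at hτ
  have hk0 : k.val ≠ 0 := by rwa [Ne, ZMod.val_eq_zero]
  have hkp : k.val < p := ZMod.val_lt k
  obtain ⟨hl, ha, hc, hN⟩ := etaWordCheck_of_mul_eq hp hm k.val (Finset.mem_range.2 hkp) hk0
  obtain ⟨h1, h2, h3, h4⟩ := etaWord_spec _ hl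
  generalize etaWord (negContFrac (p + 1) p (p - (k.val : ℕ))) = w at *
  obtain ⟨a, b, c, d, N⟩ := w
  simp only at *
  subst ha hc
  -- The word is the expansion of p/(p-k), all of whose entries are at least 2. The expansion of k/p
  -- = 1 - (p-k)/p itself begins with the entry 1, which is prepended here by hand.
  have h5 := h1.step h2 (by exact_mod_cast hp.pos) h4 1
  have hdet : (k.val : ℤ) * b - (b - d) * p = 1 := by linear_combination h2
  have hkb : k * (b : ZMod p) = 1 := by
    have := congrArg (Int.cast : ℤ → ZMod p) hdet
    simpa using this
  have hinv : k⁻¹ = (b : ZMod p) := inv_eq_of_mul_eq_one_right hkb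
  have hτ' : 0 < ((τ - b) / p).im := by
    rw [div_natCast_im, sub_im, intCast_im, sub_zero]
    have := hp.pos
    positivity
  have h6 := h5 _ hτ'
  have h7 : ((p : ℤ) : ℂ) * ((τ - b) / p) + b = τ := by
    push_cast; field_simp; ring
  have h8 : (((1 * p - (p - (k.val : ℕ)) : ℤ) : ℂ) * ((τ - b) / p) + ((1 * b - d : ℤ) : ℂ)) =
      τ * ((-1 / τ + (k.val : ℕ)) / p) := by
    have hdet' : (k.val : ℂ) * b - (b - d) * p = 1 := by exact_mod_cast hdet
    field_simp
    push_cast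
    linear_combination -hdet'
  rw [h7, h8, mul_div_cancel_left₀ _ hτ0] at h6
  have h9 : eta (p * ((-1 / τ + (k.val : ℕ)) / p)) =
      e ((k.val : ℕ) / 24) * (sqrt τ / sqrt I * (e (b / 24) * eta (p * ((τ - b) / p)))) := by
    rw [← eta_add_int, mul_div_cancel₀ _ hp0, mul_div_cancel₀ _ hp0, sub_add_cancel,
      ← eta_neg_inv hτ]
    exact eta_add_int (-1 / τ) (k.val : ℤ)
  have h10 : etaFiber p m τ (-k⁻¹) = etaProduct p m ((τ - b) / p) := by
    have := etaProduct_div_eq_etaFiber hp.ne_zero hm τ (-b)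
    push_cast at this
    rw [hinv, sub_eq_add_neg, this]
  -- The four exponents come from η at the matrix (k, b-d; p, b), from the translation by k, from
  -- the translation by b, and from (√i)⁻² = e(-6/24).
  have h11 : ((e (((1 + N - 3 : ℤ) : ℂ) / 24) * e ((k.val : ℕ) / 24) * e (b / 24) *
      e (-6 / 24)) ^ (-(m : ℤ))) = etaChar p m k := by
    rw [← e_add, ← e_add, ← e_add, e_zpow]
    have hiff : (m % 2 = 0 ∨ ∃ x ∈ Finset.range p, ((x : ℤ) * x - (k.val : ℕ)) % p = 0) ↔
        (m % 2 = 0 ∨ IsSquare k) := by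
      refine or_congr Iff.rfl ⟨?_, ?_⟩
      · rintro ⟨x, -, hx⟩
        refine ⟨x, ?_⟩
        have := (ZMod.intCast_zmod_eq_zero_iff_dvd _ p).2 (Int.dvd_of_emod_eq_zero hx)
        push_cast at this
        rw [ZMod.natCast_zmod_val, sub_eq_zero] at this
        exact this.symm
      · rintro ⟨x, hx⟩
        refine ⟨x.val, Finset.mem_range.2 (ZMod.val_lt x), ?_⟩
        apply Int.emod_eq_zero_of_dvd
        rw [← ZMod.intCast_zmod_eq_zero_iff_dvd]
        push_cast
        rw [ZMod.natCast_zmod_val, ZMod.natCast_zmod_val, hx, sub_self]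
    rw [etaChar]
    set X : ℤ := m * (N - 2 + (k.val : ℕ) + b - 6) with hX
    have hXc : (((-(m : ℤ) : ℤ) : ℂ) * (((1 + N - 3 : ℤ) : ℂ) / 24 + ((k.val : ℕ) : ℂ) / 24 +
        b / 24 + -6 / 24)) = -(X : ℂ) / 24 := by
      rw [hX]; push_cast; ring
    rw [hXc]
    by_cases hs : m % 2 = 0 ∨ IsSquare k
    · rw [if_pos (hiff.2 hs)] at hN
      rw [if_pos hs]
      obtain ⟨y, hy⟩ := Int.dvd_of_emod_eq_zero hN
      rw [← e_int (-y), hy]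
      congr 1
      push_cast
      ring
    · rw [if_neg (hiff.not.2 hs)] at hN
      rw [if_neg hs, ← e_half]
      have hy : X = 24 * (X / 24) + 12 := by omega
      refine e_eq_of_sub_eq_int (-(X / 24) - 1) ?_
      have : (X : ℂ) = 24 * ((X / 24 : ℤ) : ℂ) + 12 := by exact_mod_cast hy
      rw [this]
      push_cast
      ring
  rw [h10, etaFiber, etaProduct, etaProduct, h6, h9, ← h11, ← mul_zpow, ← mul_zpow]
  congr 1
  have h12 : e (-6 / 24) = I⁻¹ := by
    rw [← e_quarter, ← e_neg]; norm_num
  have h13 := sqrt_mul_self τ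
  have h14 := sqrt_mul_self I
  have h15 : sqrt I ≠ 0 := by rw [sqrt_I]; exact e_ne_zero _
  have h16 : e (-6 / 24) = (sqrt I * sqrt I)⁻¹ := by rw [h14, h12]
  rw [h16]
  linear_combination (e (((1 + N - 3 : ℤ) : ℂ) / 24) * e ((k.val : ℕ) / 24) * e (b / 24) *
    (sqrt I * sqrt I)⁻¹ * eta ((τ - b) / p) * eta (p * ((τ - b) / p))) * h13

lemma stdAddChar_intCast [NeZero p] (n : ℤ) : ZMod.stdAddChar (n : ZMod p) = e (n / p) := by
  rw [ZMod.stdAddChar_coe, e]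
  congr 1
  ring

lemma etaPart_eq [NeZero p] (j : ℕ) (τ : ℂ) :
    etaPart p m j τ =
      1 / p * ∑ k : ZMod p, ZMod.stdAddChar (-((j : ZMod p) * k)) * etaFiber p m τ k := by
  rw [etaPart]
  congr 1
  refine Finset.sum_nbij' (fun k => (k : ZMod p)) (fun k => k.val) ?_ ?_ ?_ ?_ ?_
  · intros; simp
  · intro k _; exact Finset.mem_range.2 (ZMod.val_lt k)
  · intro k hk; exact ZMod.val_cast_of_lt (Finset.mem_range.1 hk)
  · intro k _; simp
  · intro k hk
    rw [etaFiber, ZMod.val_cast_of_lt (Finset.mem_range.1 hk)]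
    congr 1
    rw [show (-((j : ZMod p) * (k : ZMod p))) = ((-(j * k) : ℤ) : ZMod p) by push_cast; ring,
      stdAddChar_intCast]
    congr 1
    push_cast
    ring

end

section

variable {p m : ℕ}

/-! ### Expansions -/

lemma norm_e_lt_one {τ : ℂ} (hτ : 0 < τ.im) : ‖e τ‖ < 1 :=
  norm_exp_two_pi_I_lt_one ⟨τ, hτ⟩

lemma eta_eq (z : ℂ) : eta z = e (z / 24) * ∏' n : ℕ, (1 - e z ^ (n + 1)) := by
  have : Function.Periodic.qParam 24 z = e (z / 24) := by
    rw [Function.Periodic.qParam, e]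
    congr 1
    push_cast
    ring
  rw [eta, this]
  simp_rw [eta_q_eq_pow]
  rfl

lemma tprod_one_sub_pow_ne_zero {q : ℂ} (hq : ‖q‖ < 1) : ∏' n : ℕ, (1 - q ^ (n + 1)) ≠ 0 := by
  refine tprod_one_add_ne_zero_of_summable (f := fun n : ℕ => -q ^ (n + 1)) (fun n => ?_) ?_
  · rw [← sub_eq_add_neg, sub_ne_zero]
    intro h
    have h1 : ‖q ^ (n + 1)‖ < 1 := by
      rw [norm_pow]; exact pow_lt_one₀ (norm_nonneg _) hq (Nat.succ_ne_zero n)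
    rw [← h, norm_one] at h1
    exact lt_irrefl _ h1
  · simpa using (summable_nat_add_iff 1).mpr (summable_geometric_of_lt_one (norm_nonneg _) hq)

/-- f(τ) is q⁻¹ times Q(q), where Q is an inverse power of products without zeros in the unit disc.
Hence Q is holomorphic there and equals its Taylor series. -/
lemma exists_hasSum_etaProduct_nat (hp : p ≠ 0) (hm : m * (p + 1) = 24) :
    ∃ c : ℕ → ℂ, ∀ τ : ℂ, 0 < τ.im →
      HasSum (fun n : ℕ => c n * e ((n - 1) * τ)) (etaProduct p m τ) := by
  let P : ℂ → ℂ := fun q => ∏' n : ℕ, (1 - q ^ (n + 1))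
  let Q : ℂ → ℂ := fun q => ((P q * P (q ^ p)) ^ m)⁻¹
  have hball : ∀ q ∈ Metric.ball (0 : ℂ) 1, q ^ p ∈ Metric.ball (0 : ℂ) 1 := by
    intro q hq
    rw [mem_ball_zero_iff] at hq ⊢
    rw [norm_pow]
    exact pow_lt_one₀ (norm_nonneg _) hq hp
  have hP : DifferentiableOn ℂ P (Metric.ball 0 1) := differentiableOn_tprod_one_sub_pow
  have hQ : DifferentiableOn ℂ Q (Metric.ball 0 1) := by
    refine DifferentiableOn.inv ((hP.mul (hP.comp (by fun_prop) hball)).pow m) fun q hq => ?_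
    exact pow_ne_zero _ (mul_ne_zero (tprod_one_sub_pow_ne_zero (mem_ball_zero_iff.1 hq))
      (tprod_one_sub_pow_ne_zero (mem_ball_zero_iff.1 (hball q hq))))
  refine ⟨fun n => (n.factorial : ℂ)⁻¹ * iteratedDeriv n Q 0, fun τ hτ => ?_⟩
  have hq : e τ ∈ Metric.ball (0 : ℂ) 1 := by simpa using norm_e_lt_one hτ
  have h1 := (Complex.hasSum_taylorSeries_on_ball hQ hq).mul_left (e (-τ))
  have h2 : e (-τ) * Q (e τ) = etaProduct p m τ := by
    have hm' : (m : ℂ) * (p + 1) = 24 := by exact_mod_cast hm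
    have h3 : e (p * τ) = e τ ^ p := (e_pow τ p).symm
    rw [etaProduct, eta_eq, eta_eq, h3, zpow_neg, zpow_natCast, mul_mul_mul_comm, mul_pow,
      ← e_add, e_pow, mul_inv, ← e_neg]
    congr 2
    linear_combination (τ / 24) * hm'
  rw [h2] at h1
  refine h1.congr_fun fun n => ?_
  simp only [sub_zero, smul_eq_mul, e_pow]
  rw [show ((n : ℂ) - 1) * τ = -τ + n * τ by ring, e_add]
  ring

lemma exists_hasSum_etaProduct (hp : p ≠ 0) (hm : m * (p + 1) = 24) :
    ∃ a : ℤ → ℂ, (∀ n < -1, a n = 0) ∧ ∀ τ : ℂ, 0 < τ.im →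
      HasSum (fun n : ℤ => a n * e (n * τ)) (etaProduct p m τ) := by
  obtain ⟨c, hc⟩ := exists_hasSum_etaProduct_nat hp hm
  refine ⟨fun n => if n < -1 then 0 else c (n + 1).toNat, fun n hn => if_pos hn, fun τ hτ => ?_⟩
  have hinj : Function.Injective fun n : ℕ => (n : ℤ) - 1 := by
    intro a b h; simpa using h
  rw [← hinj.hasSum_iff]
  · refine (hc τ hτ).congr_fun fun n => ?_
    have : ¬ ((n : ℤ) - 1 < -1) := by omega
    simp [this]
  · intro n hn
    have : n < -1 := by
      by_contra h
      exact hn ⟨(n + 1).toNat, by simp only; omega⟩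
    simp [this]

lemma sum_stdAddChar_mul [NeZero p] (b : ZMod p) :
    ∑ k : ZMod p, ZMod.stdAddChar (k * b) = if b = 0 then (p : ℂ) else 0 := by
  have := AddChar.sum_mulShift b (ZMod.isPrimitive_stdAddChar p)
  rw [this, ZMod.card]
  split_ifs <;> simp

/-- Averaging over k with the weight e(-jk/p) keeps exactly the terms of f(τ/p) with exponent n/p, n
≡ j mod p. The condition for vanishing is crude, only meant to bound the exponents from below. -/
lemma exists_hasSum_etaPart (hp : p ≠ 0) (hm : m * (p + 1) = 24) (j : ℕ) :
    ∃ a : ℤ → ℂ, (∀ n : ℤ, n + j < -1 → a n = 0) ∧ ∀ τ : ℂ, 0 < τ.im →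
      HasSum (fun n : ℤ => a n * e ((n + j / p) * τ)) (etaPart p m j τ) := by
  have : NeZero p := ⟨hp⟩
  have hp0 : (p : ℂ) ≠ 0 := by exact_mod_cast hp
  obtain ⟨a, ha, hs⟩ := exists_hasSum_etaProduct hp hm
  refine ⟨fun n => a (p * n + j), fun n hn => ha _ ?_, fun τ hτ => ?_⟩
  · have h1 : (1 : ℤ) ≤ p := by exact_mod_cast Nat.one_le_iff_ne_zero.2 hp
    nlinarith
  have hfib : ∀ k : ZMod p, HasSum (fun n : ℤ => a n * e (n * τ / p) * ZMod.stdAddChar (k * (n : ZMod p)))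
      (etaFiber p m τ k) := by
    intro k
    have hk : 0 < ((τ + k.val) / p).im := by
      rw [div_natCast_im, add_im, natCast_im, add_zero]
      have := Nat.pos_of_ne_zero hp
      positivity
    refine (hs _ hk).congr_fun fun n => ?_
    have : k * (n : ZMod p) = ((k.val * n : ℤ) : ZMod p) := by push_cast; simp
    rw [this, stdAddChar_intCast, mul_assoc, ← e_add]
    congr 2
    push_cast
    ring
  have hsum : HasSum (fun n : ℤ => if (n : ZMod p) = j then a n * e (n * τ / p) else 0)
      (etaPart p m j τ) := by
    rw [etaPart_eq]
    have h1 := (hasSum_sum fun k (_ : k ∈ Finset.univ) =>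
      (hfib k).mul_left (ZMod.stdAddChar (-((j : ZMod p) * k)))).mul_left (1 / (p : ℂ))
    refine h1.congr_fun fun n => ?_
    have h2 : ∀ k : ZMod p, ZMod.stdAddChar (-((j : ZMod p) * k)) *
        (a n * e (n * τ / p) * ZMod.stdAddChar (k * (n : ZMod p))) =
        a n * e (n * τ / p) * ZMod.stdAddChar (k * ((n : ZMod p) - (j : ZMod p))) := by
      intro k
      rw [show k * ((n : ZMod p) - (j : ZMod p)) = -((j : ZMod p) * k) + k * (n : ZMod p) by ring, AddChar.map_add_eq_mul]
      ring
    simp_rw [h2]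
    rw [← Finset.mul_sum, sum_stdAddChar_mul]
    simp only [sub_eq_zero]
    split_ifs
    · field_simp
    · simp
  have hinj : Function.Injective fun n : ℤ => (p : ℤ) * n + j := by
    intro x y h
    simpa [hp] using h
  rw [← hinj.hasSum_iff] at hsum
  · refine hsum.congr_fun fun n => ?_
    simp only [Function.comp]
    rw [if_pos (by push_cast; simp)]
    congr 2
    push_cast
    field_simp
  · intro n hn
    rw [if_neg]
    intro h
    apply hn
    have : (p : ℤ) ∣ n - j := by
      rw [← ZMod.intCast_zmod_eq_zero_iff_dvd]
      push_cast
      rw [h, sub_self]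
    obtain ⟨x, hx⟩ := this
    exact ⟨x, by simp only; omega⟩

lemma isExponentDecomposition_etaPart (hp : p ≠ 0) (hm : m * (p + 1) = 24) :
    IsExponentDecomposition p (etaProduct p m) (etaPart p m) := by
  have : NeZero p := ⟨hp⟩
  have hp0 : (p : ℂ) ≠ 0 := by exact_mod_cast hp
  refine ⟨fun τ => ?_, fun j _ => ?_⟩
  · have h1 : ∑ j ∈ Finset.range p, etaPart p m j τ = 1 / p * ∑ j : ZMod p, ∑ k : ZMod p,
        ZMod.stdAddChar (-(j * k)) * etaFiber p m τ k := by
      rw [Finset.mul_sum]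
      refine Finset.sum_nbij' (fun k => (k : ZMod p)) (fun k => k.val) ?_ ?_ ?_ ?_ ?_
      · intros; simp
      · intro k _; exact Finset.mem_range.2 (ZMod.val_lt k)
      · intro k hk; exact ZMod.val_cast_of_lt (Finset.mem_range.1 hk)
      · intro k _; simp
      · intro k _; exact etaPart_eq k τ
    rw [h1, Finset.sum_comm]
    simp_rw [← Finset.sum_mul, ← mul_neg, sum_stdAddChar_mul]
    rw [Finset.sum_eq_single 0]
    · rw [if_pos neg_zero, etaFiber_zero]
      field_simp
    · intro k _ hk
      rw [if_neg (by simpa using hk), zero_mul]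
    · simp
  · obtain ⟨a, -, ha⟩ := exists_hasSum_etaPart hp hm j
    exact ⟨a, fun τ => ha τ τ.2⟩

/-- `F` has an expansion in rational powers of `q`, with exponents bounded below. -/
def HasPuiseuxExpansion (F : ℍ → ℂ) : Prop :=
  ∃ c : ℚ → ℂ, (∃ N : ℚ, ∀ n < N, c n = 0) ∧
    ∀ τ : ℍ, HasSum (fun n : ℚ => c n * e (n * (τ : ℂ))) (F τ)

lemma HasPuiseuxExpansion.add {F G : ℍ → ℂ} (hF : HasPuiseuxExpansion F)
    (hG : HasPuiseuxExpansion G) : HasPuiseuxExpansion fun τ => F τ + G τ := by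
  obtain ⟨c, ⟨N, hN⟩, hc⟩ := hF
  obtain ⟨d, ⟨K, hK⟩, hd⟩ := hG
  refine ⟨fun n => c n + d n, ⟨min N K, fun n hn => ?_⟩, fun τ => ?_⟩
  · change c n + d n = 0
    rw [hN n (lt_of_lt_of_le hn (min_le_left _ _)), hK n (lt_of_lt_of_le hn (min_le_right _ _)),
      add_zero]
  · simpa only [add_mul] using (hc τ).add (hd τ)

lemma hasPuiseuxExpansion_zero : HasPuiseuxExpansion fun _ => 0 :=
  ⟨fun _ => 0, ⟨0, fun _ _ => rfl⟩, fun τ => by simp [hasSum_zero]⟩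

lemma hasPuiseuxExpansion_of_hasSum_int {F : ℍ → ℂ} (a : ℤ → ℂ) (r : ℚ) (N : ℤ)
    (ha : ∀ n < N, a n = 0) (h : ∀ τ : ℍ, HasSum (fun n : ℤ => a n * e ((n + r) * (τ : ℂ))) (F τ)) :
    HasPuiseuxExpansion F := by
  have hinj : Function.Injective fun n : ℤ => (n : ℚ) + r := by
    intro x y hxy; simpa using hxy
  refine ⟨Function.extend (fun n : ℤ => (n : ℚ) + r) a 0, ⟨N + r, fun n hn => ?_⟩, fun τ => ?_⟩
  · by_cases hx : ∃ x : ℤ, (x : ℚ) + r = n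
    · obtain ⟨x, rfl⟩ := hx
      rw [hinj.extend_apply a 0 x]
      apply ha
      have : (x : ℚ) < N := by linarith
      exact_mod_cast this
    · exact Function.extend_apply' _ _ _ hx
  · rw [← hinj.hasSum_iff]
    · refine (h τ).congr_fun fun n => ?_
      simp only [Function.comp]
      rw [hinj.extend_apply a 0 n]
      push_cast
      rfl
    · intro n hn
      rw [Function.extend_apply' _ _ _ hn]
      simp

lemma hasPuiseuxExpansion_etaProduct (hp : p ≠ 0) (hm : m * (p + 1) = 24) :
    HasPuiseuxExpansion fun τ => etaProduct p m τ := by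
  obtain ⟨a, ha, hs⟩ := exists_hasSum_etaProduct hp hm
  refine hasPuiseuxExpansion_of_hasSum_int a 0 (-1) ha fun τ => ?_
  simpa using hs τ τ.2

lemma hasPuiseuxExpansion_etaPart (hp : p ≠ 0) (hm : m * (p + 1) = 24) (j : ℕ) :
    HasPuiseuxExpansion fun τ => etaPart p m j τ := by
  obtain ⟨a, ha, hs⟩ := exists_hasSum_etaPart hp hm j
  refine hasPuiseuxExpansion_of_hasSum_int a (j / p) (-1 - j) (fun n hn => ha n (by omega))
    fun τ => ?_
  simpa using hs τ τ.2

/-! ### Holomorphy -/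

lemma differentiableAt_etaProduct (hp : p ≠ 0) {τ : ℂ} (hτ : 0 < τ.im) :
    DifferentiableAt ℂ (etaProduct p m) τ := by
  have h1 : 0 < ((p : ℂ) * τ).im := by
    have h2 : ((p : ℂ) * τ).im = p * τ.im := by simp
    rw [h2]
    have := Nat.pos_of_ne_zero hp
    positivity
  have h2 : DifferentiableAt ℂ (fun z => eta z * eta (p * z)) τ :=
    (differentiableAt_eta_of_mem_upperHalfPlaneSet hτ).mul
      (DifferentiableAt.comp (g := eta) (f := fun z => (p : ℂ) * z) τ
        (differentiableAt_eta_of_mem_upperHalfPlaneSet h1) (by fun_prop))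
  exact h2.zpow (Or.inl (mul_ne_zero (eta_ne_zero hτ) (eta_ne_zero h1)))

lemma differentiableAt_etaPart (hp : p ≠ 0) (j : ℕ) {τ : ℂ} (hτ : 0 < τ.im) :
    DifferentiableAt ℂ (etaPart p m j) τ := by
  unfold etaPart
  refine DifferentiableAt.const_mul (DifferentiableAt.fun_sum fun k _ =>
    DifferentiableAt.const_mul ?_ _) _
  refine DifferentiableAt.comp (g := etaProduct p m) (f := fun z => (z + k) / (p : ℂ)) τ
    (differentiableAt_etaProduct hp ?_) (by fun_prop)
  rw [div_natCast_im, add_im, natCast_im, add_zero]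
  have := Nat.pos_of_ne_zero hp
  positivity

lemma mdifferentiable_of_differentiableAt {F : ℍ → ℂ} {G : ℂ → ℂ} (hFG : ∀ τ : ℍ, F τ = G τ)
    (hG : ∀ τ : ℂ, 0 < τ.im → DifferentiableAt ℂ G τ) :
    MDifferentiable (modelWithCornersSelf ℂ ℂ) (modelWithCornersSelf ℂ ℂ) F := by
  rw [UpperHalfPlane.mdifferentiable_iff]
  refine DifferentiableOn.congr (f := G) (fun z hz => (hG z hz).differentiableWithinAt)
    fun z hz => ?_
  simp [Function.comp, hFG, ofComplex_apply_of_im_pos hz]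

/-! ### The transformation under `S` -/

lemma zpow_mul_sqrt_div_I (p m : ℕ) (τ : ℂ) :
    (Real.sqrt p * τ / I) ^ (-(m : ℤ)) = I ^ m / (Real.sqrt p : ℂ) ^ m * τ ^ (-(m : ℤ)) := by
  rw [zpow_neg, zpow_neg, zpow_natCast, zpow_natCast, div_pow, mul_pow, inv_div]
  rw [div_mul_eq_div_div, div_eq_mul_inv]

lemma zpow_div_sqrt_mul_I (p m : ℕ) (τ : ℂ) :
    (τ / (Real.sqrt p * I)) ^ (-(m : ℤ)) = I ^ m * (Real.sqrt p : ℂ) ^ m * τ ^ (-(m : ℤ)) := by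
  rw [zpow_neg, zpow_neg, zpow_natCast, zpow_natCast, div_pow, mul_pow, inv_div, div_eq_mul_inv]
  ring

lemma etaChar_neg_inv [Fact p.Prime] (k : ZMod p) :
    etaChar p m (-k⁻¹) = etaChar p m (-k) := by
  have : IsSquare (-k⁻¹) ↔ IsSquare (-k) := by
    rw [← inv_neg, isSquare_inv]
  simp only [etaChar, this]
  congr

/-- The `S`-transformation of the vector `[γ = 0] f + (1/p) ∑ₖ ψ(-q(γ)k) f((τ + k)/p)`, given the
Gauss sums of the discriminant form `(D, q)`. -/
lemma vector_neg_inv (hp : p.Prime) (hm : m * (p + 1) = 24) [NeZero p]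
    {D : Type*} [Fintype D] [Zero D]
    [DecidableEq D] (q : D → ZMod p) (E : D → D → ℂ) (hE : ∀ γ, E γ 0 = 1)
    (h0 : ∀ γ, ∑ δ, E γ δ = if γ = 0 then (p : ℂ) ^ (m + 2) else 0)
    (hk : ∀ γ k, k ≠ 0 → ∑ δ, E γ δ * ZMod.stdAddChar (-(q δ * k)) =
      ZMod.stdAddChar (q γ * k⁻¹) * etaChar p m (-k) * ((Real.sqrt p : ℂ) ^ (m + 2) / I ^ m))
    {F : D → ℂ → ℂ} (hF : ∀ γ τ, F γ τ = (if γ = 0 then etaProduct p m τ else 0) +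
      1 / p * ∑ k : ZMod p, ZMod.stdAddChar (-(q γ * k)) * etaFiber p m τ k)
    (γ : D) {τ : ℂ} (hτ : 0 < τ.im) :
    F γ (-1 / τ) = I ^ m / (Real.sqrt p : ℂ) ^ (m + 2) * τ ^ (-(m : ℤ)) *
      ∑ δ, E γ δ * F δ τ := by
  have : Fact p.Prime := ⟨hp⟩
  have hp0 : (p : ℂ) ≠ 0 := by exact_mod_cast hp.ne_zero
  have hs0 : (Real.sqrt p : ℂ) ≠ 0 := by
    exact_mod_cast (Real.sqrt_pos.2 (Nat.cast_pos.2 hp.pos)).ne'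
  have hs2 := ofReal_sqrt_natCast_mul_self p
  have hI : (I : ℂ) ^ m ≠ 0 := pow_ne_zero _ I_ne_zero
  set s : ℂ := (Real.sqrt p : ℂ) with hs
  set t : ℂ := τ ^ (-(m : ℤ)) with ht
  set f : ℂ := etaProduct p m τ with hf
  -- Right-hand side: the term k = 0 survives only for γ = 0, by orthogonality of characters, and
  -- every other k is evaluated by its Gauss sum.
  have hR : ∑ δ, E γ δ * F δ τ = f + 1 / p * ((if γ = 0 then (p : ℂ) ^ (m + 2) else 0) *
      etaFiber p m τ 0 + ∑ k ∈ Finset.univ.erase (0 : ZMod p), ZMod.stdAddChar (q γ * k⁻¹) *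
        etaChar p m (-k) * (s ^ (m + 2) / I ^ m) * etaFiber p m τ k) := by
    have h1 : ∀ δ, E γ δ * F δ τ = (if δ = 0 then f else 0) + 1 / p * ∑ k : ZMod p,
        E γ δ * ZMod.stdAddChar (-(q δ * k)) * etaFiber p m τ k := by
      intro δ
      rw [hF, mul_add, Finset.mul_sum, Finset.mul_sum, Finset.mul_sum]
      congr 1
      · split_ifs with h
        · rw [h, hE, one_mul]
        · simp
      · exact Finset.sum_congr rfl fun k _ => by ring
    simp_rw [h1]
    rw [Finset.sum_add_distrib, Finset.sum_ite_eq' Finset.univ (0 : D) (fun _ => f),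
      if_pos (Finset.mem_univ _), ← Finset.mul_sum, Finset.sum_comm]
    simp_rw [← Finset.sum_mul]
    rw [← Finset.add_sum_erase _ _ (Finset.mem_univ (0 : ZMod p))]
    congr 3
    · simp only [mul_zero, neg_zero, AddChar.map_zero_eq_one, mul_one, h0]
    · exact Finset.sum_congr rfl fun k hk' => by rw [hk γ k (Finset.ne_of_mem_erase hk')]
  -- Left-hand side: k = 0 returns f(τ), and the other k are permuted by k ↦ -1/k.
  have hL : ∑ k : ZMod p, ZMod.stdAddChar (-(q γ * k)) * etaFiber p m (-1 / τ) k =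
      I ^ m / s ^ m * t * f + t * ∑ k ∈ Finset.univ.erase (0 : ZMod p),
        ZMod.stdAddChar (q γ * k⁻¹) * etaChar p m (-k) * etaFiber p m τ k := by
    rw [← Finset.add_sum_erase _ _ (Finset.mem_univ (0 : ZMod p))]
    congr 1
    · rw [mul_zero, neg_zero, AddChar.map_zero_eq_one, one_mul, etaFiber_neg_inv_zero hp.pos hτ,
        zpow_mul_sqrt_div_I]
    · rw [Finset.mul_sum]
      refine Finset.sum_nbij' (fun k => -k⁻¹) (fun k => -k⁻¹) ?_ ?_ ?_ ?_ ?_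
      · intro k hk'; simpa using hk'
      · intro k hk'; simpa using hk'
      · intro k _; simp [inv_neg]
      · intro k _; simp [inv_neg]
      · intro k hk'
        rw [etaFiber_neg_inv hp hm hτ (Finset.ne_of_mem_erase hk'), ← etaChar_neg_inv (-k⁻¹)]
        simp only [inv_neg, inv_inv, neg_neg, mul_neg]
        ring
  rw [hF, hL, hR]
  have hs3 : s ^ (m + 2) = s ^ m * p := by rw [pow_add, sq, hs2]
  have hps : (p : ℂ) ^ (m + 2) = s ^ m * s ^ m * p * p := by
    rw [pow_add, sq, ← hs2, mul_pow]
    ring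
  have hsm : s ^ m ≠ 0 := pow_ne_zero _ hs0
  have hfin : ∑ k ∈ Finset.univ.erase (0 : ZMod p), ZMod.stdAddChar (q γ * k⁻¹) *
        etaChar p m (-k) * (s ^ (m + 2) / I ^ m) * etaFiber p m τ k =
      (s ^ (m + 2) / I ^ m) * ∑ k ∈ Finset.univ.erase (0 : ZMod p),
        ZMod.stdAddChar (q γ * k⁻¹) * etaChar p m (-k) * etaFiber p m τ k := by
    rw [Finset.mul_sum]
    exact Finset.sum_congr rfl fun k _ => by ring
  rw [hfin]
  generalize ∑ k ∈ Finset.univ.erase (0 : ZMod p),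
        ZMod.stdAddChar (q γ * k⁻¹) * etaChar p m (-k) * etaFiber p m τ k = X
  by_cases hγ : γ = 0
  · rw [if_pos hγ, if_pos hγ, etaProduct_neg_inv hp.pos hτ, zpow_div_sqrt_mul_I, ← etaFiber_zero,
      hs3, hps]
    field_simp
    ring
  · rw [if_neg hγ, if_neg hγ, hs3]
    field_simp
    ring

end

end EtaProducts

/-! ### Blichfeldt's bound for lattice packings -/

section Blichfeldt

open MeasureTheory

variable {E : Type*} [NormedAddCommGroup E] [InnerProductSpace ℝ E]

lemma sum_sum_norm_sub_sq {ι : Type*} (t : Finset ι) (u : ι → E) :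
    ∑ i ∈ t, ∑ j ∈ t, ‖u i - u j‖ ^ 2 =
      2 * t.card * ∑ i ∈ t, ‖u i‖ ^ 2 - 2 * ‖∑ i ∈ t, u i‖ ^ 2 := by
  have h1 : ∀ i j, ‖u i - u j‖ ^ 2 = ‖u i‖ ^ 2 - 2 * inner ℝ (u i) (u j) + ‖u j‖ ^ 2 :=
    fun i j => norm_sub_sq_real _ _
  simp_rw [h1, Finset.sum_add_distrib, Finset.sum_sub_distrib, ← Finset.mul_sum, Finset.sum_const,
    ← inner_sum, ← sum_inner, real_inner_self_eq_norm_sq, nsmul_eq_mul, ← Finset.mul_sum]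
  ring

/-- For N points, ∑|u_i - u_j|² ≤ 2N ∑|u_i|², while the separation makes the left side at least
N(N-1)·2r. Hence ∑|u_i|² ≥ (N-1)r, which is the claim without the maximum; it is then applied to the
points whose term is nonnegative. -/
lemma sum_max_one_sub_norm_sq_le {ι : Type*} (s : Finset ι) (u : ι → E) {r : ℝ} (hr : 0 < r)
    (hu : ∀ i ∈ s, ∀ j ∈ s, i ≠ j → 2 * r ≤ ‖u i - u j‖ ^ 2) :
    ∑ i ∈ s, max 0 (1 - ‖u i‖ ^ 2 / r) ≤ 1 := by
  classical
  have key : ∀ t ⊆ s, ∑ i ∈ t, (1 - ‖u i‖ ^ 2 / r) ≤ 1 := by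
    intro t ht
    rcases t.eq_empty_or_nonempty with rfl | hne
    · simp
    have hk : (1 : ℝ) ≤ t.card := by exact_mod_cast hne.card_pos
    have h1 : ∑ i ∈ t, ∑ j ∈ t, (if i = j then 0 else 2 * r) ≤
        ∑ i ∈ t, ∑ j ∈ t, ‖u i - u j‖ ^ 2 := by
      refine Finset.sum_le_sum fun i hi => Finset.sum_le_sum fun j hj => ?_
      split_ifs with h
      · positivity
      · exact hu i (ht hi) j (ht hj) h
    have h2 : ∑ i ∈ t, ∑ j ∈ t, (if i = j then 0 else 2 * r) =
        t.card * (t.card - 1) * (2 * r) := by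
      have : ∀ i ∈ t, ∑ j ∈ t, (if i = j then 0 else 2 * r) = (t.card - 1) * (2 * r) := by
        intro i hi
        have h3 : ∀ j, (if i = j then 0 else 2 * r) = 2 * r - if i = j then 2 * r else 0 := by
          intro j; split_ifs <;> ring
        simp_rw [h3, Finset.sum_sub_distrib, Finset.sum_ite_eq, if_pos hi, Finset.sum_const,
          nsmul_eq_mul]
        ring
      rw [Finset.sum_congr rfl this, Finset.sum_const, nsmul_eq_mul]
      ring
    rw [h2, sum_sum_norm_sub_sq] at h1
    rw [Finset.sum_sub_distrib, ← Finset.sum_div, Finset.sum_const, nsmul_eq_mul, mul_one]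
    have h4 : (t.card - 1) * r ≤ ∑ i ∈ t, ‖u i‖ ^ 2 := by
      have h5 := sq_nonneg ‖∑ i ∈ t, u i‖
      have h6 : t.card * ((t.card - 1) * r) ≤ t.card * ∑ i ∈ t, ‖u i‖ ^ 2 := by linarith
      exact le_of_mul_le_mul_left h6 (by linarith)
    have h7 : (t.card : ℝ) - 1 ≤ (∑ i ∈ t, ‖u i‖ ^ 2) / r := (le_div_iff₀ hr).2 h4
    linarith
  have h := key (s.filter fun i => 0 ≤ 1 - ‖u i‖ ^ 2 / r) (Finset.filter_subset _ _)
  rw [Finset.sum_filter] at h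
  refine le_trans (le_of_eq (Finset.sum_congr rfl fun i _ => ?_)) h
  split_ifs with h0
  · exact max_eq_right h0
  · exact max_eq_left (le_of_not_ge h0)

variable [FiniteDimensional ℝ E] [MeasurableSpace E] [BorelSpace E]

/-- Layer cake: the superlevel set at height t is a ball of radius √(r(1-t)), and integrating
(1-t)^h over [0,1] turns the h! of the ball volume into (h+1)!. -/
lemma le_lintegral_max_one_sub_norm_sq [Nontrivial E] {h : ℕ} (hE : Module.finrank ℝ E = 2 * h)
    {r : ℝ} (hr : 0 < r) :
    ENNReal.ofReal ((Real.pi * r) ^ h / (h + 1).factorial) ≤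
      ∫⁻ x : E, ENNReal.ofReal (max 0 (1 - ‖x‖ ^ 2 / r)) := by
  rw [lintegral_eq_lintegral_meas_lt (f := fun x : E => max 0 (1 - ‖x‖ ^ 2 / r)) volume
    (Filter.Eventually.of_forall fun x => le_max_left _ _) (by fun_prop)]
  have h1 : ∀ t ∈ Set.Ioc (0 : ℝ) 1, volume {x : E | t < max 0 (1 - ‖x‖ ^ 2 / r)} =
      ENNReal.ofReal ((r * (1 - t)) ^ h * (Real.pi ^ h / h.factorial)) := by
    intro t ht
    have h2 : {x : E | t < max 0 (1 - ‖x‖ ^ 2 / r)} = Metric.ball 0 (Real.sqrt (r * (1 - t))) := by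
      ext x
      rw [Set.mem_ofPred_eq, mem_ball_zero_iff, Real.lt_sqrt (norm_nonneg _), lt_max_iff,
        or_iff_right ht.1.not_gt, lt_sub_comm, div_lt_iff₀ hr, mul_comm]
    rw [h2, InnerProductSpace.volume_ball_of_dim_even hE, hE, ← ENNReal.ofReal_pow (Real.sqrt_nonneg _),
      pow_mul, Real.sq_sqrt (mul_nonneg hr.le (by linarith [ht.2])), ENNReal.ofReal_mul]
    exact pow_nonneg (mul_nonneg hr.le (by linarith [ht.2])) _
  calc ENNReal.ofReal ((Real.pi * r) ^ h / (h + 1).factorial)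
      = ∫⁻ t in Set.Ioc (0 : ℝ) 1,
          ENNReal.ofReal ((r * (1 - t)) ^ h * (Real.pi ^ h / h.factorial)) := by
        rw [← ofReal_integral_eq_lintegral_ofReal]
        · congr 1
          rw [← intervalIntegral.integral_of_le zero_le_one]
          simp_rw [mul_pow]
          rw [intervalIntegral.integral_mul_const, intervalIntegral.integral_const_mul,
            intervalIntegral.integral_comp_sub_left (fun x => x ^ h) 1, integral_pow]
          rw [Nat.factorial_succ]
          push_cast
          have := Nat.cast_add_one_pos (α := ℝ) h
          have := Nat.factorial_pos h
          simp
          field_simp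
        · exact (Continuous.integrableOn_Icc (by fun_prop)).mono_set Set.Ioc_subset_Icc_self
        · refine (ae_restrict_iff' measurableSet_Ioc).2 (Filter.Eventually.of_forall fun t ht => ?_)
          have : 0 ≤ 1 - t := by linarith [ht.2]
          simp only [Pi.zero_apply]
          positivity
    _ = ∫⁻ t in Set.Ioc (0 : ℝ) 1, volume {x : E | t < max 0 (1 - ‖x‖ ^ 2 / r)} :=
        (setLIntegral_congr_fun measurableSet_Ioc h1).symm
    _ ≤ _ := lintegral_mono_set Set.Ioc_subset_Ioi_self

/-- Blichfeldt's bound on the minimum of a lattice in even dimension `2h`. -/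
theorem blichfeldt_span [Nontrivial E] {ι : Type*} [Fintype ι] (b : Module.Basis ι ℝ E) {h : ℕ}
    (hE : Module.finrank ℝ E = 2 * h) {μ : ℝ} (hμ : 0 < μ)
    (hb : ∀ x ∈ Submodule.span ℤ (Set.range b), x ≠ 0 → μ ≤ ‖x‖ ^ 2) :
    ENNReal.ofReal ((Real.pi * (μ / 2)) ^ h / (h + 1).factorial) ≤
      volume (ZSpan.fundamentalDomain b) := by
  have : Countable (Submodule.span ℤ (Set.range b)) := inferInstance
  refine (le_lintegral_max_one_sub_norm_sq hE (half_pos hμ)).trans ?_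
  -- Unfolding: the integral over E is the integral over a fundamental domain of the sum over
  -- lattice translates, and that sum is at most 1 at each point.
  rw [(ZSpan.isAddFundamentalDomain' b volume).lintegral_eq_tsum'',
    ← lintegral_tsum fun g => by fun_prop]
  calc _ ≤ ∫⁻ x in ZSpan.fundamentalDomain b, 1 := by
        refine lintegral_mono fun x => ENNReal.summable.tsum_le_of_sum_le fun s => ?_
        rw [← ENNReal.ofReal_sum_of_nonneg fun i _ => le_max_left _ _]
        refine ENNReal.ofReal_le_one.2 (sum_max_one_sub_norm_sq_le s (fun g => g +ᵥ x)
          (half_pos hμ) fun i _ j _ hij => ?_)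
        have h1 := hb (i - j) (sub_mem i.2 j.2) fun h0 => hij (Subtype.ext (sub_eq_zero.1 h0))
        have h2 : (i +ᵥ x : E) - (j +ᵥ x) = i - j := add_sub_add_right_eq_sub _ _ _
        rw [h2]
        linarith
    _ = _ := by simp

open scoped MatrixOrder in
/-- Blichfeldt's bound in terms of a Gram matrix. -/
theorem blichfeldt_gram {ι : Type*} [Fintype ι] [DecidableEq ι] [Nonempty ι] {h : ℕ}
    (hι : Fintype.card ι = 2 * h) (A : Matrix ι ι ℝ) (hA : A.PosDef) {μ : ℝ} (hμ : 0 < μ)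
    (hb : ∀ x : ι → ℤ, x ≠ 0 → μ ≤ (fun i => (x i : ℝ)) ⬝ᵥ A.mulVec fun i => (x i : ℝ)) :
    (Real.pi * (μ / 2)) ^ h / (h + 1).factorial ≤ Real.sqrt A.det := by
  -- The columns of the symmetric square root of A span a Euclidean lattice with Gram matrix A and
  -- covolume det C = √(det A).
  set C : Matrix ι ι ℝ := CFC.sqrt A with hC
  have hCC : C * C = A := CFC.sqrt_mul_sqrt_self A hA.posSemidef.nonneg
  have hCt : C.transpose = C := by
    have := (Matrix.nonneg_iff_posSemidef.1 (CFC.sqrt_nonneg A)).isHermitian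
    simpa [Matrix.IsHermitian, Matrix.conjTranspose_eq_transpose_of_trivial] using this
  have hdet : C.det = Real.sqrt A.det := by
    have := Matrix.PosSemidef.det_sqrt hA.posSemidef
    simpa using this
  have hdet0 : 0 < C.det := by rw [hdet]; exact Real.sqrt_pos.2 hA.det_pos
  let b₀ := EuclideanSpace.basisFun ι ℝ
  let e := Matrix.toLinearEquiv b₀.toBasis C (isUnit_iff_ne_zero.2 hdet0.ne')
  let b := b₀.toBasis.map e
  have hbi : ∀ i j, b i j = C j i := by
    intro i j
    have : b i = ∑ k, C k i • b₀.toBasis k := Matrix.toLin_self b₀.toBasis b₀.toBasis C i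
    rw [this]
    simp [b₀, Pi.single_apply]
  have h1 := blichfeldt_span b (h := h) (by simp [hι]) hμ ?_
  · have h2 : MeasureTheory.volume (ZSpan.fundamentalDomain b) = ENNReal.ofReal C.det := by
      rw [ZSpan.measure_fundamentalDomain b _ b₀.toBasis,
        measure_congr (ZSpan.fundamentalDomain_ae_parallelepiped b₀.toBasis volume)]
      have h5 : b₀.toBasis.det b = C.det := by
        rw [Module.Basis.det_apply]
        congr 1
        ext i j
        rw [Module.Basis.toMatrix_apply]
        exact hbi j i
      have h6 : volume (parallelepiped b₀.toBasis) = 1 := by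
        rw [b₀.coe_toBasis]; exact b₀.volume_parallelepiped
      rw [h5, h6, mul_one, abs_of_pos hdet0]
    rw [h2, ENNReal.ofReal_le_ofReal_iff hdet0.le, hdet] at h1
    exact h1
  · intro x hx hx0
    obtain ⟨c, rfl⟩ := (Submodule.mem_span_range_iff_exists_fun ℤ).1 hx
    have h3 : ∑ i, c i • b i = WithLp.toLp 2 (C.mulVec fun i => (c i : ℝ)) := by
      ext j
      simp [Matrix.mulVec, dotProduct, hbi, mul_comm]
    rw [h3, EuclideanSpace.norm_sq_eq]
    have h4 : ∑ i, ‖(WithLp.toLp 2 (C.mulVec fun i => (c i : ℝ)) : EuclideanSpace ℝ ι) i‖ ^ 2 =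
        (fun i => (c i : ℝ)) ⬝ᵥ A.mulVec fun i => (c i : ℝ) := by
      rw [← hCC, ← Matrix.mulVec_mulVec, Matrix.dotProduct_mulVec, ← Matrix.mulVec_transpose, hCt]
      simp [dotProduct, sq]
    rw [h4]
    apply hb
    rintro rfl
    simp at hx0

end Blichfeldt

/-! ### Quadratic Gauss sums -/

section GaussSum

open Filter Topology Complex

/-- Only the term n = 0 survives as Im τ → ∞; the terms at τ = i dominate the rest once Im τ ≥ 1. -/
lemma tendsto_jacobiTheta₂_one {ι : Type*} {l : Filter ι} {τ : ι → ℂ} (z : ℝ)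
    (hτ : Tendsto (fun i => (τ i).im) l atTop) :
    Tendsto (fun i => jacobiTheta₂ z (τ i)) l (𝓝 1) := by
  have h1 : ∑' n : ℤ, (if n = 0 then (1 : ℂ) else 0) = 1 := tsum_ite_eq 0 _
  rw [← h1]
  have hsum : Summable fun n : ℤ => ‖jacobiTheta₂_term n 0 I‖ :=
    ((summable_jacobiTheta₂_term_iff 0 I).2 (by simp)).norm
  refine tendsto_tsum_of_dominated_convergence hsum (fun n => ?_) ?_
  · split_ifs with hn
    · subst hn
      simpa [jacobiTheta₂_term] using tendsto_const_nhds
    · rw [tendsto_zero_iff_norm_tendsto_zero]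
      simp_rw [norm_jacobiTheta₂_term, ofReal_im, mul_zero, sub_zero]
      refine Real.tendsto_exp_atBot.comp (hτ.const_mul_atTop_of_neg ?_)
      have : (0 : ℝ) < (n : ℝ) ^ 2 := by positivity
      nlinarith [Real.pi_pos]
  · filter_upwards [hτ.eventually_ge_atTop 1] with i hi n
    rw [norm_jacobiTheta₂_term, norm_jacobiTheta₂_term]
    simp only [ofReal_im, mul_zero, sub_zero, zero_im, I_im, mul_one]
    apply Real.exp_le_exp.2
    have : (0 : ℝ) ≤ (n : ℝ) ^ 2 := by positivity
    nlinarith [Real.pi_pos, mul_nonneg (mul_nonneg Real.pi_pos.le this) (sub_nonneg.2 hi)]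

variable {a : ℕ}

/-- First evaluation of θ near the rational point 1/(2a): split n mod 2a. Each class contributes one
term of the Gauss sum times a theta series on the imaginary axis, which is then inverted so that its
parameter tends to i∞ as y → 0. -/
lemma jacobiTheta₂_zero_eq_sum (ha : 0 < a) {y : ℝ} (hy : 0 < y) :
    jacobiTheta₂ 0 (1 / (2 * a) + y * I) =
      ∑ x ∈ Finset.range (2 * a), e (x ^ 2 / (4 * a)) * (1 / ((4 * a ^ 2 * y : ℝ) : ℂ) ^ (1 / 2 : ℂ) *
        jacobiTheta₂ ((x / (2 * a) : ℝ) : ℂ) (I / (4 * a ^ 2 * y : ℝ))) := by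
  have : NeZero (2 * a) := ⟨by omega⟩
  have ha0 : (a : ℂ) ≠ 0 := by exact_mod_cast ha.ne'
  have hy0 : (y : ℂ) ≠ 0 := by exact_mod_cast hy.ne'
  have hτ : 0 < (1 / (2 * a) + y * I : ℂ).im := by
    have : (1 / (2 * a) : ℂ) = ((1 / (2 * a) : ℝ) : ℂ) := by push_cast; ring
    rw [this]; simpa using hy
  have hα : 0 < (((4 * a ^ 2 * y : ℝ) : ℂ) * I).im := by
    rw [im_ofReal_mul]; simp; positivity
  have h1 := (Int.divModEquiv (2 * a)).symm.hasSum_iff.2 (hasSum_jacobiTheta₂_term 0 hτ)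
  have h2 : ∀ (k : ℤ) (x : Fin (2 * a)), jacobiTheta₂_term ((Int.divModEquiv (2 * a)).symm (k, x)) 0
      (1 / (2 * a) + y * I) = e (x ^ 2 / (4 * a)) * (cexp (-Real.pi * y * x ^ 2) *
        jacobiTheta₂_term k (2 * I * a * x * y) ((4 * a ^ 2 * y : ℝ) * I)) := by
    intro k x
    rw [Int.divModEquiv_symm_apply, jacobiTheta₂_term, jacobiTheta₂_term, e, ← Complex.exp_add,
      ← Complex.exp_add, Complex.exp_eq_exp_iff_exists_int]
    refine ⟨a * k ^ 2 + k * x, ?_⟩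
    push_cast
    field_simp
    ring_nf
    simp only [I_sq]
    ring
  have h3 : HasSum (fun x : Fin (2 * a) => e (x ^ 2 / (4 * a)) * (cexp (-Real.pi * y * x ^ 2) *
      jacobiTheta₂ (2 * I * a * x * y) ((4 * a ^ 2 * y : ℝ) * I)))
      (jacobiTheta₂ 0 (1 / (2 * a) + y * I)) := by
    have h4 := (Equiv.prodComm (Fin (2 * a)) ℤ).hasSum_iff.2 h1
    refine h4.prod_fiberwise fun x => ?_
    simp only [Function.comp, Equiv.prodComm_apply, Prod.swap, h2]
    exact ((hasSum_jacobiTheta₂_term _ hα).mul_left _).mul_left _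
  rw [h3.unique (hasSum_fintype _), Finset.sum_range fun x : ℕ => _]
  refine Finset.sum_congr rfl fun x _ => ?_
  congr 1
  rw [jacobiTheta₂_functional_equation]
  have hI : -I * (((4 * a ^ 2 * y : ℝ) : ℂ) * I) = ((4 * a ^ 2 * y : ℝ) : ℂ) := by
    linear_combination -((4 * a ^ 2 * y : ℝ) : ℂ) * I_mul_I
  have hz : (2 * I * a * x * y : ℂ) / ((4 * a ^ 2 * y : ℝ) * I) = ((x / (2 * a) : ℝ) : ℂ) := by
    push_cast
    field_simp
    ring
  have ht : -1 / (((4 * a ^ 2 * y : ℝ) : ℂ) * I) = I / (4 * a ^ 2 * y : ℝ) := by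
    push_cast
    field_simp
    rw [I_sq]
  have hx : -Real.pi * I * (2 * I * a * x * y : ℂ) ^ 2 / ((4 * a ^ 2 * y : ℝ) * I) =
      Real.pi * y * x ^ 2 := by
    push_cast
    field_simp
    rw [I_sq]
    ring
  have h5 : cexp (-Real.pi * y * x ^ 2) * cexp (Real.pi * y * x ^ 2) = 1 := by
    rw [← Complex.exp_add, ← Complex.exp_zero]
    ring_nf
  rw [hI, hz, ht, hx]
  linear_combination (1 / ((4 * a ^ 2 * y : ℝ) : ℂ) ^ (1 / 2 : ℂ) *
    jacobiTheta₂ ((x / (2 * a) : ℝ) : ℂ) (I / (4 * a ^ 2 * y : ℝ))) * h5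

lemma jacobiTheta₂_zero_add_two_mul (τ : ℂ) (n : ℕ) :
    jacobiTheta₂ 0 (τ + 2 * n) = jacobiTheta₂ 0 τ := by
  induction n with
  | zero => simp
  | succ n ih => rw [← ih, ← jacobiTheta₂_add_right 0 (τ + 2 * n)]; push_cast; ring_nf

/-- Second evaluation of the same value: invert, translate by the even integer 2a, invert again. The
parameter again goes to i∞ as y → 0, and no sum appears. -/
lemma jacobiTheta₂_zero_eq_mul (ha : 0 < a) {y : ℝ} (hy : 0 < y) :
    jacobiTheta₂ 0 (1 / (2 * a) + y * I) =
      1 / (-I * (1 / (2 * a) + y * I)) ^ (1 / 2 : ℂ) *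
        (1 / ((4 * a ^ 2 * y : ℝ) : ℂ) ^ (1 / 2 : ℂ) * (1 + 2 * a * y * I) ^ (1 / 2 : ℂ) *
        jacobiTheta₂ 0 (I / (4 * a ^ 2 * y : ℝ) - 1 / (2 * a))) := by
  have ha0 : (a : ℂ) ≠ 0 := by exact_mod_cast ha.ne'
  have hy0 : (y : ℂ) ≠ 0 := by exact_mod_cast hy.ne'
  have hα : (0 : ℝ) < 4 * a ^ 2 * y := by positivity
  have hre : (1 + 2 * a * y * I : ℂ).re = 1 := by simp
  have hw : (1 + 2 * a * y * I : ℂ) ≠ 0 := by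
    intro h; rw [h] at hre; simp at hre
  have hτ : (1 / (2 * a) + y * I : ℂ) = (1 + 2 * a * y * I) / (2 * a) := by
    field_simp
  rw [jacobiTheta₂_functional_equation]
  simp only [ne_eq, OfNat.ofNat_ne_zero, not_false_eq_true, zero_pow, mul_zero, zero_div,
    Complex.exp_zero, mul_one]
  congr 1
  rw [← jacobiTheta₂_zero_add_two_mul _ a, jacobiTheta₂_functional_equation]
  simp only [ne_eq, OfNat.ofNat_ne_zero, not_false_eq_true, zero_pow, mul_zero, zero_div,
    Complex.exp_zero, mul_one]
  have h1 : -1 / (1 / (2 * a) + y * I) + 2 * (a : ℂ) =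
      I * (((4 * a ^ 2 * y : ℝ) : ℂ) * (1 + 2 * a * y * I)⁻¹) := by
    rw [hτ]
    push_cast
    field_simp
    ring
  have h2 : -I * (I * (((4 * a ^ 2 * y : ℝ) : ℂ) * (1 + 2 * a * y * I)⁻¹)) =
      ((4 * a ^ 2 * y : ℝ) : ℂ) * (1 + 2 * a * y * I)⁻¹ := by
    linear_combination -(((4 * a ^ 2 * y : ℝ) : ℂ) * (1 + 2 * a * y * I)⁻¹) * I_mul_I
  have h3 : -1 / (I * (((4 * a ^ 2 * y : ℝ) : ℂ) * (1 + 2 * a * y * I)⁻¹)) =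
      I / (4 * a ^ 2 * y : ℝ) - 1 / (2 * a) := by
    push_cast
    field_simp
    linear_combination -2 * I_sq
  rw [h1, h2, h3]
  congr 1
  have h4 : (((4 * a ^ 2 * y : ℝ) : ℂ) * (1 + 2 * a * y * I)⁻¹) ≠ 0 :=
    mul_ne_zero (by exact_mod_cast hα.ne') (inv_ne_zero hw)
  have hlog : log (((4 * a ^ 2 * y : ℝ) : ℂ) * (1 + 2 * a * y * I)⁻¹) =
      log ((4 * a ^ 2 * y : ℝ) : ℂ) - log (1 + 2 * a * y * I) := by
    rw [Complex.log_ofReal_mul hα (inv_ne_zero hw), Complex.log_inv, ofReal_log hα.le]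
    · ring
    · intro h
      rw [Complex.arg_eq_pi_iff, hre] at h
      linarith [h.1]
  rw [cpow_def_of_ne_zero h4, cpow_def_of_ne_zero hw, cpow_def_of_ne_zero (by exact_mod_cast hα.ne'),
    hlog]
  simp only [one_div, ← Complex.exp_neg, ← Complex.exp_add]
  congr 1
  ring

/-- The quadratic Gauss sum `∑_{x mod 2a} e(x²/4a) = √(2a) e(1/8)`. -/
theorem sum_e_sq_div (ha : 0 < a) :
    ∑ x ∈ Finset.range (2 * a), e (x ^ 2 / (4 * a)) = Real.sqrt (2 * a) * e (1 / 8) := by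
  have ha0 : (a : ℂ) ≠ 0 := by exact_mod_cast ha.ne'
  have haR : (0 : ℝ) < a := by exact_mod_cast ha
  have him : Tendsto (fun y : ℝ => 1 / (4 * a ^ 2 * y)) (𝓝[>] 0) atTop := by
    have := (tendsto_inv_nhdsGT_zero (𝕜 := ℝ)).const_mul_atTop (r := 1 / (4 * (a : ℝ) ^ 2))
      (by positivity)
    refine this.congr fun y => ?_
    simp [mul_comm]
  have hL : Tendsto (fun y : ℝ => ∑ x ∈ Finset.range (2 * a), e (x ^ 2 / (4 * a)) *
      jacobiTheta₂ ((x / (2 * a) : ℝ) : ℂ) (I / (4 * a ^ 2 * y : ℝ))) (𝓝[>] 0)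
      (𝓝 (∑ x ∈ Finset.range (2 * a), e (x ^ 2 / (4 * a)) * 1)) := by
    refine tendsto_finsetSum _ fun x _ => (tendsto_jacobiTheta₂_one _ ?_).const_mul _
    refine him.congr fun y => ?_
    rw [div_ofReal_im, I_im]
  have hR : Tendsto (fun y : ℝ => 1 / (-I * (1 / (2 * a) + y * I)) ^ (1 / 2 : ℂ) *
      ((1 + 2 * a * y * I) ^ (1 / 2 : ℂ) *
        jacobiTheta₂ 0 (I / (4 * a ^ 2 * y : ℝ) - 1 / (2 * a)))) (𝓝[>] 0)
      (𝓝 (1 / (-I * (1 / (2 * a) + (0 : ℝ) * I)) ^ (1 / 2 : ℂ) *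
        ((1 + 2 * a * (0 : ℝ) * I) ^ (1 / 2 : ℂ) * 1))) := by
    have h0 : Tendsto (fun y : ℝ => y) (𝓝[>] 0) (𝓝 0) := tendsto_nhdsWithin_of_tendsto_nhds tendsto_id
    have hslit : (-I * (1 / (2 * a) + (0 : ℝ) * I) : ℂ) ∈ slitPlane := by
      right
      have : (1 / (2 * a) + (0 : ℝ) * I : ℂ) = ((1 / (2 * a) : ℝ) : ℂ) := by push_cast; ring
      rw [this, im_mul_ofReal]
      simp [haR.ne']
    refine Tendsto.mul ?_ (Tendsto.mul ?_ ?_)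
    · refine Tendsto.div tendsto_const_nhds ?_ ?_
      · refine ContinuousAt.tendsto (x := (0 : ℝ)) (f := fun y : ℝ =>
          (-I * (1 / (2 * a) + y * I)) ^ (1 / 2 : ℂ)) ?_ |>.comp h0
        exact ContinuousAt.cpow (by fun_prop) (by fun_prop) hslit
      · rw [Ne, cpow_eq_zero_iff]
        rintro ⟨h, -⟩
        rw [h] at hslit
        exact zero_notMem_slitPlane hslit
    · refine ContinuousAt.tendsto (x := (0 : ℝ)) (f := fun y : ℝ =>
          (1 + 2 * a * y * I) ^ (1 / 2 : ℂ)) ?_ |>.comp h0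
      exact ContinuousAt.cpow (by fun_prop) (by fun_prop) (by simp)
    · have := tendsto_jacobiTheta₂_one (l := 𝓝[>] (0 : ℝ))
        (τ := fun y : ℝ => I / (4 * a ^ 2 * y : ℝ) - 1 / (2 * a)) 0 ?_
      · simpa using this
      · refine him.congr fun y => ?_
        have : (1 / (2 * a) : ℂ) = ((1 / (2 * a) : ℝ) : ℂ) := by push_cast; ring
        rw [this, sub_im, ofReal_im, sub_zero, div_ofReal_im, I_im]
  -- Both evaluations contain the singular factor (4a²y)^{-1/2}; it is cancelled before letting y →
  -- 0.
  have hLR : ∀ᶠ y : ℝ in 𝓝[>] 0, ∑ x ∈ Finset.range (2 * a), e (x ^ 2 / (4 * a)) *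
      jacobiTheta₂ ((x / (2 * a) : ℝ) : ℂ) (I / (4 * a ^ 2 * y : ℝ)) =
      1 / (-I * (1 / (2 * a) + y * I)) ^ (1 / 2 : ℂ) * ((1 + 2 * a * y * I) ^ (1 / 2 : ℂ) *
        jacobiTheta₂ 0 (I / (4 * a ^ 2 * y : ℝ) - 1 / (2 * a))) := by
    filter_upwards [self_mem_nhdsWithin] with y hy
    have hα : (((4 * a ^ 2 * y : ℝ) : ℂ) ^ (1 / 2 : ℂ)) ≠ 0 := by
      rw [Ne, cpow_eq_zero_iff]
      rintro ⟨h, -⟩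
      have hy' : (0 : ℝ) < y := hy
      have : (0 : ℝ) < 4 * a ^ 2 * y := by positivity
      exact this.ne' (by exact_mod_cast h)
    have h1 := jacobiTheta₂_zero_eq_sum ha hy
    rw [jacobiTheta₂_zero_eq_mul ha hy] at h1
    have h2 := congrArg (fun z => (((4 * a ^ 2 * y : ℝ) : ℂ) ^ (1 / 2 : ℂ)) * z) h1
    rw [Finset.mul_sum] at h2
    refine Eq.trans (Finset.sum_congr rfl fun x _ => ?_) (h2.symm.trans ?_)
    · generalize ((4 * a ^ 2 * y : ℝ) : ℂ) ^ (1 / 2 : ℂ) = α at hα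
      rw [one_div, mul_left_comm, mul_inv_cancel_left₀ hα]
    · generalize ((4 * a ^ 2 * y : ℝ) : ℂ) ^ (1 / 2 : ℂ) = α at hα
      field_simp
  have := tendsto_nhds_unique (hL.congr' hLR) hR
  simp only [mul_one] at this
  rw [this]
  -- The limit is the inverse principal square root of -i/(2a), whose argument is -π/2; this
  -- produces √(2a) e(1/8).
  have h1 : (-I * (1 / (2 * a) + (0 : ℝ) * I) : ℂ) = ((1 / (2 * a) : ℝ) : ℂ) * (-I) := by
    push_cast; ring
  have h2 : (0 : ℝ) < 1 / (2 * a) := by positivity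
  rw [h1, cpow_def_of_ne_zero (mul_ne_zero (by exact_mod_cast h2.ne') (neg_ne_zero.2 I_ne_zero)),
    Complex.log_ofReal_mul h2 (neg_ne_zero.2 I_ne_zero), Complex.log_neg_I, one_div (cexp _),
    ← Complex.exp_neg]
  simp only [ofReal_zero, mul_zero, zero_mul, add_zero, one_cpow, mul_one]
  rw [one_div (2 * (a : ℝ)), Real.log_inv, Real.sqrt_eq_rpow, Real.rpow_def_of_pos (by positivity), e,
    ofReal_exp, ← Complex.exp_add]
  congr 1
  push_cast
  ring

end GaussSum

/-! ### Gauss sums of discriminant forms -/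

section FiniteGroups

/-- The sum of a nontrivial multiplicative function over a finite group vanishes. -/
lemma sum_eq_zero_of_exists_ne_one {C : Type*} [AddCommGroup C] [Fintype C] (χ : C → ℂ)
    (hχ : ∀ a b, χ (a + b) = χ a * χ b) (h : ∃ a, χ a ≠ 1) : ∑ a, χ a = 0 := by
  obtain ⟨a, ha⟩ := h
  have h1 : ∑ b, χ b = χ a * ∑ b, χ b := by
    rw [Finset.mul_sum]
    simp_rw [← hχ]
    exact (Fintype.sum_equiv (Equiv.addLeft a) _ _ fun _ => rfl).symm
  have h2 : (χ a - 1) * ∑ b, χ b = 0 := by rw [sub_mul, ← h1, one_mul, sub_self]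
  exact (mul_eq_zero.1 h2).resolve_left (sub_ne_zero.2 ha)

/-- Summation of `f` over the fibres of a surjective homomorphism. -/
lemma sum_comp_surjective {E D : Type*} [AddCommGroup E] [AddCommGroup D] [Fintype E] [Fintype D]
    (β : E →+ D) (hβ : Function.Surjective β) (f : D → ℂ) :
    ∑ x, f (β x) = (Nat.card β.ker : ℂ) * ∑ d, f d := by
  classical
  rw [← Finset.sum_fiberwise_of_maps_to (s := Finset.univ) (t := Finset.univ) (g := β)
    (fun _ _ => Finset.mem_univ _), Finset.mul_sum]
  refine Finset.sum_congr rfl fun d _ => ?_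
  obtain ⟨x₀, rfl⟩ := hβ d
  rw [Finset.sum_congr rfl (g := fun _ => f (β x₀)) fun x hx => by rw [(Finset.mem_filter.1 hx).2],
    Finset.sum_const, nsmul_eq_mul]
  congr 2
  rw [Nat.card_eq_fintype_card, Fintype.card_subtype]
  refine Finset.card_bij' (fun x _ => x - x₀) (fun x _ => x + x₀) ?_ ?_ ?_ ?_ <;>
    simp +contextual [AddMonoidHom.mem_ker]

/-- A quadratic Gauss sum over `H` reduces to the subquotient `D = C^⊥ / C` for an isotropic
subgroup `C`. Here `E = C^⊥`. -/
lemma sum_eq_card_ker_mul_sum {C E D H : Type*} [AddCommGroup C] [AddCommGroup E] [AddCommGroup D]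
    [AddCommGroup H] [Fintype C] [Fintype E] [Fintype D] [Fintype H] (ι : C → H) (α : E →+ H)
    (hα : Function.Injective α) (β : E →+ D) (hβ : Function.Surjective β) (f : H → ℂ) (fD : D → ℂ)
    (χ : H → C → ℂ) (hf : ∀ x c, f (x + ι c) = f x * χ x c)
    (hχ : ∀ x a b, χ x (a + b) = χ x a * χ x b)
    (hχα : ∀ x, x ∈ Set.range α ↔ ∀ c, χ x c = 1) (hfD : ∀ y, f (α y) = fD (β y)) :
    ∑ x, f x = (Nat.card β.ker : ℂ) * ∑ d, fD d := by
  classical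
  have hC : (Fintype.card C : ℂ) ≠ 0 := by exact_mod_cast Fintype.card_ne_zero
  -- Average over translates by C: each x is weighted by a full character sum over C, which vanishes
  -- unless x is orthogonal to C.
  have h1 : (Fintype.card C : ℂ) * ∑ x, f x =
      (Fintype.card C : ℂ) * ∑ x, if x ∈ Set.range α then f x else 0 := by
    calc (Fintype.card C : ℂ) * ∑ x, f x = ∑ c : C, ∑ x, f (x + ι c) := by
          rw [Finset.sum_congr (s₁ := Finset.univ) rfl fun c _ =>
            Fintype.sum_equiv (Equiv.addRight (ι c)) (fun x => f (x + ι c)) f fun _ => rfl]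
          simp
      _ = ∑ x, f x * ∑ c, χ x c := by
          rw [Finset.sum_comm]
          simp_rw [hf, Finset.mul_sum]
      _ = _ := by
          rw [Finset.mul_sum]
          refine Finset.sum_congr rfl fun x _ => ?_
          split_ifs with hx
          · simp_rw [(hχα x).1 hx]
            simp [mul_comm]
          · rw [hχα] at hx
            push Not at hx
            rw [sum_eq_zero_of_exists_ne_one _ (hχ x) hx, mul_zero, mul_zero]
  rw [mul_left_cancel₀ hC h1, ← sum_comp_surjective β hβ, ← Finset.sum_filter]
  simp_rw [← hfD]
  refine (Finset.sum_nbij α ?_ hα.injOn ?_ fun _ _ => rfl).symm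
  · simp
  · intro x hx
    obtain ⟨y, rfl⟩ : x ∈ Set.range α := by simpa using hx
    exact ⟨y, by simp, rfl⟩

end FiniteGroups

/-! ### Discriminant groups of lattices in a rational quadratic space. -/

section Disc

variable {V : Type*} [AddCommGroup V]

/-- The discriminant group `Γ'/Γ`. -/
abbrev Disc (Γ Γ' : Submodule ℤ V) : Type _ := Γ' ⧸ Γ.submoduleOf Γ'

/-- The class in `Γ'/Γ` of an element of `Γ'`. -/
abbrev Disc.mk {Γ Γ' : Submodule ℤ V} (x : V) (hx : x ∈ Γ') : Disc Γ Γ' :=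
  Submodule.Quotient.mk ⟨x, hx⟩

lemma Disc.mk_eq_mk_iff {Γ Γ' : Submodule ℤ V} {x y : V} {hx : x ∈ Γ'} {hy : y ∈ Γ'} :
    (Disc.mk x hx : Disc Γ Γ') = Disc.mk y hy ↔ x - y ∈ Γ :=
  Submodule.Quotient.eq _

lemma Disc.exists_mk {Γ Γ' : Submodule ℤ V} (γ : Disc Γ Γ') : ∃ x, ∃ hx : x ∈ Γ', γ = Disc.mk x hx := by
  obtain ⟨⟨x, hx⟩, rfl⟩ := Submodule.Quotient.mk_surjective _ γ
  exact ⟨x, hx, rfl⟩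

lemma Disc.exists_out_mk {Γ Γ' : Submodule ℤ V} (x : V) (hx : x ∈ Γ') :
    ∃ u ∈ Γ, (((Disc.mk x hx : Disc Γ Γ').out : Γ') : V) = x + u := by
  refine ⟨((Disc.mk x hx : Disc Γ Γ').out : Γ') - x, ?_, by abel⟩
  have h : (Submodule.Quotient.mk (Disc.mk x hx : Disc Γ Γ').out : Disc Γ Γ') =
    Submodule.Quotient.mk ⟨x, hx⟩ := Quotient.out_eq _
  exact (Submodule.Quotient.eq (Γ.submoduleOf Γ')).1 h

end Disc

section Lattices

variable {V : Type*} [AddCommGroup V] [Module ℚ V]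

/-- `Γ` is an even lattice of full rank in the quadratic space `(V, b)`, and `Γ'` is its dual. -/
structure IsEvenLatticeIn (b : LinearMap.BilinForm ℚ V) (Γ Γ' : Submodule ℤ V) : Prop where
  symm : ∀ x y, b x y = b y x
  nondegenerate : b.Nondegenerate
  finite : Module.Finite ℚ V
  exists_basis : ∃ v : Module.Basis (Fin (Module.finrank ℚ V)) ℚ V,
    Γ = Submodule.span ℤ (Set.range v)
  even : ∀ x ∈ Γ, ∃ n : ℤ, b x x = 2 * n
  dual_eq : Γ' = b.dualSubmodule Γ

/-- `e((γ, δ))` for `γ, δ ∈ Γ'/Γ`. -/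
def ePair (b : LinearMap.BilinForm ℚ V) {Γ Γ' : Submodule ℤ V} (γ δ : Disc Γ Γ') : ℂ :=
  e ((b (γ.out : Γ') (δ.out : Γ') : ℚ) : ℂ)

/-- `e(γ²/2)` for `γ ∈ Γ'/Γ`. -/
def eNorm (b : LinearMap.BilinForm ℚ V) {Γ Γ' : Submodule ℤ V} (γ : Disc Γ Γ') : ℂ :=
  e ((b (γ.out : Γ') (γ.out : Γ') / 2 : ℚ) : ℂ)

lemma e_ratCast_eq_one_iff (r : ℚ) : e (r : ℂ) = 1 ↔ ∃ n : ℤ, r = n := by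
  rw [e, Complex.exp_eq_one_iff]
  refine exists_congr fun n => ?_
  have h : (2 * Real.pi * Complex.I : ℂ) ≠ 0 := Complex.two_pi_I_ne_zero
  constructor
  · intro h1
    have h2 : (r : ℂ) = n := mul_left_cancel₀ h (by rw [h1]; ring)
    exact_mod_cast h2
  · rintro rfl
    push_cast
    ring

lemma norm_e_ratCast (r : ℚ) : ‖e (r : ℂ)‖ = 1 := by
  rw [e, show (2 * Real.pi * Complex.I * r : ℂ) = ((2 * Real.pi * r : ℝ) : ℂ) * Complex.I by
    push_cast; ring, Complex.norm_exp_ofReal_mul_I]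

/-- A lattice of full rank contains a multiple of every vector. -/
lemma exists_zsmul_mem_span {ι : Type*} [Fintype ι] (v : Module.Basis ι ℚ V) (x : V) :
    ∃ n : ℤ, n ≠ 0 ∧ n • x ∈ Submodule.span ℤ (Set.range v) := by
  obtain ⟨n, hn⟩ := IsLocalization.exist_integer_multiples_of_finset (nonZeroDivisors ℤ)
    (Finset.univ.image fun i => v.repr x i)
  refine ⟨n, nonZeroDivisors.coe_ne_zero n, ?_⟩
  rw [← v.sum_repr x, Finset.smul_sum]
  refine sum_mem fun i _ => ?_
  obtain ⟨k, hk⟩ := hn (v.repr x i) (Finset.mem_image_of_mem _ (Finset.mem_univ _))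
  rw [← smul_assoc, ← hk]
  simp only [algebraMap_int_eq, eq_intCast, Int.cast_smul_eq_zsmul]
  exact Submodule.smul_mem _ _ (Submodule.subset_span ⟨i, rfl⟩)

namespace IsEvenLatticeIn

variable {b : LinearMap.BilinForm ℚ V} {Γ Γ' : Submodule ℤ V}

lemma exists_int (h : IsEvenLatticeIn b Γ Γ') {x y : V} (hx : x ∈ Γ') (hy : y ∈ Γ) :
    ∃ n : ℤ, b x y = n := by
  rw [h.dual_eq] at hx
  obtain ⟨n, hn⟩ := Submodule.mem_one.1 (hx y hy)
  exact ⟨n, by simpa using hn.symm⟩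

lemma mem_dual (h : IsEvenLatticeIn b Γ Γ') {x : V} (hx : ∀ y ∈ Γ, ∃ n : ℤ, b x y = n) :
    x ∈ Γ' := by
  rw [h.dual_eq]
  intro y hy
  obtain ⟨n, hn⟩ := hx y hy
  exact Submodule.mem_one.2 ⟨n, by simpa using hn.symm⟩

lemma le_dual (h : IsEvenLatticeIn b Γ Γ') : Γ ≤ Γ' := by
  intro x hx
  refine h.mem_dual fun y hy => ?_
  obtain ⟨k, hk⟩ := h.even x hx
  obtain ⟨l, hl⟩ := h.even y hy
  obtain ⟨n, hn⟩ := h.even (x + y) (add_mem hx hy)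
  refine ⟨n - k - l, ?_⟩
  simp only [map_add, LinearMap.add_apply, h.symm y x] at hn
  push_cast
  linarith

lemma mem_of_forall_dual (h : IsEvenLatticeIn b Γ Γ') {x : V}
    (hx : ∀ y ∈ Γ', ∃ n : ℤ, b x y = n) : x ∈ Γ := by
  obtain ⟨v, hv⟩ := h.exists_basis
  have hd := LinearMap.BilinForm.dualSubmodule_dualSubmodule_of_basis (R := ℤ) b h.nondegenerate
    ⟨h.symm⟩ v
  rw [← hv, ← h.dual_eq] at hd
  rw [← hd]
  intro y hy
  obtain ⟨n, hn⟩ := hx y hy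
  exact Submodule.mem_one.2 ⟨n, by simpa using hn.symm⟩

/-- The group is finitely generated, since Γ' is spanned by the dual basis, and torsion, since Γ has
full rank. -/
lemma finite_disc (h : IsEvenLatticeIn b Γ Γ') : Finite (Disc Γ Γ') := by
  have := h.finite
  obtain ⟨v, hv⟩ := h.exists_basis
  have hfg : Module.Finite ℤ Γ' := by
    rw [h.dual_eq, hv, LinearMap.BilinForm.dualSubmodule_span_of_basis b h.nondegenerate]
    exact Module.Finite.span_of_finite ℤ (Set.finite_range _)
  have : Module.Finite ℤ (Disc Γ Γ') := inferInstance
  refine Module.finite_of_fg_torsion _ ?_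
  intro γ
  obtain ⟨x, hx, rfl⟩ := γ.exists_mk
  obtain ⟨n, hn0, hn⟩ := exists_zsmul_mem_span v x
  refine ⟨⟨n, mem_nonZeroDivisors_of_ne_zero hn0⟩, ?_⟩
  change Submodule.Quotient.mk _ = _
  rw [Submodule.Quotient.mk_eq_zero]
  change n • x ∈ Γ
  rwa [hv]

lemma ePair_mk (h : IsEvenLatticeIn b Γ Γ') {x y : V} (hx : x ∈ Γ') (hy : y ∈ Γ') :
    ePair b (Disc.mk x hx : Disc Γ Γ') (Disc.mk y hy) = e (b x y : ℚ) := by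
  obtain ⟨u, hu, hxu⟩ := Disc.exists_out_mk x hx (Γ := Γ)
  obtain ⟨v, hv, hyv⟩ := Disc.exists_out_mk y hy (Γ := Γ)
  obtain ⟨n, hn⟩ := h.exists_int hx hv
  obtain ⟨k, hk⟩ := h.exists_int hy hu
  obtain ⟨l, hl⟩ := h.exists_int (h.le_dual hu) hv
  rw [ePair, hxu, hyv]
  refine e_eq_of_sub_eq_int (n + k + l) ?_
  simp only [map_add, LinearMap.add_apply, hn, h.symm u y, hk, hl]
  push_cast
  ring

lemma eNorm_mk (h : IsEvenLatticeIn b Γ Γ') {x : V} (hx : x ∈ Γ') :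
    eNorm b (Disc.mk x hx : Disc Γ Γ') = e ((b x x / 2 : ℚ) : ℂ) := by
  obtain ⟨u, hu, hxu⟩ := Disc.exists_out_mk x hx (Γ := Γ)
  obtain ⟨n, hn⟩ := h.exists_int hx hu
  obtain ⟨k, hk⟩ := h.even u hu
  rw [eNorm, hxu]
  refine e_eq_of_sub_eq_int (n + k) ?_
  simp only [map_add, LinearMap.add_apply, hn, h.symm u x, hk]
  push_cast
  ring

lemma ePair_add_right (h : IsEvenLatticeIn b Γ Γ') (γ δ ε : Disc Γ Γ') :
    ePair b γ (δ + ε) = ePair b γ δ * ePair b γ ε := by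
  obtain ⟨x, hx, rfl⟩ := γ.exists_mk
  obtain ⟨y, hy, rfl⟩ := δ.exists_mk
  obtain ⟨z, hz, rfl⟩ := ε.exists_mk
  have : (Disc.mk y hy + Disc.mk z hz : Disc Γ Γ') = Disc.mk (y + z) (add_mem hy hz) := rfl
  rw [this, h.ePair_mk, h.ePair_mk, h.ePair_mk, ← e_add, map_add]
  push_cast
  rfl

lemma eNorm_add (h : IsEvenLatticeIn b Γ Γ') (γ δ : Disc Γ Γ') :
    eNorm b (γ + δ) = eNorm b γ * eNorm b δ * ePair b γ δ := by
  obtain ⟨x, hx, rfl⟩ := γ.exists_mk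
  obtain ⟨y, hy, rfl⟩ := δ.exists_mk
  have : (Disc.mk x hx + Disc.mk y hy : Disc Γ Γ') = Disc.mk (x + y) (add_mem hx hy) := rfl
  rw [this, h.eNorm_mk, h.eNorm_mk, h.eNorm_mk, h.ePair_mk, ← e_add, ← e_add]
  congr 1
  simp only [map_add, LinearMap.add_apply, h.symm y x]
  push_cast
  ring

lemma ePair_comm (h : IsEvenLatticeIn b Γ Γ') (γ δ : Disc Γ Γ') : ePair b γ δ = ePair b δ γ := by
  rw [ePair, ePair, h.symm]

lemma eNorm_zero (h : IsEvenLatticeIn b Γ Γ') : eNorm b (0 : Disc Γ Γ') = 1 := by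
  have : (0 : Disc Γ Γ') = Disc.mk 0 (zero_mem _) := rfl
  rw [this, h.eNorm_mk]
  simp [e]

lemma ePair_zero (h : IsEvenLatticeIn b Γ Γ') (γ : Disc Γ Γ') : ePair b γ 0 = 1 := by
  obtain ⟨x, hx, rfl⟩ := γ.exists_mk
  have : (0 : Disc Γ Γ') = Disc.mk 0 (zero_mem _) := rfl
  rw [this, h.ePair_mk]
  simp [e]

/-- Orthogonality relations on the discriminant group. -/
lemma sum_ePair (h : IsEvenLatticeIn b Γ Γ') [Fintype (Disc Γ Γ')] [DecidableEq (Disc Γ Γ')]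
    (γ : Disc Γ Γ') : ∑ δ, ePair b γ δ = if γ = 0 then (Fintype.card (Disc Γ Γ') : ℂ) else 0 := by
  split_ifs with hγ
  · subst hγ
    simp [h.ePair_comm 0, h.ePair_zero]
  · refine sum_eq_zero_of_exists_ne_one _ (h.ePair_add_right γ) ?_
    by_contra! hc
    refine hγ ?_
    obtain ⟨x, hx, rfl⟩ := γ.exists_mk
    refine (Submodule.Quotient.mk_eq_zero _).2 (h.mem_of_forall_dual fun y hy => ?_)
    have := hc (Disc.mk y hy)
    rw [h.ePair_mk] at this
    exact (e_ratCast_eq_one_iff _).1 this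

/-- The Gauss sum of a discriminant form has absolute value `√|D|`. -/
lemma norm_sum_eNorm (h : IsEvenLatticeIn b Γ Γ') [Fintype (Disc Γ Γ')] :
    ‖∑ γ : Disc Γ Γ', eNorm b γ‖ = Real.sqrt (Fintype.card (Disc Γ Γ')) := by
  classical
  have hn : ∀ γ : Disc Γ Γ', eNorm b γ * (starRingEnd ℂ) (eNorm b γ) = 1 := by
    intro γ
    rw [Complex.mul_conj, Complex.normSq_eq_norm_sq, eNorm, norm_e_ratCast]
    simp
  have h1 : (∑ γ : Disc Γ Γ', eNorm b γ) * (starRingEnd ℂ) (∑ γ : Disc Γ Γ', eNorm b γ) =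
      Fintype.card (Disc Γ Γ') := by
    rw [map_sum, Finset.sum_mul_sum, Finset.sum_comm]
    -- Substituting x = z + y leaves the factor e((z, y)) under the sum over y, and orthogonality
    -- isolates z = 0.
    calc ∑ y : Disc Γ Γ', ∑ x : Disc Γ Γ', eNorm b x * (starRingEnd ℂ) (eNorm b y)
        = ∑ y : Disc Γ Γ', ∑ z : Disc Γ Γ', eNorm b z * ePair b z y := by
          refine Finset.sum_congr rfl fun y _ => ?_
          refine Fintype.sum_equiv (Equiv.subRight y) _ _ fun x => ?_
          obtain ⟨z, rfl⟩ : ∃ z, x = z + y := ⟨x - y, by abel⟩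
          simp only [Equiv.subRight_apply, add_sub_cancel_right, h.eNorm_add]
          linear_combination (eNorm b z * ePair b z y) * hn y
      _ = ∑ z : Disc Γ Γ', eNorm b z * ∑ y : Disc Γ Γ', ePair b z y := by
          rw [Finset.sum_comm]
          simp_rw [Finset.mul_sum]
      _ = _ := by
          simp_rw [h.sum_ePair]
          simp [h.eNorm_zero]
  rw [Complex.mul_conj, Complex.normSq_eq_norm_sq] at h1
  rw [eq_comm, Real.sqrt_eq_iff_eq_sq (by positivity) (norm_nonneg _)]
  exact_mod_cast h1.symm

end IsEvenLatticeIn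

end Lattices

/-! ### Milgram's formula. -/

section Milgram

/-- The map of discriminant groups induced by an inclusion of lattices. -/
def Disc.incl {V : Type*} [AddCommGroup V] {A Γ Γ' : Submodule ℤ V} (h : Γ ≤ Γ') :
    Disc A Γ →+ Disc A Γ' :=
  (Submodule.mapQ _ (A.submoduleOf Γ') (Submodule.inclusion h) fun _ hx => hx).toAddMonoidHom

/-- The projection of discriminant groups induced by an inclusion of lattices. -/
def Disc.proj {V : Type*} [AddCommGroup V] {A Γ Γ' : Submodule ℤ V} (h : A ≤ Γ) :
    Disc A Γ' →+ Disc Γ Γ' :=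
  (Submodule.mapQ (A.submoduleOf Γ') (Γ.submoduleOf Γ') LinearMap.id fun _ hx => h hx).toAddMonoidHom

lemma Disc.incl_injective {V : Type*} [AddCommGroup V] {A Γ Γ' : Submodule ℤ V} (h : Γ ≤ Γ') :
    Function.Injective (Disc.incl h : Disc A Γ →+ Disc A Γ') := by
  intro γ δ hγδ
  obtain ⟨x, hx, rfl⟩ := γ.exists_mk
  obtain ⟨y, hy, rfl⟩ := δ.exists_mk
  exact Disc.mk_eq_mk_iff.2 ((Disc.mk_eq_mk_iff (hx := h hx) (hy := h hy)).1 hγδ)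

lemma Disc.proj_surjective {V : Type*} [AddCommGroup V] {A Γ Γ' : Submodule ℤ V} (h : A ≤ Γ) :
    Function.Surjective (Disc.proj h : Disc A Γ' →+ Disc Γ Γ') := by
  intro γ
  obtain ⟨x, hx, rfl⟩ := γ.exists_mk
  exact ⟨Disc.mk x hx, rfl⟩

variable {V : Type*} [AddCommGroup V] [Module ℚ V] {b : LinearMap.BilinForm ℚ V}
  {A A' Γ Γ' : Submodule ℤ V}

namespace IsEvenLatticeIn

lemma dual_le (h : IsEvenLatticeIn b Γ Γ') (hA : IsEvenLatticeIn b A A') (hle : A ≤ Γ) :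
    Γ' ≤ A' :=
  fun _ hx => hA.mem_dual fun _ hy => h.exists_int hx (hle hy)

/-- The Gauss sum of a sublattice is a positive multiple of the Gauss sum of the lattice. -/
lemma exists_sum_eNorm_eq (h : IsEvenLatticeIn b Γ Γ') (hA : IsEvenLatticeIn b A A') (hle : A ≤ Γ)
    [Fintype (Disc Γ Γ')] [Fintype (Disc A A')] :
    ∃ n : ℕ, ∑ γ : Disc A A', eNorm b γ = n * ∑ γ : Disc Γ Γ', eNorm b γ := by
  have hΓA : Γ ≤ A' := h.le_dual.trans (h.dual_le hA hle)
  have : Finite (Disc A Γ) := Finite.of_injective _ (Disc.incl_injective hΓA)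
  have : Finite (Disc A Γ') := Finite.of_injective _ (Disc.incl_injective (h.dual_le hA hle))
  have := Fintype.ofFinite (Disc A Γ)
  have := Fintype.ofFinite (Disc A Γ')
  refine ⟨_, sum_eq_card_ker_mul_sum (C := Disc A Γ) (Disc.incl hΓA) (Disc.incl (h.dual_le hA hle))
    (Disc.incl_injective _) (Disc.proj hle) (Disc.proj_surjective hle) _ _
    (fun x c => ePair b x (Disc.incl hΓA c)) ?_ ?_ ?_ ?_⟩
  · intro x c
    rw [hA.eNorm_add]
    congr 1
    obtain ⟨y, hy, rfl⟩ := c.exists_mk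
    change _ * eNorm b (Disc.mk y (hΓA hy)) = _
    obtain ⟨n, hn⟩ := h.even y hy
    rw [hA.eNorm_mk, (e_ratCast_eq_one_iff _).2 ⟨n, by rw [hn]; ring⟩, mul_one]
  · intro x c d
    rw [map_add, hA.ePair_add_right]
  · intro x
    obtain ⟨x, hx, rfl⟩ := x.exists_mk
    constructor
    · rintro ⟨y, hy⟩ c
      obtain ⟨y, hy', rfl⟩ := y.exists_mk
      rw [← hy]
      obtain ⟨c, hc, rfl⟩ := c.exists_mk
      change ePair b (Disc.mk y (h.dual_le hA hle hy')) (Disc.mk c (hΓA hc)) = 1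
      rw [hA.ePair_mk]
      exact (e_ratCast_eq_one_iff _).2 (h.exists_int hy' hc)
    · intro hc
      have hx' : x ∈ Γ' := by
        refine h.mem_dual fun y hy => (e_ratCast_eq_one_iff _).1 ?_
        rw [← hA.ePair_mk hx (hΓA hy)]
        exact hc (Disc.mk y hy)
      exact ⟨Disc.mk x hx', rfl⟩
  · intro y
    obtain ⟨y, hy, rfl⟩ := y.exists_mk
    change eNorm b (Disc.mk y (h.dual_le hA hle hy)) = eNorm b (Disc.mk y hy)
    rw [hA.eNorm_mk, h.eNorm_mk]

/-- A quadratic space is diagonalized by vectors of any given lattice. -/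
lemma exists_orthogonal (h : IsEvenLatticeIn b Γ Γ') :
    ∃ (w : Module.Basis (Fin (Module.finrank ℚ V)) ℚ V) (a : Fin (Module.finrank ℚ V) → ℤ),
      (∀ i, w i ∈ Γ) ∧ (∀ i j, i ≠ j → b (w i) (w j) = 0) ∧ (∀ i, b (w i) (w i) = 2 * a i) ∧
      ∀ i, a i ≠ 0 := by
  have := h.finite
  have h2 : Invertible (2 : ℚ) := invertibleOfNonzero two_ne_zero
  obtain ⟨u, hu⟩ := LinearMap.BilinForm.exists_orthogonal_basis (B := b) ⟨h.symm⟩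
  obtain ⟨v, rfl⟩ := h.exists_basis
  choose n hn hnu using fun i => exists_zsmul_mem_span v (u i)
  have hn' : ∀ i, (n i : ℚ) ≠ 0 := fun i => by exact_mod_cast hn i
  let w := u.isUnitSMul (fun i => (hn' i).isUnit)
  have hw : ∀ i, w i = n i • u i := fun i => by
    simp [w, Module.Basis.isUnitSMul_apply, Int.cast_smul_eq_zsmul]
  have ho : ∀ i j, i ≠ j → b (w i) (w j) = 0 := fun i j hij => by
    rw [hw, hw, map_zsmul, map_zsmul, LinearMap.smul_apply, show b (u i) (u j) = 0 from hu hij,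
      smul_zero, smul_zero]
  have hself : ∀ i, b (w i) (w i) ≠ 0 := by
    have : b.IsOrthoᵢ w := fun i j hij => ho i j hij
    exact fun i => LinearMap.IsOrthoᵢ.not_isOrtho_basis_self_of_separatingLeft this h.nondegenerate.1 i
  choose a ha using fun i => h.even (w i) (by rw [hw]; exact hnu i)
  refine ⟨w, a, fun i => by rw [hw]; exact hnu i, ho, ha, fun i h0 => hself i ?_⟩
  rw [ha, h0, Int.cast_zero, mul_zero]

end IsEvenLatticeIn

/-- The one dimensional Gauss sum, for either sign. -/
lemma sum_e_sq_div_int {a : ℤ} (ha : a ≠ 0) :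
    ∑ x : Fin (2 * a.natAbs), e (((x : ℕ) ^ 2 / (4 * a) : ℚ) : ℂ) =
      Real.sqrt (2 * a.natAbs) * e ((a.sign : ℂ) / 8) := by
  have hpos : 0 < a.natAbs := Int.natAbs_pos.2 ha
  have key := sum_e_sq_div hpos
  rw [← Fin.sum_univ_eq_sum_range (fun x : ℕ => e ((x : ℂ) ^ 2 / (4 * a.natAbs)))] at key
  have hc : ∀ z : ℝ, (starRingEnd ℂ) (e z) = e (-z) := fun z => by
    rw [e, e, ← Complex.exp_conj]
    simp [Complex.conj_ofNat]
  rcases lt_or_gt_of_ne ha with h | h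
  · obtain ⟨n, rfl⟩ : ∃ n : ℕ, a = -n := ⟨a.natAbs, by omega⟩
    simp only [Int.natAbs_neg, Int.natAbs_natCast] at key hpos ⊢
    have := congrArg (starRingEnd ℂ) key
    rw [map_sum, map_mul, Complex.conj_ofReal, show (1 / 8 : ℂ) = ((1 / 8 : ℝ) : ℂ) by simp, hc] at this
    rw [Int.sign_neg, Int.sign_natCast_of_ne_zero hpos.ne']
    push_cast at this ⊢
    rw [neg_div, ← this]
    refine Finset.sum_congr rfl fun x _ => ?_
    rw [show ((x : ℕ) ^ 2 / (4 * n) : ℂ) = (((x : ℕ) ^ 2 / (4 * n) : ℝ) : ℂ) by push_cast; rfl, hc]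
    push_cast
    rw [mul_neg, div_neg]
  · obtain ⟨n, rfl⟩ : ∃ n : ℕ, a = n := ⟨a.natAbs, by omega⟩
    simp only [Int.natAbs_natCast] at key hpos ⊢
    rw [Int.sign_natCast_of_ne_zero hpos.ne']
    push_cast at key ⊢
    exact key

/-- The Gauss sum of the lattice spanned by an orthogonal basis. -/
lemma sum_eNorm_of_orthogonal {n : ℕ} (w : Module.Basis (Fin n) ℚ V) (a : Fin n → ℤ)
    (hA : IsEvenLatticeIn b A A') (hw : A = Submodule.span ℤ (Set.range w))
    (ho : ∀ i j, i ≠ j → b (w i) (w j) = 0) (ha : ∀ i, b (w i) (w i) = 2 * a i)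
    (ha0 : ∀ i, a i ≠ 0) [Fintype (Disc A A')] :
    ∑ γ : Disc A A', eNorm b γ =
      ∏ i, ∑ x : Fin (2 * (a i).natAbs), e (((x : ℕ) ^ 2 / (4 * a i) : ℚ) : ℂ) := by
  have ha0' : ∀ i, (a i : ℚ) ≠ 0 := fun i => by exact_mod_cast ha0 i
  -- Vectors are parametrized by their pairings k i with w i. The dual lattice is given by integral
  -- k and A by 2 a i ∣ k i, so residues modulo 2|a i| enumerate the discriminant group.
  let vec : (Fin n → ℚ) → V := fun k => ∑ i, (k i / (2 * a i)) • w i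
  have hpair : ∀ (k : Fin n → ℚ) j, b (vec k) (w j) = k j := by
    intro k j
    simp only [vec, map_sum, LinearMap.sum_apply, map_smul, LinearMap.smul_apply, smul_eq_mul]
    rw [Finset.sum_eq_single j (fun i _ hij => by rw [ho i j hij, mul_zero]) (by simp), ha]
    field_simp [ha0' j]
  have hnorm : ∀ k : Fin n → ℚ, b (vec k) (vec k) = ∑ i, k i ^ 2 / (2 * a i) := by
    intro k
    conv_lhs => rw [show vec k = ∑ i, (k i / (2 * a i)) • w i from rfl]
    rw [show (∑ i, (k i / (2 * a i)) • w i) = ∑ i, (k i / (2 * a i)) • w i from rfl, map_sum]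
    refine Finset.sum_congr rfl fun i _ => ?_
    have := hpair k i
    simp only [vec] at this
    rw [map_smul, this, smul_eq_mul]
    ring
  have hmemA : ∀ x, x ∈ A ↔ ∀ i, ∃ k : ℤ, w.repr x i = k := by
    intro x
    rw [hw, w.mem_span_iff_repr_mem ℤ]
    simp [eq_comm]
  have hmem : ∀ k : Fin n → ℤ, vec (fun i => k i) ∈ A' := by
    intro k
    refine hA.mem_dual fun y hy => ?_
    choose l hl using (hmemA y).1 hy
    refine ⟨∑ i, l i * k i, ?_⟩
    rw [← w.sum_repr y, map_sum]
    push_cast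
    refine Finset.sum_congr rfl fun i _ => ?_
    rw [map_smul, hpair, hl, smul_eq_mul]
  let φ : (∀ i, Fin (2 * (a i).natAbs)) → Disc A A' :=
    fun k => Disc.mk (vec fun i => ((k i : ℕ) : ℤ)) (hmem fun i => ((k i : ℕ) : ℤ))
  have hrepr : ∀ k i, w.repr (vec k) i = k i / (2 * a i) := fun k i => by
    simp only [vec, w.repr_sum_self]
  have hiff : ∀ k l : Fin n → ℤ, vec (fun i => k i) - vec (fun i => l i) ∈ A ↔
      ∀ i, (2 * a i) ∣ k i - l i := by
    intro k l
    rw [hmemA]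
    refine forall_congr' fun i => ?_
    rw [map_sub, Finsupp.sub_apply, hrepr, hrepr, ← sub_div]
    refine exists_congr fun c => ?_
    have := ha0' i
    rw [div_eq_iff (by positivity)]
    constructor
    · intro h
      have : (k i : ℚ) - l i = ((2 * a i * c : ℤ) : ℚ) := by rw [h]; push_cast; ring
      exact_mod_cast this
    · intro h
      have : ((k i - l i : ℤ) : ℚ) = (2 * a i * c : ℤ) := by rw [h]
      push_cast at this
      rw [this]; ring
  have hφ : Function.Bijective φ := by
    constructor
    · intro k l hkl
      have := (hiff _ _).1 (Disc.mk_eq_mk_iff.1 hkl)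
      funext i
      have h1 := this i
      have h2 := (k i).2
      have h3 := (l i).2
      rw [← Int.natAbs_dvd, show (2 * a i).natAbs = 2 * (a i).natAbs by omega] at h1
      have := Int.eq_zero_of_abs_lt_dvd h1 (by rw [abs_lt]; omega)
      exact Fin.ext (by omega)
    · intro γ
      obtain ⟨x, hx, rfl⟩ := γ.exists_mk
      choose k hk using fun i => hA.exists_int hx (show w i ∈ A from hw ▸ Submodule.subset_span ⟨i, rfl⟩)
      have hxk : x = vec fun i => k i := by
        apply w.ext_elem
        intro i
        have h1 : b x (w i) = w.repr x i * (2 * a i) := by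
          conv_lhs => rw [← w.sum_repr x]
          simp only [map_sum, LinearMap.sum_apply, map_smul, LinearMap.smul_apply, smul_eq_mul]
          rw [Finset.sum_eq_single i (fun j _ hij => by rw [ho j i hij, mul_zero]) (by simp), ha]
        rw [hrepr, ← hk, h1]
        field_simp [ha0' i]
      have hpos : ∀ i, (0 : ℤ) < 2 * (a i).natAbs := fun i => by
        have := ha0 i
        omega
      refine ⟨fun i => ⟨(k i % (2 * (a i).natAbs : ℤ)).toNat, ?_⟩, ?_⟩
      · have := Int.emod_lt_of_pos (k i) (hpos i)
        have := Int.emod_nonneg (k i) (hpos i).ne'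
        omega
      · rw [Disc.mk_eq_mk_iff, hxk, hiff]
        intro i
        rw [Int.toNat_of_nonneg (Int.emod_nonneg (k i) (hpos i).ne'), ← Int.natAbs_dvd,
          show (2 * a i).natAbs = 2 * (a i).natAbs by omega, Nat.cast_mul, Nat.cast_ofNat]
        exact ⟨-(k i / (2 * (a i).natAbs : ℤ)),
          by linear_combination Int.emod_add_mul_ediv (k i) (2 * (a i).natAbs : ℤ)⟩
  rw [Finset.prod_univ_sum, Fintype.piFinset_univ, ← Fintype.sum_bijective φ hφ _ _ fun _ => rfl]
  refine Finset.sum_congr rfl fun k _ => ?_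
  rw [hA.eNorm_mk, hnorm]
  have he : ∀ (s : Finset (Fin n)) (f : Fin n → ℚ), e ((∑ i ∈ s, f i : ℚ) : ℂ) = ∏ i ∈ s, e (f i : ℂ) := by
    classical
    intro s f
    induction s using Finset.induction_on with
    | empty => simp [e]
    | insert i s hi ih => rw [Finset.sum_insert hi, Finset.prod_insert hi, ← ih, ← e_add]; push_cast; rfl
  rw [← he, Finset.sum_div]
  congr 2
  refine Finset.sum_congr rfl fun i _ => ?_
  push_cast
  ring

/-- **Milgram's formula**. -/
theorem IsEvenLatticeIn.sum_eNorm (h : IsEvenLatticeIn b Γ Γ') [Fintype (Disc Γ Γ')] :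
    ∑ γ : Disc Γ Γ', eNorm b γ = Real.sqrt (Fintype.card (Disc Γ Γ')) *
      e (((sigPos b.toQuadraticMap : ℂ) - sigNeg b.toQuadraticMap) / 8) := by
  have := h.finite
  obtain ⟨w, a, hwΓ, ho, ha, ha0⟩ := h.exists_orthogonal
  have hA : IsEvenLatticeIn b (Submodule.span ℤ (Set.range w))
      (b.dualSubmodule (Submodule.span ℤ (Set.range w))) :=
    ⟨h.symm, h.nondegenerate, h.finite, ⟨w, rfl⟩,
      fun x hx => h.even x (Submodule.span_le.2 (by rintro _ ⟨i, rfl⟩; exact hwΓ i) hx), rfl⟩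
  have := hA.finite_disc
  have := Fintype.ofFinite (Disc (Submodule.span ℤ (Set.range w))
      (b.dualSubmodule (Submodule.span ℤ (Set.range w))))
  -- The span of an orthogonal basis taken from Γ has a Gauss sum that factors into one dimensional
  -- ones, and it is N times the sum sought.
  obtain ⟨N, hN⟩ := h.exists_sum_eNorm_eq hA (Submodule.span_le.2 (by rintro _ ⟨i, rfl⟩; exact hwΓ i))
  rw [sum_eNorm_of_orthogonal w a hA rfl ho ha ha0,
    Finset.prod_congr rfl fun i _ => sum_e_sq_div_int (ha0 i), Finset.prod_mul_distrib] at hN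
  have heq : QuadraticMap.Equivalent b.toQuadraticMap
      (QuadraticMap.weightedSumSquares ℚ fun i => 2 * (a i : ℚ)) := by
    have hass : QuadraticMap.associated (R := ℚ) b.toQuadraticMap = b :=
      QuadraticMap.associated_left_inverse ℚ h.symm
    have := QuadraticForm.isometryEquivWeightedSumSquares b.toQuadraticMap w
      (by rw [hass]; exact fun i j hij => ho i j hij)
    simp only [LinearMap.BilinMap.toQuadraticMap_apply, ha] at this
    exact ⟨this⟩
  have hsig : ∏ i, e (((a i).sign : ℂ) / 8) =
      e (((sigPos b.toQuadraticMap : ℂ) - sigNeg b.toQuadraticMap) / 8) := by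
    rw [QuadraticForm.sigPos_of_equiv_weightedSumSquares heq, QuadraticForm.sigNeg_of_equiv_weightedSumSquares heq,
      Set.ncard_eq_toFinset_card', Set.ncard_eq_toFinset_card']
    have he : ∀ (s : Finset (Fin (Module.finrank ℚ V))) (f : Fin (Module.finrank ℚ V) → ℂ),
        ∏ i ∈ s, e (f i) = e (∑ i ∈ s, f i) := by
      classical
      intro s f
      induction s using Finset.induction_on with
      | empty => simp [e]
      | insert i s hi ih => rw [Finset.sum_insert hi, Finset.prod_insert hi, ih, e_add]
    rw [he, ← Finset.sum_div]
    congr 2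
    simp only [Set.toFinset_ofPred, Finset.card_filter, Nat.cast_sum, ← Finset.sum_sub_distrib]
    refine Finset.sum_congr rfl fun i _ => ?_
    rcases lt_or_gt_of_ne (ha0 i) with hi | hi
    · have : (a i : ℚ) < 0 := by exact_mod_cast hi
      have h2 : ¬ (0 : ℚ) < 2 * a i := by linarith
      have h3 : 2 * (a i : ℚ) < 0 := by linarith
      simp [Int.sign_eq_neg_one_of_neg hi, h2, h3]
    · have : (0 : ℚ) < a i := by exact_mod_cast hi
      have h2 : (0 : ℚ) < 2 * a i := by linarith
      have h3 : ¬ 2 * (a i : ℚ) < 0 := by linarith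
      simp [Int.sign_eq_one_of_pos hi, h2, h3]
  rw [hsig] at hN
  -- The value of N is not needed: both absolute values are known, so taking norms determines the
  -- positive factor and the phase is read off.
  have hn := congrArg norm hN
  have hS := h.norm_sum_eNorm
  have he : ‖e (((sigPos b.toQuadraticMap : ℂ) - sigNeg b.toQuadraticMap) / 8)‖ = 1 := by
    have := norm_e_ratCast (((sigPos b.toQuadraticMap : ℚ) - sigNeg b.toQuadraticMap) / 8)
    push_cast at this
    exact this
  have hP : ∏ i, (Real.sqrt (2 * (a i).natAbs) : ℂ) =
      ((∏ i, Real.sqrt (2 * (a i).natAbs) : ℝ) : ℂ) := by push_cast; rfl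
  have hP0 : 0 < ∏ i, Real.sqrt (2 * (a i).natAbs) := Finset.prod_pos fun i _ => by
    have : 0 < (a i).natAbs := Int.natAbs_pos.2 (ha0 i)
    positivity
  rw [hP] at hN hn
  rw [norm_mul, he, norm_mul, hS, Complex.norm_real, Real.norm_of_nonneg hP0.le, mul_one,
    Complex.norm_natCast] at hn
  have hN0 : (N : ℂ) ≠ 0 := by
    intro h0
    have : (N : ℝ) = 0 := by exact_mod_cast h0
    rw [this, zero_mul] at hn
    exact hP0.ne' hn
  rw [hn] at hN
  push_cast at hN
  rw [mul_assoc] at hN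
  exact (mul_left_cancel₀ hN0 hN).symm

end Milgram

lemma eq_zero_of_zsmul_eq_zero {V : Type*} [AddCommGroup V] [Module ℚ V] {n : ℤ} (hn : n ≠ 0)
    {x : V} (h : n • x = 0) : x = 0 := by
  rw [← Int.cast_smul_eq_zsmul ℚ, smul_eq_zero] at h
  exact h.resolve_left (by exact_mod_cast hn)

/-! ### Gram matrices and discriminants. -/

section GramMatrix

variable {V : Type*} [AddCommGroup V] [Module ℚ V] {ι : Type*} [Fintype ι] [DecidableEq ι]

/-- The order of the discriminant group is the absolute value of the determinant of the Gram
matrix. -/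
lemma natCard_disc {b : LinearMap.BilinForm ℚ V} {Γ Γ' : Submodule ℤ V} (h : IsEvenLatticeIn b Γ Γ')
    (v : Module.Basis ι ℚ V) (hv : Γ = Submodule.span ℤ (Set.range v)) :
    (Nat.card (Disc Γ Γ') : ℚ) = |(LinearMap.BilinForm.toMatrix v b).det| := by
  have := h.finite
  have hd : Γ' = Submodule.span ℤ (Set.range (b.dualBasis h.nondegenerate v)) := by
    rw [← LinearMap.BilinForm.dualSubmodule_span_of_basis b h.nondegenerate, ← hv]
    exact h.dual_eq
  have h1 := AddSubgroup.relIndex_eq_abs_det Γ.toAddSubgroup Γ'.toAddSubgroup h.le_dual v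
    (b.dualBasis h.nondegenerate v)
    (by rw [hv, Submodule.span_int_eq_addSubgroupClosure])
    ((congrArg Submodule.toAddSubgroup hd).trans (Submodule.span_int_eq_addSubgroupClosure _))
  have h2 : (b.dualBasis h.nondegenerate v).toMatrix v = (LinearMap.BilinForm.toMatrix v b).transpose := by
    ext i j
    rw [Module.Basis.toMatrix_apply, LinearMap.BilinForm.dualBasis_repr_apply, Matrix.transpose_apply,
      LinearMap.BilinForm.toMatrix_apply]
  rw [Module.Basis.det_apply, h2, Matrix.det_transpose] at h1
  rw [← h1]
  rfl

/-- The Gram matrix of a positive definite rational form is positive definite over `ℝ`. -/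
lemma posDef_map_ratCast {A : Matrix ι ι ℚ} (hA : A.IsSymm) (hpos : ∀ x, x ≠ 0 → 0 < x ⬝ᵥ A.mulVec x) :
    (A.map (Rat.cast : ℚ → ℝ)).PosDef := by
  have hH : (A.map (Rat.cast : ℚ → ℝ)).IsHermitian := by
    ext i j
    simp only [Matrix.conjTranspose_apply, Matrix.map_apply, star_trivial]
    rw [hA.apply]
  have hcast : ∀ x : ι → ℚ, (fun i => (x i : ℝ)) ⬝ᵥ
      (A.map (Rat.cast : ℚ → ℝ)).mulVec (fun i => (x i : ℝ)) = ((x ⬝ᵥ A.mulVec x : ℚ) : ℝ) := by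
    intro x
    simp [dotProduct, Matrix.mulVec]
  have hdense : DenseRange (fun (x : ι → ℚ) i => (x i : ℝ)) :=
    DenseRange.piMap fun _ => Rat.denseRange_cast
  -- Density of the rational vectors gives only semidefiniteness over ℝ; definiteness follows
  -- because the rational determinant is nonzero.
  have hsemi : (A.map (Rat.cast : ℚ → ℝ)).PosSemidef := by
    refine Matrix.posSemidef_iff_dotProduct_mulVec.2 ⟨hH, fun x => ?_⟩
    rw [star_trivial]
    refine hdense.induction_on (p := fun x : ι → ℝ => 0 ≤ x ⬝ᵥ (A.map (Rat.cast : ℚ → ℝ)).mulVec x)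
      x ?_ fun y => ?_
    · exact isClosed_le continuous_const (by fun_prop)
    · rw [hcast]
      by_cases hy : y = 0
      · simp [hy]
      · exact_mod_cast (hpos y hy).le
  refine hsemi.posDef_iff_isUnit.2 ?_
  rw [Matrix.isUnit_iff_isUnit_det, isUnit_iff_ne_zero]
  have hdet : A.det ≠ 0 := by
    intro h0
    obtain ⟨x, hx, hx0⟩ := Matrix.exists_mulVec_eq_zero_iff.2 h0
    have := hpos x hx
    rw [hx0, dotProduct_zero] at this
    exact this.false
  have : (A.map (Rat.cast : ℚ → ℝ)).det = ((A.det : ℚ) : ℝ) :=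
    (RingHom.map_det (Rat.castHom ℝ) A).symm
  rw [this]
  exact_mod_cast hdet

/-- Blichfeldt's bound for a lattice in a rational quadratic space. -/
lemma blichfeldt_rat (b : LinearMap.BilinForm ℚ V) (hb : ∀ x y, b x y = b y x) (v : Module.Basis ι ℚ V) {h : ℕ}
    (hι : Fintype.card ι = 2 * h) (h0 : h ≠ 0) {μ : ℚ} (hμ : 0 < μ)
    (hmin : ∀ x ∈ Submodule.span ℤ (Set.range v), x ≠ 0 → μ ≤ b x x) :
    (Real.pi * (μ / 2)) ^ h / (h + 1).factorial ≤
      Real.sqrt (((LinearMap.BilinForm.toMatrix v b).det : ℚ) : ℝ) := by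
  have : Nonempty ι := Fintype.card_pos_iff.1 (by omega)
  set A := LinearMap.BilinForm.toMatrix v b with hA
  have hquad : ∀ x : ι → ℚ, x ⬝ᵥ A.mulVec x = b (∑ i, x i • v i) (∑ i, x i • v i) := by
    intro x
    have := LinearMap.BilinForm.apply_eq_dotProduct_toMatrix_mulVec v b (∑ i, x i • v i) (∑ i, x i • v i)
    rw [this]
    have hx : ⇑(v.repr (∑ i, x i • v i)) = x := by
      ext i
      rw [v.repr_sum_self]
    rw [hx]
  have hne : ∀ x : ι → ℚ, x ≠ 0 → ∑ i, x i • v i ≠ 0 := by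
    intro x hx h0
    refine hx (funext fun i => ?_)
    have := congrArg (fun y => v.repr y i) h0
    simpa only [v.repr_sum_self, map_zero, Finsupp.coe_zero, Pi.zero_apply] using this
  have hpos : ∀ x, x ≠ 0 → 0 < b x x := by
    intro x hx
    obtain ⟨n, hn, hnx⟩ := exists_zsmul_mem_span v x
    have := hmin _ hnx fun h => hx (eq_zero_of_zsmul_eq_zero hn h)
    simp only [map_zsmul, LinearMap.smul_apply, zsmul_eq_mul] at this
    have hn' : (n : ℚ) ≠ 0 := by exact_mod_cast hn
    have : 0 < ((n : ℚ) * n) * b x x := by rw [mul_assoc]; linarith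
    exact (pos_iff_pos_of_mul_pos this).1 (mul_self_pos.2 hn')
  have hAs : A.IsSymm := by
    ext i j
    rw [Matrix.transpose_apply, hA, LinearMap.BilinForm.toMatrix_apply, LinearMap.BilinForm.toMatrix_apply, hb]
  have key := blichfeldt_gram hι (A.map (Rat.cast : ℚ → ℝ))
    (posDef_map_ratCast hAs fun x hx => by rw [hquad]; exact hpos _ (hne x hx))
    (μ := (μ : ℝ)) (by exact_mod_cast hμ) fun x hx => ?_
  · have : (A.map (Rat.cast : ℚ → ℝ)).det = ((A.det : ℚ) : ℝ) :=
      (RingHom.map_det (Rat.castHom ℝ) A).symm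
    rwa [this] at key
  · have h1 := hquad fun i => (x i : ℚ)
    have h2 : (fun i => (x i : ℝ)) ⬝ᵥ (A.map (Rat.cast : ℚ → ℝ)).mulVec (fun i => (x i : ℝ)) =
        (((fun i => (x i : ℚ)) ⬝ᵥ A.mulVec fun i => (x i : ℚ) : ℚ) : ℝ) := by
      simp [dotProduct, Matrix.mulVec]
    rw [h2, h1]
    have hx' : (fun i => (x i : ℚ)) ≠ 0 := by
      contrapose! hx
      funext i
      have := congrFun hx i
      simpa using this
    refine Rat.cast_le.2 (hmin _ (sum_mem fun i _ => ?_) (hne _ hx'))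
    rw [Int.cast_smul_eq_zsmul]
    exact Submodule.smul_mem _ _ (Submodule.subset_span ⟨i, rfl⟩)

/-- The determinant of the Gram matrix of the dual basis. -/
lemma det_toMatrix_dualBasis [FiniteDimensional ℚ V] (b : LinearMap.BilinForm ℚ V) (hb : b.Nondegenerate)
    (v : Module.Basis ι ℚ V) :
    (LinearMap.BilinForm.toMatrix (b.dualBasis hb v) b).det = ((LinearMap.BilinForm.toMatrix v b).det)⁻¹ := by
  have h1 := LinearMap.BilinForm.toMatrix_mul_basis_toMatrix (b := b.dualBasis hb v) v b
  have h2 : (b.dualBasis hb v).toMatrix v = (LinearMap.BilinForm.toMatrix v b).transpose := by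
    ext i j
    rw [Module.Basis.toMatrix_apply, LinearMap.BilinForm.dualBasis_repr_apply, Matrix.transpose_apply,
      LinearMap.BilinForm.toMatrix_apply]
  rw [h2, Matrix.transpose_transpose] at h1
  have h3 := congrArg Matrix.det h1
  rw [Matrix.det_mul, Matrix.det_mul, Matrix.det_transpose] at h3
  have h4 : (LinearMap.BilinForm.toMatrix v b).det ≠ 0 :=
    (LinearMap.BilinForm.nondegenerate_toMatrix_iff v).2 hb |>.det_ne_zero
  field_simp
  exact mul_left_cancel₀ h4 (by linear_combination h3)

end GramMatrix

/-! ### Integral lattices and their rational spans. -/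

section IntegralLattices

variable {L : Type*} [AddCommGroup L] {B : LinearMap.BilinForm ℤ L}

@[simp] lemma ratForm_tmul (r s : ℚ) (x y : L) :
    ratForm B (r ⊗ₜ[ℤ] x) (s ⊗ₜ[ℤ] y) = s * r * B x y := by
  simp [ratForm, LinearMap.BilinForm.baseChange_tmul, mul_comm]

lemma one_tmul_mem_latticeIn (x : L) : (1 : ℚ) ⊗ₜ[ℤ] x ∈ latticeIn L := ⟨x, rfl⟩

variable [Module.Free ℤ L] [Module.Finite ℤ L]

/-- A `ℤ`-basis of `L` as a `ℚ`-basis of `ℚ ⊗ L`. -/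
def ratBasis {ι : Type*} (v : Module.Basis ι ℤ L) : Module.Basis ι ℚ (ℚ ⊗[ℤ] L) :=
  Algebra.TensorProduct.basis ℚ v

lemma latticeIn_eq_span {ι : Type*} (v : Module.Basis ι ℤ L) :
    latticeIn L = Submodule.span ℤ (Set.range (ratBasis v)) := by
  have hv : ∀ i, ratBasis v i = (1 : ℚ) ⊗ₜ[ℤ] v i := fun i =>
    Algebra.TensorProduct.basis_apply v i
  refine le_antisymm ?_ (Submodule.span_le.2 ?_)
  · rintro _ ⟨l, rfl⟩
    change (1 : ℚ) ⊗ₜ[ℤ] l ∈ _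
    have hl := v.mem_span l
    induction hl using Submodule.span_induction with
    | mem x hx =>
      obtain ⟨i, rfl⟩ := hx
      exact Submodule.subset_span ⟨i, hv i⟩
    | zero => rw [TensorProduct.tmul_zero]; exact zero_mem _
    | add x y _ _ hx hy => rw [TensorProduct.tmul_add]; exact add_mem hx hy
    | smul n x _ hx =>
      have := map_zsmul (TensorProduct.mk ℤ ℚ L 1).toAddMonoidHom n x
      change (TensorProduct.mk ℤ ℚ L 1).toAddMonoidHom (n • x) ∈ _
      rw [this]
      exact Submodule.smul_mem _ n hx
  · rintro _ ⟨i, rfl⟩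
    exact ⟨v i, (hv i).symm⟩

lemma exists_zsmul_eq_tmul (x : ℚ ⊗[ℤ] L) : ∃ n : ℤ, n ≠ 0 ∧ ∃ l : L, n • x = 1 ⊗ₜ[ℤ] l := by
  obtain ⟨n, hn, h⟩ := exists_zsmul_mem_span (ratBasis (Module.Free.chooseBasis ℤ L)) x
  rw [← latticeIn_eq_span] at h
  obtain ⟨l, hl⟩ := h
  exact ⟨n, hn, l, hl.symm⟩

lemma one_tmul_injective : Function.Injective fun l : L => (1 : ℚ) ⊗ₜ[ℤ] l := by
  intro x y h
  refine (Module.Free.chooseBasis ℤ L).ext_elem fun i => ?_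
  have := congrArg (fun z => (ratBasis (Module.Free.chooseBasis ℤ L)).repr z i) h
  simpa [ratBasis] using this

lemma ratForm_nondegenerate (hs : ∀ x y, B x y = B y x) (hB : ∀ x, (∀ y, B x y = 0) → x = 0) :
    (ratForm B).Nondegenerate := by
  have h1 : ∀ x, (∀ y, ratForm B x y = 0) → x = 0 := by
    intro x hx
    obtain ⟨n, hn, l, hl⟩ := exists_zsmul_eq_tmul x
    have : l = 0 := hB l fun y => by
      have h2 : ratForm B (n • x) (1 ⊗ₜ[ℤ] y) = 0 := by
        rw [map_zsmul, LinearMap.smul_apply, hx, smul_zero]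
      rw [hl, ratForm_tmul] at h2
      simpa using h2
    rw [this, TensorProduct.tmul_zero] at hl
    exact eq_zero_of_zsmul_eq_zero hn hl
  exact ⟨h1, fun y hy => h1 y fun x => by rw [ratForm_symm hs]; exact hy x⟩

lemma IsEvenLattice.isEvenLatticeIn (h : IsEvenLattice B) :
    IsEvenLatticeIn (ratForm B) (latticeIn L) (dualLattice B) where
  symm := ratForm_symm h.symm
  nondegenerate := ratForm_nondegenerate h.symm h.nondegenerate.1
  finite := inferInstance
  exists_basis := by
    refine ⟨ratBasis ((Module.finBasis ℤ L).reindex (finCongr ?_)), latticeIn_eq_span _⟩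
    rw [Module.finrank_baseChange]
  even := by
    rintro _ ⟨l, rfl⟩
    obtain ⟨n, hn⟩ := h.even l
    refine ⟨n, ?_⟩
    change ratForm B ((1 : ℚ) ⊗ₜ[ℤ] l) ((1 : ℚ) ⊗ₜ[ℤ] l) = _
    rw [ratForm_tmul, hn]
    push_cast
    ring
  dual_eq := rfl

lemma toMatrix_ratForm {ι : Type*} [Fintype ι] [DecidableEq ι] (v : Module.Basis ι ℤ L) :
    LinearMap.BilinForm.toMatrix (ratBasis v) (ratForm B) =
      (LinearMap.BilinForm.toMatrix v B).map (Int.cast : ℤ → ℚ) := by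
  ext i j
  simp [LinearMap.BilinForm.toMatrix_apply, ratBasis, Algebra.TensorProduct.basis_apply]

lemma IsEvenLattice.natCard_discGroup (h : IsEvenLattice B) {ι : Type*} [Fintype ι] [DecidableEq ι]
    (v : Module.Basis ι ℤ L) :
    (Nat.card (DiscGroup B) : ℤ) = |(LinearMap.BilinForm.toMatrix v B).det| := by
  have h1 := natCard_disc h.isEvenLatticeIn (ratBasis v) (latticeIn_eq_span v)
  have h2 : ((LinearMap.BilinForm.toMatrix v B).map (Int.cast : ℤ → ℚ)).det =
      ((LinearMap.BilinForm.toMatrix v B).det : ℚ) :=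
    (RingHom.map_det (Int.castRingHom ℚ) _).symm
  rw [toMatrix_ratForm, h2] at h1
  exact_mod_cast h1

/-- Blichfeldt's bound for a positive definite even lattice of rank `2h`. -/
lemma IsEvenLattice.blichfeldt (h : IsEvenLattice B) {n : ℕ} (hL : Module.finrank ℤ L = 2 * n)
    (hn : n ≠ 0) {μ : ℤ} (hμ : 0 < μ) (hmin : ∀ x, x ≠ 0 → μ ≤ B x x) :
    (Real.pi * (μ / 2)) ^ n / (n + 1).factorial ≤ Real.sqrt (Nat.card (DiscGroup B)) := by
  have h1 := blichfeldt_rat (ratForm B) (ratForm_symm h.symm) (ratBasis (Module.finBasis ℤ L))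
    (h := n) (by rw [Fintype.card_fin, hL]) hn (μ := μ) (by exact_mod_cast hμ) ?_
  · have h2 := natCard_disc h.isEvenLatticeIn (ratBasis (Module.finBasis ℤ L)) (latticeIn_eq_span _)
    refine le_trans ?_ (h1.trans (Real.sqrt_le_sqrt ?_))
    · push_cast
      rfl
    · have h3 : ((Nat.card (DiscGroup B) : ℚ) : ℝ) =
          ((|(LinearMap.BilinForm.toMatrix (ratBasis (Module.finBasis ℤ L)) (ratForm B)).det| : ℚ) : ℝ) :=
        congrArg _ h2
      rw [Rat.cast_natCast] at h3
      rw [h3]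
      exact_mod_cast le_abs_self _
  · rw [← latticeIn_eq_span]
    rintro _ ⟨l, rfl⟩ hl
    change _ ≤ ratForm B ((1 : ℚ) ⊗ₜ[ℤ] l) ((1 : ℚ) ⊗ₜ[ℤ] l)
    rw [ratForm_tmul]
    have := hmin l (by rintro rfl; exact hl (TensorProduct.tmul_zero _ _))
    simp only [mul_one, one_mul]
    exact_mod_cast this

end IntegralLattices

/-! ### Signatures from explicit definite sublattices. -/

section Signature

variable {L : Type*} [AddCommGroup L] [Module.Free ℤ L] [Module.Finite ℤ L]
  {L' : Type*} [AddCommGroup L'] [Module.Free ℤ L'] [Module.Finite ℤ L']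

/-- Positivity on nonzero integral vectors passes to `ℚ ⊗ L'` by clearing denominators, and it
forces the extended map to be injective. With its negative counterpart this pins down a signature as
soon as the two lower bounds add up to the rank. -/
lemma finrank_le_sigPos {B : LinearMap.BilinForm ℤ L} (φ : L' →ₗ[ℤ] L)
    (hφ : ∀ x, x ≠ 0 → 0 < B (φ x) (φ x)) :
    Module.finrank ℤ L' ≤ sigPos (ratForm B).toQuadraticMap := by
  have key : ∀ u : ℚ ⊗[ℤ] L', u ≠ 0 → 0 < ratForm B (φ.baseChange ℚ u) (φ.baseChange ℚ u) := by
    intro u hu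
    obtain ⟨n, hn, l, hl⟩ := exists_zsmul_eq_tmul u
    have hl0 : l ≠ 0 := by
      rintro rfl
      rw [TensorProduct.tmul_zero] at hl
      exact hu (eq_zero_of_zsmul_eq_zero hn hl)
    have h1 : ratForm B (φ.baseChange ℚ (n • u)) (φ.baseChange ℚ (n • u)) = B (φ l) (φ l) := by
      rw [hl, LinearMap.baseChange_tmul, ratForm_tmul, mul_one, one_mul]
    simp only [map_zsmul, LinearMap.smul_apply, zsmul_eq_mul] at h1
    have h2 : (0 : ℚ) < B (φ l) (φ l) := by exact_mod_cast hφ l hl0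
    rw [← h1, ← mul_assoc] at h2
    exact (pos_iff_pos_of_mul_pos h2).1 (mul_self_pos.2 (by exact_mod_cast hn))
  have hinj : Function.Injective (φ.baseChange ℚ) := by
    rw [injective_iff_map_eq_zero]
    intro u hu
    by_contra h0
    have := key u h0
    rw [hu, map_zero] at this
    exact lt_irrefl _ this
  have hpos : ((ratForm B).toQuadraticMap.restrict (LinearMap.range (φ.baseChange ℚ))).PosDef := by
    rintro ⟨_, u, rfl⟩ hx
    refine key u ?_
    rintro rfl
    exact hx (Subtype.ext (map_zero _))
  have := le_sigPos_of_posDef _ hpos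
  rwa [LinearMap.finrank_range_of_inj hinj, Module.finrank_baseChange] at this

lemma finrank_le_sigNeg {B : LinearMap.BilinForm ℤ L} (φ : L' →ₗ[ℤ] L)
    (hφ : ∀ x, x ≠ 0 → B (φ x) (φ x) < 0) :
    Module.finrank ℤ L' ≤ sigNeg (ratForm B).toQuadraticMap := by
  have h1 := finrank_le_sigPos (B := -B) φ fun x hx => by
    have := hφ x hx
    simp only [LinearMap.neg_apply]
    omega
  have h2 : (ratForm (-B)).toQuadraticMap = -(ratForm B).toQuadraticMap := by
    have : ratForm (-B) = -ratForm B := by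
      refine LinearMap.ext fun x => LinearMap.ext fun y => ?_
      induction x using TensorProduct.induction_on with
      | zero => simp
      | add x x' hx hx' => simp only [map_add, LinearMap.add_apply, hx, hx']
      | tmul r l =>
        induction y using TensorProduct.induction_on with
        | zero => simp
        | add y y' hy hy' => simp only [map_add, hy, hy']
        | tmul s l' => simp
    rw [this]
    ext x
    simp
  rwa [h2, sigPos_neg] at h1

lemma sigPos_add_sigNeg_le (B : LinearMap.BilinForm ℤ L) :
    sigPos (ratForm B).toQuadraticMap + sigNeg (ratForm B).toQuadraticMap ≤ Module.finrank ℤ L := by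
  have := QuadraticForm.sigPos_add_sigNeg_add_radical (Q := (ratForm B).toQuadraticMap)
  rw [Module.finrank_baseChange] at this
  omega

/-- Milgram's formula for a positive definite even lattice. -/
lemma IsEvenLattice.sum_eNorm_of_pos {B : LinearMap.BilinForm ℤ L} (h : IsEvenLattice B)
    (hpos : ∀ x, x ≠ 0 → 0 < B x x) [Fintype (Disc (latticeIn L) (dualLattice B))] :
    ∑ γ : Disc (latticeIn L) (dualLattice B), eNorm (ratForm B) γ =
      Real.sqrt (Fintype.card (Disc (latticeIn L) (dualLattice B))) *
        e ((Module.finrank ℤ L : ℂ) / 8) := by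
  have h1 := finrank_le_sigPos (B := B) LinearMap.id hpos
  have h2 := sigPos_add_sigNeg_le B
  have h3 : sigPos (ratForm B).toQuadraticMap = Module.finrank ℤ L := by omega
  have h4 : sigNeg (ratForm B).toQuadraticMap = 0 := by omega
  rw [h.isEvenLatticeIn.sum_eNorm, h3, h4, Nat.cast_zero, sub_zero]

end Signature

/-! ### Representing linear functionals by vectors. -/

section Functionals

variable {L : Type*} [AddCommGroup L] [Module.Free ℤ L] [Module.Finite ℤ L]
  {B : LinearMap.BilinForm ℤ L}

/-- A rational functional on a nondegenerate lattice is represented by a vector. -/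
lemma exists_ratForm_eq (h : (ratForm B).Nondegenerate) (φ : L →ₗ[ℤ] ℚ) :
    ∃ x : ℚ ⊗[ℤ] L, ∀ y, ratForm B x (1 ⊗ₜ[ℤ] y) = φ y := by
  refine ⟨((ratForm B).toDual h).symm (φ.liftBaseChange ℚ), fun y => ?_⟩
  rw [LinearMap.BilinForm.apply_toDual_symm_apply, LinearMap.liftBaseChange_tmul, one_smul]

lemma ratForm_ext (h : (ratForm B).Nondegenerate) {x y : ℚ ⊗[ℤ] L}
    (hxy : ∀ l, ratForm B x (1 ⊗ₜ[ℤ] l) = ratForm B y (1 ⊗ₜ[ℤ] l)) : x = y := by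
  rw [← sub_eq_zero]
  refine h.1 _ fun z => ?_
  obtain ⟨n, hn, l, hl⟩ := exists_zsmul_eq_tmul z
  have h1 : n • ratForm B (x - y) z = 0 := by
    rw [← map_zsmul, hl, map_sub, LinearMap.sub_apply, hxy, sub_self]
  exact eq_zero_of_zsmul_eq_zero hn h1

lemma mem_dualLattice_iff {x : ℚ ⊗[ℤ] L} :
    x ∈ dualLattice B ↔ ∀ l, ∃ n : ℤ, ratForm B x (1 ⊗ₜ[ℤ] l) = n := by
  constructor
  · exact fun hx l => exists_int_of_mem hx ⟨l, rfl⟩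
  · rintro hx _ ⟨l, rfl⟩
    obtain ⟨n, hn⟩ := hx l
    exact Submodule.mem_one.2 ⟨n, (eq_intCast _ n).trans hn.symm⟩

/-- An integral functional on a unimodular lattice is represented by a lattice vector. -/
lemma exists_eq_of_unimodular (h : (ratForm B).Nondegenerate) (hu : dualLattice B = latticeIn L)
    (φ : L →ₗ[ℤ] ℤ) : ∃ x, ∀ y, B x y = φ y := by
  obtain ⟨x, hx⟩ := exists_ratForm_eq h ((Algebra.linearMap ℤ ℚ).comp φ)
  have hx' : x ∈ latticeIn L := by
    rw [← hu, mem_dualLattice_iff]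
    exact fun l => ⟨φ l, hx l⟩
  obtain ⟨l, rfl⟩ := hx'
  refine ⟨l, fun y => ?_⟩
  have := hx y
  change ratForm B ((1 : ℚ) ⊗ₜ[ℤ] l) ((1 : ℚ) ⊗ₜ[ℤ] y) = (φ y : ℚ) at this
  rw [ratForm_tmul] at this
  simp only [mul_one, one_mul] at this
  exact_mod_cast this

end Functionals

/-! ### Projections of a unimodular lattice onto a primitive sublattice. -/

section Projections

variable {Λ : Type*} [AddCommGroup Λ] [Module.Free ℤ Λ] [Module.Finite ℤ Λ]

/-- `P` is `n` times the orthogonal projection to the primitive sublattice `S`. -/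
structure IsScaledProjection (B : LinearMap.BilinForm ℤ Λ) (S : Submodule ℤ Λ) (P : Λ →ₗ[ℤ] Λ)
    (n : ℕ) : Prop where
  ne_zero : n ≠ 0
  mem : ∀ x, P x ∈ S
  mem_iff : ∀ x, x ∈ S ↔ P x = n • x
  adjoint : ∀ x, ∀ y ∈ S, B (P x) y = n * B x y

namespace IsScaledProjection

variable {B : LinearMap.BilinForm ℤ Λ} {S : Submodule ℤ Λ} {P : Λ →ₗ[ℤ] Λ} {n : ℕ}

/-- The orthogonal projection to `ℚ ⊗ S`. -/
def proj (h : IsScaledProjection B S P n) : Λ →+ ℚ ⊗[ℤ] S :=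
  (TensorProduct.mk ℤ ℚ S (1 / n)).toAddMonoidHom.comp (P.codRestrict S h.mem).toAddMonoidHom

lemma proj_apply (h : IsScaledProjection B S P n) (x : Λ) :
    h.proj x = (1 / n : ℚ) ⊗ₜ[ℤ] (⟨P x, h.mem x⟩ : S) := rfl

lemma ratForm_proj (h : IsScaledProjection B S P n) (x : Λ) (y : S) :
    ratForm (B.restrict S) (h.proj x) (1 ⊗ₜ[ℤ] y) = B x y := by
  have hn : (n : ℚ) ≠ 0 := by exact_mod_cast h.ne_zero
  have h1 : (B.restrict S) ⟨P x, h.mem x⟩ y = n * B x y := h.adjoint x y y.2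
  rw [proj_apply, ratForm_tmul, h1]
  push_cast
  field_simp

lemma proj_mem (h : IsScaledProjection B S P n) (x : Λ) : h.proj x ∈ dualLattice (B.restrict S) :=
  mem_dualLattice_iff.2 fun l => ⟨B x l, h.ratForm_proj x l⟩

lemma mem_of_zsmul_mem (h : IsScaledProjection B S P n) {k : ℤ} (hk : k ≠ 0) {x : Λ}
    (hx : k • x ∈ S) : x ∈ S := by
  rw [h.mem_iff, map_zsmul, smul_comm] at hx
  rw [h.mem_iff]
  exact smul_right_injective Λ hk hx

lemma isTorsionFree_quotient (h : IsScaledProjection B S P n) : Module.IsTorsionFree ℤ (Λ ⧸ S) := by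
  refine Module.IsTorsionFree.of_smul_eq_zero fun k y hky => ?_
  obtain ⟨y, rfl⟩ := S.mkQ_surjective y
  rw [or_iff_not_imp_left]
  intro hk
  rw [← map_smul, Submodule.mkQ_apply, Submodule.Quotient.mk_eq_zero] at hky
  exact (Submodule.Quotient.mk_eq_zero _).2 (h.mem_of_zsmul_mem hk hky)

/-- Every vector of the dual lattice of `S` is the projection of a vector of `Λ`. -/
lemma exists_proj_eq (h : IsScaledProjection B S P n) (hB : (ratForm B).Nondegenerate)
    (hS : (ratForm (B.restrict S)).Nondegenerate) (hu : dualLattice B = latticeIn Λ)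
    {x : ℚ ⊗[ℤ] S} (hx : x ∈ dualLattice (B.restrict S)) : ∃ l, x = h.proj l := by
  have := h.isTorsionFree_quotient
  -- S is primitive, so Λ/S is free and S is a direct summand. A functional on S therefore extends
  -- to Λ along the retraction r, and unimodularity represents the extension.
  obtain ⟨s, hs⟩ := Module.projective_lifting_property S.mkQ LinearMap.id S.mkQ_surjective
  have hs' : ∀ y, S.mkQ (s y) = y := fun y => LinearMap.congr_fun hs y
  let r : Λ →ₗ[ℤ] S := (LinearMap.id - s.comp S.mkQ).codRestrict S fun y => by
    rw [← Submodule.Quotient.mk_eq_zero, ← Submodule.mkQ_apply, LinearMap.sub_apply, map_sub]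
    simp [hs']
  have hr : ∀ y : S, r y = y := fun y => Subtype.ext (by
    simp [r, (Submodule.Quotient.mk_eq_zero S).2 y.2])
  choose f hf using mem_dualLattice_iff.1 hx
  let φ : S →ₗ[ℤ] ℤ := AddMonoidHom.toIntLinearMap
    { toFun := f
      map_zero' := by
        have := hf 0
        rw [TensorProduct.tmul_zero, map_zero] at this
        exact_mod_cast this.symm
      map_add' := fun y z => by
        have := hf (y + z)
        rw [TensorProduct.tmul_add, map_add, hf, hf] at this
        exact_mod_cast this.symm }
  obtain ⟨l, hl⟩ := exists_eq_of_unimodular hB hu (φ.comp r)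
  refine ⟨l, ratForm_ext hS fun y => ?_⟩
  rw [hf, h.ratForm_proj, hl]
  change _ = ((φ (r y) : ℤ) : ℚ)
  rw [hr]
  rfl

lemma proj_mem_latticeIn_iff (h : IsScaledProjection B S P n) {x : Λ} :
    h.proj x ∈ latticeIn S ↔ ∃ y, P x = n • y := by
  have hn : (n : ℚ) ≠ 0 := by exact_mod_cast h.ne_zero
  have key : ∀ s : S, n • ((1 / n : ℚ) ⊗ₜ[ℤ] s) = 1 ⊗ₜ[ℤ] s := fun s => by
    rw [TensorProduct.smul_tmul', nsmul_eq_mul, mul_one_div_cancel hn]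
  constructor
  · rintro ⟨s, hs⟩
    refine ⟨s, ?_⟩
    have h1 := congrArg (fun z => n • z) hs
    change n • ((1 : ℚ) ⊗ₜ[ℤ] s) = n • h.proj x at h1
    rw [proj_apply, key, ← TensorProduct.tmul_smul] at h1
    exact (congrArg Subtype.val (one_tmul_injective h1)).symm
  · rintro ⟨y, hy⟩
    have hyS : y ∈ S := by
      refine h.mem_of_zsmul_mem (k := n) (by exact_mod_cast h.ne_zero) ?_
      rw [natCast_zsmul, ← hy]
      exact h.mem x
    refine ⟨⟨y, hyS⟩, ?_⟩
    change (1 : ℚ) ⊗ₜ[ℤ] (⟨y, hyS⟩ : S) = _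
    rw [proj_apply]
    have : (⟨P x, h.mem x⟩ : S) = n • ⟨y, hyS⟩ := Subtype.ext hy
    rw [this, TensorProduct.tmul_smul, key]

/-- The order of the discriminant group of `S` is an index in `Λ`. -/
lemma natCard_discGroup (h : IsScaledProjection B S P n) (hB : (ratForm B).Nondegenerate)
    (hS : (ratForm (B.restrict S)).Nondegenerate) (hu : dualLattice B = latticeIn Λ)
    (J : AddSubgroup Λ) (hJ : ∀ x, x ∈ J ↔ ∃ y, P x = n • y) :
    Nat.card (DiscGroup (B.restrict S)) = J.index := by
  -- Projection induces a surjection of Λ onto the discriminant group of S, with kernel J.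
  let f : Λ →+ DiscGroup (B.restrict S) :=
    (Submodule.mkQ _).toAddMonoidHom.comp (h.proj.codRestrict (dualLattice (B.restrict S)) h.proj_mem)
  have hf : ∀ x, f x = Disc.mk (h.proj x) (h.proj_mem x) := fun x => rfl
  have hker : f.ker = J := by
    ext x
    rw [AddMonoidHom.mem_ker, hJ, ← h.proj_mem_latticeIn_iff, hf]
    exact Submodule.Quotient.mk_eq_zero _
  have hsurj : Function.Surjective f := by
    intro γ
    obtain ⟨x, hx, rfl⟩ := Disc.exists_mk γ
    obtain ⟨l, rfl⟩ := h.exists_proj_eq hB hS hu hx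
    exact ⟨l, rfl⟩
  rw [← hker, AddSubgroup.index_ker, AddMonoidHom.range_eq_top.2 hsurj, AddSubgroup.card_top]

end IsScaledProjection

end Projections

/-! ### Finite order automorphisms and their fixed lattices. -/

section Automorphisms

variable {Λ : Type*} [AddCommGroup Λ] {B : LinearMap.BilinForm ℤ Λ}

/-- A unipotent isometry of a definite lattice is trivial. -/
lemma apply_eq_self_of_unipotent (hpos : ∀ x, x ≠ 0 → 0 < B x x)
    (h : Module.End ℤ Λ) (hiso : ∀ x y, B (h x) (h y) = B x y) (n : ℕ) (x : Λ)
    (hx : ((h - 1) ^ n) x = 0) : h x = x := by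
  have key : ∀ x, (h - 1) ((h - 1) x) = 0 → (h - 1) x = 0 := by
    intro x hx
    by_contra h0
    set y := (h - 1) x with hy
    have h1 : h x = x + y := by rw [hy, LinearMap.sub_apply, Module.End.one_apply]; abel
    have h2 : h y = y := by
      rw [LinearMap.sub_apply, Module.End.one_apply, sub_eq_zero] at hx
      exact hx
    -- With h x = x + y and h y = y, invariance of (x, y) gives (y, y) = 0.
    have h3 := hiso x y
    rw [h1, h2, map_add, LinearMap.add_apply] at h3
    have := hpos y h0
    omega
  have main : ∀ (n : ℕ) (x : Λ), ((h - 1) ^ n) x = 0 → (h - 1) x = 0 := by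
    intro n
    induction n with
    | zero =>
      intro x hx
      rw [pow_zero, Module.End.one_apply] at hx
      rw [hx, map_zero]
    | succ n ih =>
      intro x hx
      rw [pow_succ, Module.End.mul_apply] at hx
      exact key x (ih _ hx)
  have := main n x hx
  rwa [LinearMap.sub_apply, Module.End.one_apply, sub_eq_zero] at this

end Automorphisms

section Trace

variable {Λ : Type*} [AddCommGroup Λ] [Module.Free ℤ Λ] [Module.Finite ℤ Λ]

lemma natCard_quotient_range {φ : Λ →ₗ[ℤ] Λ} (hφ : Function.Injective φ) :
    Nat.card (Λ ⧸ LinearMap.range φ) = (LinearMap.det φ).natAbs := by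
  rw [← Submodule.natAbs_det_equiv _ (LinearEquiv.ofInjective φ hφ)]
  rfl

/-- The trace `1 + g + ⋯ + g^{p-1}`. -/
def orbitSum (g : Λ ≃ₗ[ℤ] Λ) (p : ℕ) : Module.End ℤ Λ :=
  ∑ i ∈ Finset.range p, (g : Λ →ₗ[ℤ] Λ) ^ i

/-- An isometry of a definite lattice with characteristic polynomial `(X-1)^m (X^p-1)^m` has
order dividing `p`. -/
lemma pow_eq_one_of_hasCycleShape {B : LinearMap.BilinForm ℤ Λ}
    (hpos : ∀ x, x ≠ 0 → 0 < B x x) {p m : ℕ} {g : Λ ≃ₗ[ℤ] Λ}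
    (hg : ∀ x y, B (g x) (g y) = B x y)
    (hshape : HasCycleShape g (Multiset.replicate m 1 + Multiset.replicate m p)) :
    ((g : Λ →ₗ[ℤ] Λ) : Module.End ℤ Λ) ^ p = 1 := by
  set G : Module.End ℤ Λ := (g : Λ →ₗ[ℤ] Λ) with hG
  have h1 : (G - 1) ^ m * (G ^ p - 1) ^ m = 0 := by
    have := LinearMap.aeval_self_charpoly G
    rw [hshape] at this
    simpa using this
  -- By Cayley–Hamilton (G-1)^m (G^p-1)^m = 0, and G - 1 divides G^p - 1. So G^p is unipotent, and a
  -- unipotent isometry of a definite lattice is trivial.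
  have h2 : (G ^ p - 1) ^ (m + m) = 0 := by
    have hc : Commute (G - 1) (orbitSum g p) :=
      Commute.sum_right _ _ _ fun i _ => ((Commute.refl G).pow_right i).sub_left (Commute.one_left _)
    have h3 : G ^ p - 1 = (orbitSum g p) * (G - 1) := (geom_sum_mul G p).symm
    rw [pow_add]
    nth_rw 1 [h3]
    rw [hc.symm.mul_pow, mul_assoc, h1, mul_zero]
  have hiso : ∀ n : ℕ, ∀ x y, B ((G ^ n) x) ((G ^ n) y) = B x y := by
    intro n
    induction n with
    | zero => simp
    | succ n ih =>
      intro x y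
      rw [pow_succ', Module.End.mul_apply, Module.End.mul_apply]
      exact (hg _ _).trans (ih x y)
  refine LinearMap.ext fun x => ?_
  exact apply_eq_self_of_unipotent hpos (G ^ p) (hiso p) (m + m) x (by rw [h2]; rfl)

lemma mem_fixedSublattice {g : Λ ≃ₗ[ℤ] Λ} {x : Λ} : x ∈ fixedSublattice g ↔ g x = x := Iff.rfl

lemma orbitSum_apply_of_mem {g : Λ ≃ₗ[ℤ] Λ} (p : ℕ) {x : Λ} (hx : x ∈ fixedSublattice g) :
    orbitSum g p x = p • x := by
  have h : ∀ i : ℕ, (((g : Λ →ₗ[ℤ] Λ) : Module.End ℤ Λ) ^ i) x = x := by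
    intro i
    induction i with
    | zero => rfl
    | succ i ih =>
      rw [pow_succ, Module.End.mul_apply]
      exact (congrArg _ hx).trans ih
  rw [orbitSum, LinearMap.sum_apply, Finset.sum_congr rfl fun i _ => h i, Finset.sum_const,
    Finset.card_range]

lemma orbitSum_sub_apply {g : Λ ≃ₗ[ℤ] Λ} {p : ℕ}
    (hgp : ((g : Λ →ₗ[ℤ] Λ) : Module.End ℤ Λ) ^ p = 1) (x : Λ) : orbitSum g p (g x - x) = 0 := by
  have h := geom_sum_mul ((g : Λ →ₗ[ℤ] Λ) : Module.End ℤ Λ) p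
  rw [hgp, sub_self] at h
  exact LinearMap.congr_fun h x

/-- The orbit sum is `p` times the projection to the fixed sublattice. -/
lemma isScaledProjection_orbitSum {B : LinearMap.BilinForm ℤ Λ} {g : Λ ≃ₗ[ℤ] Λ} {p : ℕ}
    (hp : p ≠ 0) (hg : ∀ x y, B (g x) (g y) = B x y)
    (hgp : ((g : Λ →ₗ[ℤ] Λ) : Module.End ℤ Λ) ^ p = 1) :
    IsScaledProjection B (fixedSublattice g) (orbitSum g p) p := by
  have hmem : ∀ x, orbitSum g p x ∈ fixedSublattice g := by
    intro x
    have h := mul_geom_sum ((g : Λ →ₗ[ℤ] Λ) : Module.End ℤ Λ) p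
    rw [hgp, sub_self] at h
    have := LinearMap.congr_fun h x
    rw [sub_mul, one_mul, LinearMap.sub_apply, LinearMap.zero_apply, sub_eq_zero] at this
    exact this
  refine ⟨hp, hmem, fun x => ⟨orbitSum_apply_of_mem p, fun hx => ?_⟩, fun x y hy => ?_⟩
  · have h1 := hmem x
    rw [hx, mem_fixedSublattice, map_nsmul] at h1
    rw [← natCast_zsmul, ← natCast_zsmul] at h1
    exact smul_right_injective Λ (r := (p : ℤ)) (by exact_mod_cast hp) h1
  · have h : ∀ i : ℕ, B ((((g : Λ →ₗ[ℤ] Λ) : Module.End ℤ Λ) ^ i) x) y = B x y := by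
      intro i
      induction i with
      | zero => rfl
      | succ i ih =>
        rw [pow_succ', Module.End.mul_apply, ← ih]
        conv_lhs => rw [← mem_fixedSublattice.1 hy]
        exact hg _ _
    rw [orbitSum, LinearMap.sum_apply, map_sum, LinearMap.sum_apply,
      Finset.sum_congr rfl fun i _ => h i, Finset.sum_const, Finset.card_range, nsmul_eq_mul]

/-- An automorphism of prime order `p` of a unimodular lattice with characteristic polynomial
`(X-1)^m (X^p-1)^m`: the rank of the fixed sublattice, and a bound for its discriminant. -/
lemma finrank_fixedSublattice_and_index {B : LinearMap.BilinForm ℤ Λ} {g : Λ ≃ₗ[ℤ] Λ} {p m : ℕ}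
    (hp : p ≠ 0) (hg : ∀ x y, B (g x) (g y) = B x y)
    (hgp : ((g : Λ →ₗ[ℤ] Λ) : Module.End ℤ Λ) ^ p = 1)
    (hshape : HasCycleShape g (Multiset.replicate m 1 + Multiset.replicate m p))
    (J : AddSubgroup Λ) (hJ : ∀ x, x ∈ J ↔ ∃ y, orbitSum g p x = p • y) :
    Module.finrank ℤ (fixedSublattice g) = 2 * m ∧ J.index ∣ p ^ m := by
  have hpr := isScaledProjection_orbitSum hp hg hgp
  have := hpr.isTorsionFree_quotient
  set K := fixedSublattice g with hK
  set G : Λ →ₗ[ℤ] Λ := (g : Λ →ₗ[ℤ] Λ) with hG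
  have hle : K ≤ K.comap G := fun x hx => by
    rw [Submodule.mem_comap]
    have : G x = x := hx
    rwa [this]
  set gq := K.mapQ K G hle with hgq
  -- If x - gx is fixed by g, its orbit sum is p(x - gx) and also 0, so x is fixed. Thus g has no
  -- eigenvalue 1 on Λ/K.
  have hinj : Function.Injective (LinearMap.id - gq : (Λ ⧸ K) →ₗ[ℤ] (Λ ⧸ K)) := by
    rw [injective_iff_map_eq_zero]
    intro y hy
    obtain ⟨x, rfl⟩ := K.mkQ_surjective y
    have h1 : x - G x ∈ K := (Submodule.Quotient.mk_eq_zero K).1 hy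
    have h2 : p • (G x - x) = 0 := by
      have h3 : G x - x ∈ K := by rw [← neg_sub]; exact neg_mem h1
      rw [← orbitSum_apply_of_mem p h3]
      exact orbitSum_sub_apply hgp x
    have h3 : G x - x = 0 := by
      rw [← natCast_zsmul] at h2
      exact (smul_eq_zero.1 h2).resolve_left (by exact_mod_cast hp)
    exact (Submodule.Quotient.mk_eq_zero K).2 (sub_eq_zero.1 h3)
  have hchar : G.charpoly = (Polynomial.X - 1) ^ Module.finrank ℤ K * gq.charpoly := by
    refine Polynomial.funext fun t => ?_
    have hle' : K ≤ K.comap (algebraMap ℤ (Module.End ℤ Λ) t - G) := fun x hx => by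
      rw [Submodule.mem_comap, LinearMap.sub_apply]
      exact sub_mem (by simpa using K.smul_mem t hx) (hle hx)
    have h1 : (algebraMap ℤ (Module.End ℤ Λ) t - G).restrict hle' = (t - 1) • LinearMap.id := by
      ext x
      have : G x = x := x.2
      simp [LinearMap.restrict_apply, this, sub_smul]
    have h2 : K.mapQ K (algebraMap ℤ (Module.End ℤ Λ) t - G) hle' =
        algebraMap ℤ (Module.End ℤ (Λ ⧸ K)) t - gq := by
      refine LinearMap.ext fun y => ?_
      obtain ⟨x, rfl⟩ := K.mkQ_surjective y
      simp [hgq]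
    rw [LinearMap.eval_charpoly, LinearMap.det_eq_det_mul_det K _ hle', h1, h2, LinearMap.det_smul,
      LinearMap.det_id, mul_one, Polynomial.eval_mul, LinearMap.eval_charpoly]
    simp
  have hshape' : (Polynomial.X - 1 : Polynomial ℤ) ^ (2 * m) *
      (∑ i ∈ Finset.range p, Polynomial.X ^ i) ^ m =
      (Polynomial.X - 1) ^ Module.finrank ℤ K * gq.charpoly := by
    rw [← hchar, hshape]
    simp only [Multiset.map_add, Multiset.map_replicate, Multiset.prod_add, Multiset.prod_replicate,
      pow_one]
    rw [← mul_geom_sum, mul_pow, two_mul, pow_add]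
    ring
  have hX : (Polynomial.X - 1 : Polynomial ℤ) ≠ 0 := by
    simpa using Polynomial.X_sub_C_ne_zero (1 : ℤ)
  have heval : (gq.charpoly).eval 1 = LinearMap.det (LinearMap.id - gq) := by
    rw [LinearMap.eval_charpoly, map_one]
    rfl
  have hdet : LinearMap.det (LinearMap.id - gq) ≠ 0 := by
    intro h0
    exact (LinearMap.det_eq_zero_iff_ker_ne_bot.1 h0) (LinearMap.ker_eq_bot.2 hinj)
  -- Compare orders of vanishing at 1: the second factor on each side of `hshape'` is nonzero there,
  -- namely p^m and det(1 - g) on Λ/K. The same comparison then identifies these two values.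
  have hr : Module.finrank ℤ K = 2 * m := by
    rcases lt_trichotomy (Module.finrank ℤ K) (2 * m) with h | h | h
    · obtain ⟨d, hd⟩ := Nat.exists_eq_add_of_lt h
      rw [hd, add_assoc, pow_add, mul_assoc] at hshape'
      have := congrArg (Polynomial.eval 1) (mul_left_cancel₀ (pow_ne_zero _ hX) hshape')
      rw [heval] at this
      simp at this
      exact absurd this.symm hdet
    · exact h
    · obtain ⟨d, hd⟩ := Nat.exists_eq_add_of_lt h
      rw [hd, add_assoc, pow_add _ (2 * m), mul_assoc] at hshape'
      have := congrArg (Polynomial.eval 1) (mul_left_cancel₀ (pow_ne_zero _ hX) hshape')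
      simp [Polynomial.eval_finsetSum] at this
      exact absurd this.1 hp
  refine ⟨hr, ?_⟩
  rw [hr] at hshape'
  have hdetval : LinearMap.det (LinearMap.id - gq) = (p : ℤ) ^ m := by
    rw [← heval, ← mul_left_cancel₀ (pow_ne_zero _ hX) hshape']
    simp [Polynomial.eval_finsetSum]
  have hcard : Nat.card ((Λ ⧸ K) ⧸ LinearMap.range (LinearMap.id - gq)) = p ^ m := by
    rw [natCard_quotient_range hinj, hdetval]
    simp
  have hidx : (((LinearMap.range (LinearMap.id - gq)).toAddSubgroup).comap
      K.mkQ.toAddMonoidHom).index = p ^ m := by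
    rw [AddSubgroup.index_comap_of_surjective _ (Submodule.mkQ_surjective K), ← hcard]
    rfl
  rw [← hidx]
  -- J contains the preimage of (1-g)(Λ/K), of index p^m: the orbit sum kills z - gz and multiplies
  -- K by p.
  refine AddSubgroup.index_dvd_of_le ?_
  rintro x ⟨z, hz⟩
  obtain ⟨z, rfl⟩ := K.mkQ_surjective z
  have h1 : z - G z - x ∈ K := by
    rw [← Submodule.Quotient.mk_eq_zero, Submodule.Quotient.mk_sub, sub_eq_zero]
    exact hz
  have h2 : orbitSum g p x = orbitSum g p (-(z - G z - x)) - orbitSum g p (G z - z) := by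
    rw [← map_sub]
    congr 1
    abel
  rw [hJ, h2, orbitSum_apply_of_mem p (neg_mem h1), show orbitSum g p (G z - z) = 0 from
    orbitSum_sub_apply hgp z, sub_zero]
  exact ⟨_, rfl⟩

end Trace

/-! ### Unimodular lattices of rank 8 without vectors of norm 1. -/

section Unimodular

variable {N : Type*} [AddCommGroup N] [Module.Free ℤ N] [Module.Finite ℤ N]

/-- The sublattice of vectors of even norm. -/
def evenSublattice {C : LinearMap.BilinForm ℤ N} (hs : ∀ x y, C x y = C y x) : Submodule ℤ N where
  carrier := {x | Even (C x x)}
  add_mem' {x y} hx hy := by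
    have : C (x + y) (x + y) = C x x + C y y + (C x y + C x y) := by
      simp only [map_add, LinearMap.add_apply, hs y x]
      ring
    rw [Set.mem_ofPred_eq, this]
    exact (Even.add hx hy).add ⟨_, rfl⟩
  zero_mem' := by simp
  smul_mem' k x hx := by
    have : C (k • x) (k • x) = k * k * C x x := by
      simp only [map_smul, LinearMap.smul_apply, smul_eq_mul]
      ring
    rw [Set.mem_ofPred_eq, this]
    exact Even.mul_left hx _

variable {C : LinearMap.BilinForm ℤ N} (hs : ∀ x y, C x y = C y x)

lemma mem_evenSublattice {x : N} : x ∈ evenSublattice hs ↔ Even (C x x) := Iff.rfl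

lemma two_smul_mem_evenSublattice (x : N) : (2 : ℤ) • x ∈ evenSublattice hs := by
  rw [mem_evenSublattice]
  simp only [map_smul, LinearMap.smul_apply, smul_eq_mul]
  exact (even_two.mul_right _)

lemma sub_mem_evenSublattice {x y : N} (hx : x ∉ evenSublattice hs) (hy : y ∉ evenSublattice hs) :
    x - y ∈ evenSublattice hs := by
  rw [mem_evenSublattice, Int.not_even_iff_odd] at hx hy
  have : C (x - y) (x - y) = C x x + C y y - (C x y + C x y) := by
    simp only [map_sub, LinearMap.sub_apply, hs y x]
    ring
  rw [mem_evenSublattice, this]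
  exact (hx.add_odd hy).sub ⟨_, rfl⟩

/-- The lattice `N` inside the rational span of its even sublattice. -/
def evenSublatticeIncl : N →+ ℚ ⊗[ℤ] (evenSublattice hs) where
  toFun x := (1 / 2 : ℚ) ⊗ₜ[ℤ] ⟨(2 : ℤ) • x, two_smul_mem_evenSublattice hs x⟩
  map_zero' := by
    have : (⟨(2 : ℤ) • (0 : N), two_smul_mem_evenSublattice hs 0⟩ : evenSublattice hs) = 0 :=
      Subtype.ext (smul_zero _)
    rw [this, TensorProduct.tmul_zero]
  map_add' x y := by
    rw [← TensorProduct.tmul_add]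
    congr 1
    exact Subtype.ext (smul_add _ _ _)

lemma evenSublatticeIncl_of_mem {x : N} (hx : x ∈ evenSublattice hs) :
    evenSublatticeIncl hs x = 1 ⊗ₜ[ℤ] ⟨x, hx⟩ := by
  have : (⟨(2 : ℤ) • x, two_smul_mem_evenSublattice hs x⟩ : evenSublattice hs) =
    (2 : ℤ) • ⟨x, hx⟩ := rfl
  change (1 / 2 : ℚ) ⊗ₜ[ℤ] _ = _
  rw [this, ← TensorProduct.smul_tmul, zsmul_eq_mul]
  norm_num

lemma ratForm_evenSublatticeIncl (x y : N) :
    ratForm (C.restrict (evenSublattice hs)) (evenSublatticeIncl hs x) (evenSublatticeIncl hs y) =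
      C x y := by
  change ratForm _ ((1 / 2 : ℚ) ⊗ₜ[ℤ] _) ((1 / 2 : ℚ) ⊗ₜ[ℤ] _) = _
  rw [ratForm_tmul]
  change _ * ((C ((2 : ℤ) • x) ((2 : ℤ) • y) : ℤ) : ℚ) = _
  simp only [map_smul, LinearMap.smul_apply, smul_eq_mul]
  push_cast
  ring

lemma finrank_evenSublattice :
    Module.finrank ℤ (evenSublattice hs) = Module.finrank ℤ N := by
  refine le_antisymm (Submodule.finrank_le _) ?_
  let φ : N →ₗ[ℤ] evenSublattice hs :=
    ((2 : ℤ) • LinearMap.id : N →ₗ[ℤ] N).codRestrict _ (two_smul_mem_evenSublattice hs)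
  refine LinearMap.finrank_le_finrank_of_injective (f := φ) fun x y hxy => ?_
  exact smul_right_injective N (r := (2 : ℤ)) two_ne_zero (congrArg Subtype.val hxy)

lemma isEvenLattice_evenSublattice (hpos : ∀ x, x ≠ 0 → 0 < C x x) :
    IsEvenLattice (C.restrict (evenSublattice hs)) where
  symm x y := hs x y
  even x := x.2
  nondegenerate := by
    have h : ∀ x : evenSublattice hs, x ≠ 0 → 0 < C x x := fun x hx => hpos x fun h => hx (Subtype.ext h)
    refine ⟨fun x hx => ?_, fun x hx => ?_⟩ <;> by_contra h0 <;> exact (h x h0).ne' (hx x)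

/-- The vectors of the dual of the even sublattice that pair integrally with an odd vector. -/
lemma exists_evenSublatticeIncl_eq
    (hpos : ∀ x, x ≠ 0 → 0 < C x x) (hu : ∀ φ : N →ₗ[ℤ] ℤ, ∃ z, ∀ y, C z y = φ y)
    {y₁ : N} (hy₁ : y₁ ∉ evenSublattice hs)
    {x : ℚ ⊗[ℤ] (evenSublattice hs)} (hx : x ∈ dualLattice (C.restrict (evenSublattice hs)))
    (hxy : ∃ k : ℤ, ratForm (C.restrict (evenSublattice hs)) x (evenSublatticeIncl hs y₁) = k) :
    ∃ z, x = evenSublatticeIncl hs z := by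
  have hL := isEvenLattice_evenSublattice hs hpos
  have hint : ∀ y, ∃ k : ℤ,
      ratForm (C.restrict (evenSublattice hs)) x (evenSublatticeIncl hs y) = k := by
    have h1 : ∀ y ∈ evenSublattice hs, ∃ k : ℤ,
        ratForm (C.restrict (evenSublattice hs)) x (evenSublatticeIncl hs y) = k := fun y hy => by
      rw [evenSublatticeIncl_of_mem hs hy]
      exact mem_dualLattice_iff.1 hx _
    intro y
    by_cases hy : y ∈ evenSublattice hs
    · exact h1 y hy
    · obtain ⟨k, hk⟩ := h1 _ (sub_mem_evenSublattice hs hy hy₁)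
      obtain ⟨l, hl⟩ := hxy
      refine ⟨k + l, ?_⟩
      rw [map_sub, map_sub, hl] at hk
      push_cast
      linarith
  choose f hf using hint
  let φ : N →ₗ[ℤ] ℤ := AddMonoidHom.toIntLinearMap
    { toFun := f
      map_zero' := by
        have := hf 0
        rw [map_zero, map_zero] at this
        exact_mod_cast this.symm
      map_add' := fun y z => by
        have := hf (y + z)
        rw [map_add, map_add, hf, hf] at this
        exact_mod_cast this.symm }
  obtain ⟨z, hz⟩ := hu φ
  refine ⟨z, ratForm_ext hL.isEvenLatticeIn.nondegenerate fun l => ?_⟩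
  rw [← evenSublatticeIncl_of_mem hs l.2, hf, ratForm_evenSublatticeIncl, hz]
  rfl

/-- A positive definite unimodular lattice of rank `8` without vectors of norm `1` is even. -/
theorem even_of_unimodular_of_finrank_eq_eight (hs : ∀ x y, C x y = C y x)
    (hpos : ∀ x, x ≠ 0 → 0 < C x x) (hu : ∀ φ : N →ₗ[ℤ] ℤ, ∃ z, ∀ y, C z y = φ y)
    (hN : Module.finrank ℤ N = 8)
    (hmin : ∀ x, x ≠ 0 → 2 ≤ C x x) (y₁ : N) : Even (C y₁ y₁) := by
  classical
  by_contra hy₁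
  change y₁ ∉ evenSublattice hs at hy₁
  have hL := isEvenLattice_evenSublattice hs hpos
  set L := evenSublattice hs with hLdef
  set j := evenSublatticeIncl hs with hj
  set b := ratForm (C.restrict L) with hb
  have hin : IsEvenLatticeIn b (latticeIn L) (dualLattice (C.restrict L)) := hL.isEvenLatticeIn
  have hjmem : ∀ y, j y ∈ dualLattice (C.restrict L) := fun y =>
    mem_dualLattice_iff.2 fun l => ⟨C y l, by
      rw [← evenSublatticeIncl_of_mem hs l.2]
      exact ratForm_evenSublatticeIncl hs y l⟩
  have hjmem' : ∀ y, j y ∈ latticeIn L ↔ y ∈ L := by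
    intro y
    constructor
    · rintro ⟨l, hl⟩
      change (1 : ℚ) ⊗ₜ[ℤ] l = j y at hl
      have h1 : (2 : ℤ) • ((1 : ℚ) ⊗ₜ[ℤ] l) = (2 : ℤ) • j y := by rw [hl]
      rw [← TensorProduct.tmul_smul, ← map_zsmul,
        evenSublatticeIncl_of_mem hs (two_smul_mem_evenSublattice hs y)] at h1
      have h2 := congrArg Subtype.val (one_tmul_injective h1)
      have h3 : (l : N) = y := smul_right_injective N (r := (2 : ℤ)) two_ne_zero h2
      exact h3 ▸ l.2
    · intro hy
      rw [hj, evenSublatticeIncl_of_mem hs hy]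
      exact one_tmul_mem_latticeIn _
  have := hin.finite_disc
  have := Fintype.ofFinite (Disc (latticeIn L) (dualLattice (C.restrict L)))
  set ν : Disc (latticeIn L) (dualLattice (C.restrict L)) := Disc.mk (j y₁) (hjmem y₁) with hν
  have hν0 : ν ≠ 0 := fun h0 =>
    hy₁ ((hjmem' y₁).1 ((Submodule.Quotient.mk_eq_zero
      ((latticeIn L).submoduleOf (dualLattice (C.restrict L)))).1 h0))
  have hpm : ∀ δ, ePair b δ ν = 1 ∨ ePair b δ ν = -1 := by
    intro δ
    obtain ⟨x, hx, rfl⟩ := δ.exists_mk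
    rw [hν, hin.ePair_mk, ← sq_eq_one_iff, sq, ← e_add, ← two_mul]
    have : (2 * ((b x (j y₁) : ℚ) : ℂ)) = ((b x ((2 : ℤ) • j y₁) : ℚ) : ℂ) := by
      rw [map_zsmul, zsmul_eq_mul]
      push_cast
      rfl
    rw [this, e_ratCast_eq_one_iff]
    refine hin.exists_int hx ?_
    rw [← map_zsmul, hjmem']
    exact two_smul_mem_evenSublattice hs y₁
  have hone : ∀ δ, ePair b δ ν = 1 ↔ δ = 0 ∨ δ = ν := by
    intro δ
    constructor
    · intro hδ
      obtain ⟨x, hx, rfl⟩ := δ.exists_mk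
      rw [hν, hin.ePair_mk, e_ratCast_eq_one_iff] at hδ
      obtain ⟨z, rfl⟩ := exists_evenSublatticeIncl_eq hs hpos hu hy₁ hx hδ
      by_cases hz : z ∈ L
      · left
        exact (Submodule.Quotient.mk_eq_zero _).2 ((hjmem' z).2 hz)
      · right
        refine Disc.mk_eq_mk_iff.2 ?_
        rw [← map_sub]
        exact (hjmem' _).2 (sub_mem_evenSublattice hs hz hy₁)
    · rintro (rfl | rfl)
      · rw [hin.ePair_comm, hin.ePair_zero]
      · rw [hν, hin.ePair_mk, e_ratCast_eq_one_iff]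
        exact ⟨_, ratForm_evenSublatticeIncl hs y₁ y₁⟩
  -- Pairing with the class ν of an odd vector is a nontrivial character with values ±1, which is 1
  -- exactly on {0, ν}. Summing 1 plus the character over the group gives 2·2.
  have hcard : Fintype.card (Disc (latticeIn L) (dualLattice (C.restrict L))) = 4 := by
    have h1 : ∑ δ, (1 + ePair b δ ν) =
        (Fintype.card (Disc (latticeIn L) (dualLattice (C.restrict L))) : ℂ) := by
      rw [Finset.sum_add_distrib]
      simp_rw [hin.ePair_comm _ ν]
      rw [hin.sum_ePair, if_neg hν0]
      simp
    have h2 : ∀ δ, (1 + ePair b δ ν) = if δ ∈ ({0, ν} : Finset _) then 2 else 0 := by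
      intro δ
      simp only [Finset.mem_insert, Finset.mem_singleton, ← hone]
      rcases hpm δ with h | h <;> rw [h] <;> norm_num
    simp_rw [h2] at h1
    rw [Finset.sum_ite_mem, Finset.univ_inter, Finset.sum_const, Finset.card_pair hν0.symm] at h1
    norm_num at h1
    exact_mod_cast h1.symm
  have heν : eNorm b ν = -1 := by
    rw [hν, hin.eNorm_mk]
    obtain ⟨k, hk⟩ := Int.not_even_iff_odd.1 hy₁
    rw [show b (j y₁) (j y₁) = C y₁ y₁ from ratForm_evenSublatticeIncl hs y₁ y₁, hk, ← e_half]
    refine e_eq_of_sub_eq_int k ?_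
    push_cast
    ring
  -- Milgram's formula: √4 · e(8/8).
  have hsum : ∑ δ : Disc (latticeIn L) (dualLattice (C.restrict L)), eNorm b δ = 2 := by
    have h1 := hL.sum_eNorm_of_pos fun x hx => hpos x fun h => hx (Subtype.ext h)
    rw [hcard, finrank_evenSublattice, hN] at h1
    rw [h1, show (((4 : ℕ) : ℝ)) = 2 ^ 2 by norm_num, Real.sqrt_sq (by norm_num)]
    have : e (((8 : ℕ) : ℂ) / 8) = 1 := by
      have := e_int 1
      rw [← this]
      congr 1
      norm_num
    rw [this]
    simp
  -- Four numbers of absolute value 1 add up to 2 and the one at ν is -1, so the other three are all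
  -- 1.
  have hothers : ∀ δ, δ ≠ ν → eNorm b δ = 1 := by
    have hnorm : ∀ δ : Disc (latticeIn L) (dualLattice (C.restrict L)), ‖eNorm b δ‖ = 1 :=
      fun δ => norm_e_ratCast _
    have h1 : ∑ δ : Disc (latticeIn L) (dualLattice (C.restrict L)), (1 - (eNorm b δ).re) = 2 := by
      have := congrArg Complex.re hsum
      rw [Complex.re_sum] at this
      rw [Finset.sum_sub_distrib, this, Finset.sum_const, Finset.card_univ, hcard]
      norm_num
    rw [← Finset.add_sum_erase _ _ (Finset.mem_univ ν), heν] at h1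
    have h2 : ∑ δ ∈ Finset.univ.erase ν, (1 - (eNorm b δ).re) = 0 := by
      simp only [Complex.neg_re, Complex.one_re] at h1
      linarith
    rw [Finset.sum_eq_zero_iff_of_nonneg fun δ _ => by
      linarith [Complex.re_le_norm (eNorm b δ), hnorm δ]] at h2
    intro δ hδ
    have h3 := h2 δ (Finset.mem_erase.2 ⟨hδ, Finset.mem_univ _⟩)
    have h4 : (eNorm b δ).re = 1 := by linarith
    have h5 := hnorm δ
    rw [← sq_eq_sq₀ (norm_nonneg _) zero_le_one, ← Complex.normSq_eq_norm_sq, Complex.normSq_apply,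
      h4] at h5
    have h6 : (eNorm b δ).im = 0 := by
      have : (eNorm b δ).im * (eNorm b δ).im = 0 := by linarith
      exact mul_self_eq_zero.1 this
    exact Complex.ext h4 h6
  have hposV : ∀ x : ℚ ⊗[ℤ] L, x ≠ 0 → 0 < b x x := by
    intro x hx
    obtain ⟨n, hn, l, hl⟩ := exists_zsmul_eq_tmul x
    have hl0 : (l : N) ≠ 0 := by
      intro h0
      rw [show l = 0 from Subtype.ext h0, TensorProduct.tmul_zero] at hl
      exact hx (eq_zero_of_zsmul_eq_zero hn hl)
    have h1 : b (n • x) (n • x) = C l l := by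
      rw [hl, hb, ratForm_tmul, mul_one, one_mul]
      rfl
    simp only [map_zsmul, LinearMap.smul_apply, zsmul_eq_mul] at h1
    have h2 : (0 : ℚ) < C l l := by exact_mod_cast hpos l hl0
    rw [← h1, ← mul_assoc] at h2
    exact (pos_iff_pos_of_mul_pos h2).1 (mul_self_pos.2 (by exact_mod_cast hn))
  -- Hence the whole dual of the even sublattice has minimum at least 2: in the class ν by
  -- hypothesis on N, elsewhere because norms are positive even integers. Its determinant is 1/4,
  -- which violates Blichfeldt's bound π⁴/120 ≤ 1/2.
  have hminV : ∀ x ∈ dualLattice (C.restrict L), x ≠ 0 → 2 ≤ b x x := by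
    intro x hx hx0
    by_cases hxν : (Disc.mk x hx : Disc (latticeIn L) (dualLattice (C.restrict L))) = ν
    · rw [hν, Disc.mk_eq_mk_iff] at hxν
      obtain ⟨l, hl⟩ := hxν
      change (1 : ℚ) ⊗ₜ[ℤ] l = x - j y₁ at hl
      have hx' : x = j (y₁ + l) := by
        rw [map_add, hj, evenSublatticeIncl_of_mem hs l.2, hl]
        abel
      rw [hx', show b (j (y₁ + l)) (j (y₁ + l)) = C (y₁ + l) (y₁ + l) from
        ratForm_evenSublatticeIncl hs _ _]
      have : y₁ + l ≠ 0 := by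
        intro h0
        rw [h0, map_zero] at hx'
        exact hx0 hx'
      exact_mod_cast hmin _ this
    · have h1 := hothers _ hxν
      rw [hin.eNorm_mk, e_ratCast_eq_one_iff] at h1
      obtain ⟨k, hk⟩ := h1
      have h2 := hposV x hx0
      have h3 : (0 : ℚ) < k := by linarith
      have h4 : (1 : ℤ) ≤ k := by exact_mod_cast h3
      have h5 : (1 : ℚ) ≤ k := by exact_mod_cast h4
      linarith
  have hfin := hin.finite
  let v := ratBasis (Module.finBasis ℤ L)
  have hdual : dualLattice (C.restrict L) =
      Submodule.span ℤ (Set.range (b.dualBasis hin.nondegenerate v)) := by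
    rw [← LinearMap.BilinForm.dualSubmodule_span_of_basis b hin.nondegenerate, ← latticeIn_eq_span]
    rfl
  have hbl := blichfeldt_rat b hin.symm (b.dualBasis hin.nondegenerate v) (h := 4)
    (by rw [Fintype.card_fin, finrank_evenSublattice, hN]) (by norm_num) (μ := 2) (by norm_num)
    fun x hx => hminV x (hdual ▸ hx)
  rw [det_toMatrix_dualBasis b hin.nondegenerate v] at hbl
  have hdet := natCard_disc hin v (latticeIn_eq_span _)
  rw [Nat.card_eq_fintype_card, hcard] at hdet
  have h1 : Real.sqrt ((((LinearMap.BilinForm.toMatrix v b).det)⁻¹ : ℚ) : ℝ) ≤ 1 / 2 := by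
    have h2 : ((LinearMap.BilinForm.toMatrix v b).det)⁻¹ ≤ 1 / 4 := by
      refine (le_abs_self _).trans ?_
      rw [abs_inv, ← hdet]
      norm_num
    rw [Real.sqrt_le_left (by norm_num)]
    refine le_trans (Rat.cast_le.2 h2) ?_
    norm_num
  have h2 := hbl.trans h1
  have h3 : (3 : ℝ) ^ 4 ≤ Real.pi ^ 4 := pow_le_pow_left₀ (by norm_num) Real.pi_gt_three.le 4
  norm_num [Nat.factorial] at h2
  linarith

end Unimodular

/-! ### Sublattices of the Leech lattice. -/

section Leech

variable {Λ : Type*} [AddCommGroup Λ] [Module.Free ℤ Λ] [Module.Finite ℤ Λ]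
  {B : LinearMap.BilinForm ℤ Λ}

namespace IsLeechLattice

lemma nondegenerate (hΛ : IsLeechLattice B) : (ratForm B).Nondegenerate :=
  ratForm_nondegenerate hΛ.symm fun x hx => by
    by_contra h
    exact (hΛ.posDef x h).ne' (hx x)

lemma restrict_pos (hΛ : IsLeechLattice B) (S : Submodule ℤ Λ) (x : S) (hx : x ≠ 0) :
    0 < B.restrict S x x :=
  hΛ.posDef x fun h => hx (Subtype.ext h)

lemma isEvenLattice_restrict (hΛ : IsLeechLattice B) (S : Submodule ℤ Λ) :
    IsEvenLattice (B.restrict S) where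
  symm x y := hΛ.symm x y
  even x := hΛ.even x
  nondegenerate := by
    refine ⟨fun x hx => ?_, fun x hx => ?_⟩ <;> by_contra h0 <;>
      exact (hΛ.restrict_pos S x h0).ne' (hx x)

lemma four_le (hΛ : IsLeechLattice B) {x : Λ} (hx : x ≠ 0) : 4 ≤ B x x := by
  have h1 := hΛ.posDef x hx
  have h2 := hΛ.norm_ne_two x
  obtain ⟨k, hk⟩ := hΛ.even x
  omega

/-- Blichfeldt's bound for the discriminant of a sublattice of the Leech lattice. -/
lemma le_natCard_discGroup (hΛ : IsLeechLattice B) (S : Submodule ℤ Λ) {n : ℕ}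
    (hS : Module.finrank ℤ S = 2 * n) (hn : n ≠ 0) :
    ((157 / 25 : ℝ) ^ n) ^ 2 ≤ ((n + 1).factorial : ℝ) ^ 2 * Nat.card (DiscGroup (B.restrict S)) := by
  have h1 := (hΛ.isEvenLattice_restrict S).blichfeldt hS hn (μ := 4) (by norm_num)
    fun x hx => hΛ.four_le fun h => hx (Subtype.ext h)
  rw [div_le_iff₀ (by positivity)] at h1
  -- 157/25 = 2 · 3.14 is a rational lower bound for π · 4/2, where 4 is the minimum of the Leech
  -- lattice.
  have h2 : (157 / 25 : ℝ) ^ n ≤ (Real.pi * ((4 : ℤ) / 2)) ^ n := by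
    refine pow_le_pow_left₀ (by norm_num) ?_ n
    have := Real.pi_gt_d2
    push_cast
    linarith
  have h3 := pow_le_pow_left₀ (by positivity) (h2.trans h1) 2
  rw [mul_pow, Real.sq_sqrt (by positivity), mul_comm] at h3
  exact h3

end IsLeechLattice

/-- A positive definite even lattice of rank `12` and level `3` does not have determinant `3⁵`. -/
lemma natCard_discGroup_ne_of_finrank_eq_twelve {L : Type*} [AddCommGroup L] [Module.Free ℤ L]
    [Module.Finite ℤ L] {C : LinearMap.BilinForm ℤ L} (hC : IsEvenLattice C)
    (hpos : ∀ x, x ≠ 0 → 0 < C x x) (hL : Module.finrank ℤ L = 12)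
    (hthree : ∀ x ∈ dualLattice C, ∃ k : ℤ, 3 * (ratForm C x x / 2) = k) :
    Nat.card (DiscGroup C) ≠ 3 ^ 5 := by
  intro hcard
  have hin := hC.isEvenLatticeIn
  have := hin.finite_disc
  have := Fintype.ofFinite (Disc (latticeIn L) (dualLattice C))
  have h1 := hC.sum_eNorm_of_pos hpos
  rw [← Nat.card_eq_fintype_card] at h1
  rw [hcard, hL] at h1
  have h2 : e (((12 : ℕ) : ℂ) / 8) = -1 := by
    rw [← e_half]
    refine e_eq_of_sub_eq_int 1 ?_
    norm_num
  -- Each summand is a cube root of unity, with real part 1 or -1/2.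
  have hre : ∀ γ : Disc (latticeIn L) (dualLattice C), ∃ k : ℤ, 2 * (eNorm (ratForm C) γ).re = k := by
    intro γ
    obtain ⟨x, hx, rfl⟩ := γ.exists_mk
    obtain ⟨k, hk⟩ := hthree x hx
    have h3 : eNorm (ratForm C) (Disc.mk x hx : Disc (latticeIn L) (dualLattice C)) ^ 3 = 1 := by
      rw [hin.eNorm_mk, e_pow]
      have : (((3 : ℕ) : ℂ) * ((ratForm C x x / 2 : ℚ) : ℂ)) = ((3 * (ratForm C x x / 2) : ℚ) : ℂ) := by
        push_cast
        ring
      rw [this, hk]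
      exact_mod_cast e_int k
    have h4 : ‖eNorm (ratForm C) (Disc.mk x hx : Disc (latticeIn L) (dualLattice C))‖ = 1 :=
      norm_e_ratCast _
    set z := eNorm (ratForm C) (Disc.mk x hx : Disc (latticeIn L) (dualLattice C))
    have h5 : (z - 1) * (z ^ 2 + z + 1) = 0 := by linear_combination h3
    rcases mul_eq_zero.1 h5 with h | h
    · refine ⟨2, ?_⟩
      rw [sub_eq_zero.1 h]
      norm_num
    · refine ⟨-1, ?_⟩
      have h6 : z * (starRingEnd ℂ) z = 1 := by
        rw [Complex.mul_conj, Complex.normSq_eq_norm_sq, h4]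
        norm_num
      have h7 : z + (starRingEnd ℂ) z = -1 := by
        linear_combination (starRingEnd ℂ z) * h - (z + 1) * h6
      rw [Complex.add_conj] at h7
      have := congrArg Complex.re h7
      simpa using this
  choose k hk using hre
  have h3 := congrArg Complex.re h1
  rw [h2, mul_neg_one, Complex.neg_re, Complex.ofReal_re, Complex.re_sum] at h3
  have h4 : ((∑ γ, k γ : ℤ) : ℝ) = -(2 * Real.sqrt ((3 ^ 5 : ℕ) : ℝ)) := by
    push_cast
    rw [← Finset.sum_congr rfl fun γ _ => hk γ, ← Finset.mul_sum, h3]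
    push_cast
    ring
  -- An integer would have square 4 · 3⁵ = 972, which lies strictly between 31² and 32².
  have h5 : ((∑ γ, k γ : ℤ) : ℝ) ^ 2 = 972 := by
    rw [h4, neg_sq, mul_pow, Real.sq_sqrt (by positivity)]
    norm_num
  have h6 : (∑ γ, k γ) ^ 2 = 972 := by exact_mod_cast h5
  generalize ∑ γ, k γ = n at h6
  have h7 : n < 32 := by nlinarith
  have h8 : -32 < n := by nlinarith
  interval_cases n <;> omega

/-- The sublattice on which `g` acts as `-1`. -/
def negSublattice (g : Λ ≃ₗ[ℤ] Λ) : Submodule ℤ Λ := LinearMap.ker (orbitSum g 2)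

lemma orbitSum_two_apply (g : Λ ≃ₗ[ℤ] Λ) (x : Λ) : orbitSum g 2 x = x + g x := by
  rw [orbitSum, Finset.sum_range_succ, Finset.sum_range_one, pow_zero, pow_one]
  rfl

/-- For an involution, (1 - g)/2 is the orthogonal projection to the (-1)-eigenspace. -/
lemma isScaledProjection_negSublattice {g : Λ ≃ₗ[ℤ] Λ} (hg : ∀ x y, B (g x) (g y) = B x y)
    (hg2 : ((g : Λ →ₗ[ℤ] Λ) : Module.End ℤ Λ) ^ 2 = 1) :
    IsScaledProjection B (negSublattice g) (LinearMap.id - (g : Λ →ₗ[ℤ] Λ)) 2 := by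
  have hsq : ∀ x, g (g x) = x := fun x => LinearMap.congr_fun hg2 x
  have hmem : ∀ x, x ∈ negSublattice g ↔ g x = -x := fun x => by
    rw [negSublattice, LinearMap.mem_ker, orbitSum_two_apply, add_eq_zero_iff_neg_eq, eq_comm]
  refine ⟨two_ne_zero, fun x => ?_, fun x => ?_, fun x y hy => ?_⟩
  · rw [hmem]
    simp [hsq]
  · rw [hmem]
    simp only [LinearMap.sub_apply, LinearMap.id_apply, LinearEquiv.coe_coe, two_smul]
    constructor
    · intro h
      rw [h, sub_neg_eq_add]
    · intro h
      rw [sub_eq_iff_eq_add] at h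
      have : x + (x + g x) = x + 0 := by rw [add_zero, ← add_assoc]; exact h.symm
      exact (neg_eq_of_add_eq_zero_right (add_left_cancel this)).symm
  · have h1 : B (g x) y = -B x y := by
      rw [hmem] at hy
      have h2 := hg x y
      rw [hy, map_neg] at h2
      omega
    simp only [LinearMap.sub_apply, LinearMap.id_apply, LinearEquiv.coe_coe, map_sub, h1]
    push_cast
    ring

/-- For `p = 2`: the norms on the dual of the fixed sublattice are integral. -/
lemma even_apply_of_natCard {g : Λ ≃ₗ[ℤ] Λ} (hΛ : IsLeechLattice B)
    (hg : ∀ x y, B (g x) (g y) = B x y)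
    (hg2 : ((g : Λ →ₗ[ℤ] Λ) : Module.End ℤ Λ) ^ 2 = 1)
    (hrank : Module.finrank ℤ (negSublattice g) = 8)
    (hcard : Nat.card (DiscGroup (B.restrict (negSublattice g))) = 2 ^ 8) (x : Λ) :
    Even (B x (g x)) := by
  have hpr := isScaledProjection_negSublattice hg hg2
  set N := negSublattice g with hN
  set P : Λ →ₗ[ℤ] Λ := LinearMap.id - (g : Λ →ₗ[ℤ] Λ) with hP
  have hPx : ∀ x, P x = x - g x := fun x => rfl
  let Q : Λ →ₗ[ℤ] N := P.codRestrict N hpr.mem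
  have hinj : Function.Injective ((2 : ℤ) • LinearMap.id : N →ₗ[ℤ] N) :=
    smul_right_injective N (r := (2 : ℤ)) two_ne_zero
  set D : AddSubgroup N := (LinearMap.range ((2 : ℤ) • LinearMap.id : N →ₗ[ℤ] N)).toAddSubgroup
    with hD
  have hDindex : D.index = 2 ^ 8 := by
    have h1 := natCard_quotient_range hinj
    rw [LinearMap.det_smul, LinearMap.det_id, hrank] at h1
    exact h1
  have hDle : D ≤ Q.toAddMonoidHom.range := by
    rintro _ ⟨y, rfl⟩
    refine ⟨y, Subtype.ext ?_⟩
    exact ((hpr.mem_iff y).1 y.2).trans (natCast_zsmul _ _).symm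
  -- The preimage of 2N under 1 - g has index |N'/N| = 2⁸, which is also the index of 2N in N. This
  -- forces (1-g)Λ = N.
  have hJ : (D.comap Q.toAddMonoidHom).index = 2 ^ 8 := by
    rw [← hcard, hpr.natCard_discGroup hΛ.nondegenerate
      (hΛ.isEvenLattice_restrict N).isEvenLatticeIn.nondegenerate hΛ.unimodular]
    intro z
    constructor
    · rintro ⟨y, hy⟩
      exact ⟨y, (congrArg Subtype.val hy).symm.trans (natCast_zsmul _ _)⟩
    · rintro ⟨y, hy⟩
      have hyN : y ∈ N := by
        refine hpr.mem_of_zsmul_mem (k := (2 : ℕ)) (by norm_num) ?_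
        rw [natCast_zsmul, ← hy]
        exact hpr.mem z
      exact ⟨⟨y, hyN⟩, Subtype.ext (hy.trans (natCast_zsmul _ _).symm).symm⟩
  have hQ : Function.Surjective Q := by
    have h1 := AddSubgroup.relIndex_mul_index hDle
    rw [AddSubgroup.index_comap] at hJ
    rw [hJ, hDindex] at h1
    have h2 : Q.toAddMonoidHom.range.index = 1 := by
      have : 0 < 2 ^ 8 := by norm_num
      nlinarith
    exact AddMonoidHom.range_eq_top.1 (AddSubgroup.index_eq_one.1 h2)
  -- Since every x in N is z - gz, one has (x, y) = 2(z, y) on N. So the form can be halved, and C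
  -- denotes half of it.
  have heven : ∀ x y : N, Even (B x y) := by
    intro x y
    obtain ⟨z, rfl⟩ := hQ x
    have := hpr.adjoint z y y.2
    change Even (B (P z) y)
    rw [this]
    exact ⟨B z y, by push_cast; ring⟩
  choose c hc using heven
  let C : LinearMap.BilinForm ℤ N := LinearMap.mk₂ ℤ c
    (fun x x' y => by
      have := hc (x + x') y
      rw [Submodule.coe_add, map_add, LinearMap.add_apply, hc, hc] at this
      omega)
    (fun k x y => by
      have := hc (k • x) y
      rw [Submodule.coe_smul, map_smul, LinearMap.smul_apply, hc, smul_eq_mul] at this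
      rw [smul_eq_mul]
      linarith)
    (fun x y y' => by
      have := hc x (y + y')
      rw [Submodule.coe_add, map_add, hc, hc] at this
      omega)
    (fun k x y => by
      have := hc x (k • y)
      rw [Submodule.coe_smul, map_smul, hc, smul_eq_mul] at this
      rw [smul_eq_mul]
      linarith)
  have hBC : ∀ x y : N, B x y = 2 * C x y := fun x y => by
    rw [hc, two_mul]
    rfl
  have h8 := even_of_unimodular_of_finrank_eq_eight (C := C)
    (fun x y => by have := hΛ.symm x y; rw [hBC, hBC] at this; omega)
    (fun x hx => by
      have := hΛ.posDef x fun h => hx (Subtype.ext h)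
      rw [hBC] at this
      omega)
    -- C is unimodular: a functional on N is represented under B by the projection (l - gl)/2 of
    -- some l in Λ, hence under C by l - gl.
    (fun φ => by
      obtain ⟨x, hx⟩ := exists_ratForm_eq
        (hΛ.isEvenLattice_restrict N).isEvenLatticeIn.nondegenerate ((Algebra.linearMap ℤ ℚ).comp φ)
      obtain ⟨l, rfl⟩ := hpr.exists_proj_eq hΛ.nondegenerate
        (hΛ.isEvenLattice_restrict N).isEvenLatticeIn.nondegenerate hΛ.unimodular
        (mem_dualLattice_iff.2 fun y => ⟨φ y, hx y⟩)
      refine ⟨Q l, fun y => ?_⟩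
      have h1 := hx y
      rw [hpr.ratForm_proj] at h1
      have h2 : B l y = φ y := by
        have h1' : ((B l y : ℤ) : ℚ) = ((φ y : ℤ) : ℚ) := h1
        exact_mod_cast h1'
      have h3 : B (Q l) y = 2 * B l y := hpr.adjoint l y y.2
      rw [hBC, h2] at h3
      omega)
    hrank
    (fun x hx => by
      have := hΛ.four_le (x := x) fun h => hx (Subtype.ext h)
      rw [hBC] at this
      omega)
    (Q x)
  obtain ⟨k, hk⟩ := h8
  have h1 := hBC (Q x) (Q x)
  rw [hk] at h1
  -- Evenness of C makes the norm of x - gx divisible by 4. As it equals 2x² - 2(x, gx) with x²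
  -- even, (x, gx) is even.
  have h2 : B (Q x) (Q x) = 2 * B x x - 2 * B x (g x) := by
    change B (x - g x) (x - g x) = _
    simp only [map_sub, LinearMap.sub_apply, hg, hΛ.symm (g x) x]
    ring
  obtain ⟨l, hl⟩ := hΛ.even x
  rw [h2, hl] at h1
  exact ⟨l - k, by omega⟩

end Leech

/-! ### Discriminant and level of the fixed sublattice. -/

section FixedSublattice

variable {Λ : Type*} [AddCommGroup Λ] [Module.Free ℤ Λ] [Module.Finite ℤ Λ]
  {B : LinearMap.BilinForm ℤ Λ} {p m : ℕ} {g : Λ ≃ₗ[ℤ] Λ}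

lemma prime_cases (hp : p.Prime) (hm : m * (p + 1) = 24) :
    (p = 2 ∧ m = 8) ∨ (p = 3 ∧ m = 6) ∨ (p = 5 ∧ m = 4) ∨ (p = 7 ∧ m = 3) ∨ (p = 11 ∧ m = 2) ∨
      (p = 23 ∧ m = 1) := by
  have h1 : p + 1 ∣ 24 := ⟨m, by rw [← hm, mul_comm]⟩
  have h2 := Nat.le_of_dvd (by norm_num) h1
  have h3 := hp.two_le
  have h4 : p ≤ 23 := by omega
  interval_cases p <;> omega

/-- `p x² / 2` is integral for `x` in the dual of the fixed sublattice. -/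
lemma exists_mul_norm_eq (hΛ : IsLeechLattice B) (hp : p.Prime)
    (hg : ∀ x y, B (g x) (g y) = B x y)
    (hgp : ((g : Λ →ₗ[ℤ] Λ) : Module.End ℤ Λ) ^ p = 1)
    (h2 : p = 2 → ∀ x, Even (B x (g x))) {x : ℚ ⊗[ℤ] (fixedSublattice g)}
    (hx : x ∈ dualLattice (B.restrict (fixedSublattice g))) :
    ∃ k : ℤ, p * (ratForm (B.restrict (fixedSublattice g)) x x / 2) = k := by
  have hp0 := hp.ne_zero
  have hpr := isScaledProjection_orbitSum hp0 hg hgp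
  have hp' : (p : ℚ) ≠ 0 := by exact_mod_cast hp0
  obtain ⟨l, rfl⟩ := hpr.exists_proj_eq hΛ.nondegenerate
    (hΛ.isEvenLattice_restrict _).isEvenLatticeIn.nondegenerate hΛ.unimodular hx
  have h1 : ratForm (B.restrict (fixedSublattice g)) (hpr.proj l) (hpr.proj l) =
      B (orbitSum g p l) (orbitSum g p l) / p ^ 2 := by
    rw [hpr.proj_apply, ratForm_tmul]
    change _ * ((B (orbitSum g p l) (orbitSum g p l) : ℤ) : ℚ) = _
    field_simp
  have h3 := hpr.adjoint l _ (hpr.mem l)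
  obtain ⟨w, hw⟩ := hΛ.even (orbitSum g p l)
  rcases hp.eq_two_or_odd' with rfl | hodd
  · obtain ⟨u, hu⟩ := h2 rfl l
    obtain ⟨v, hv⟩ := hΛ.even l
    rw [orbitSum_two_apply] at h3 h1 hw
    rw [map_add (B l), hu, hv] at h3
    refine ⟨v + u, ?_⟩
    rw [h1, h3]
    push_cast
    ring
  · rw [hw] at h3
    have h4 : Even (B l (orbitSum g p l)) := by
      have : Even ((p : ℤ) * B l (orbitSum g p l)) := ⟨w, h3.symm⟩
      rcases Int.even_mul.1 this with h | h
      · exact absurd ((Int.even_coe_nat p).1 h) (Nat.not_even_iff_odd.2 hodd)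
      · exact h
    obtain ⟨k, hk⟩ := h4
    refine ⟨k, ?_⟩
    rw [h1, hw, h3, hk]
    push_cast
    field_simp
    ring

/-- The fixed sublattice has determinant `p^m`. -/
theorem natCard_discGroup_fixedSublattice (hΛ : IsLeechLattice B) (hp : p.Prime)
    (hm : m * (p + 1) = 24) (hg : ∀ x y, B (g x) (g y) = B x y)
    (hshape : HasCycleShape g (Multiset.replicate m 1 + Multiset.replicate m p)) :
    Nat.card (DiscGroup (B.restrict (fixedSublattice g))) = p ^ m ∧
      (p = 2 → ∀ x, Even (B x (g x))) := by
  have hgp := pow_eq_one_of_hasCycleShape hΛ.posDef hg hshape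
  have hpr := isScaledProjection_orbitSum hp.ne_zero hg hgp
  set K := fixedSublattice g with hK
  let J : AddSubgroup Λ := (AddMonoidHom.range (nsmulAddMonoidHom (α := Λ) p)).comap
    (orbitSum g p).toAddMonoidHom
  have hJ : ∀ x, x ∈ J ↔ ∃ y, orbitSum g p x = p • y := fun x =>
    exists_congr fun y => eq_comm
  obtain ⟨hrank, hdvd⟩ := finrank_fixedSublattice_and_index hp.ne_zero hg hgp hshape J hJ
  have hcard := hpr.natCard_discGroup hΛ.nondegenerate
    (hΛ.isEvenLattice_restrict _).isEvenLatticeIn.nondegenerate hΛ.unimodular J hJ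
  -- So the discriminant is p^a with a ≤ m, and only lower bounds for a are left to prove.
  obtain ⟨a, ha, hJa⟩ := (Nat.dvd_prime_pow hp).1 hdvd
  rw [hJa] at hcard
  have hbl := hΛ.le_natCard_discGroup K hrank (by rintro rfl; omega)
  rw [hcard] at hbl
  rcases prime_cases hp hm with ⟨rfl, rfl⟩ | ⟨rfl, rfl⟩ | h
  · have hle : LinearMap.range (orbitSum g 2) ≤ K := by
      rintro _ ⟨x, rfl⟩
      exact hpr.mem x
    have hr1 : Module.finrank ℤ (LinearMap.range (orbitSum g 2)) = 16 := by
      refine le_antisymm ((Submodule.finrank_mono hle).trans_eq hrank) ?_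
      rw [show 16 = 2 * 8 by norm_num, ← hrank]
      refine LinearMap.finrank_le_finrank_of_injective
        (f := (orbitSum g 2).rangeRestrict.comp K.subtype) fun x y hxy => ?_
      have h1 : orbitSum g 2 x = orbitSum g 2 y := congrArg Subtype.val hxy
      rw [(hpr.mem_iff x).1 x.2, (hpr.mem_iff y).1 y.2, ← natCast_zsmul, ← natCast_zsmul] at h1
      exact Subtype.ext (smul_right_injective Λ (r := ((2 : ℕ) : ℤ)) (by norm_num) h1)
    have hr2 : Module.finrank ℤ (negSublattice g) = 8 := by
      have h1 := Submodule.finrank_quotient_add_finrank (LinearMap.ker (orbitSum g 2))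
      rw [(orbitSum g 2).quotKerEquivRange.finrank_eq, hr1, hΛ.finrank_eq] at h1
      rw [negSublattice]
      omega
    have hprN := isScaledProjection_negSublattice hg hgp
    -- The same J serves both eigenlattices: x + gx and x - gx differ by 2gx, so they are divisible
    -- by 2 together.
    have hcardN : Nat.card (DiscGroup (B.restrict (negSublattice g))) = 2 ^ a := by
      rw [hprN.natCard_discGroup hΛ.nondegenerate
        (hΛ.isEvenLattice_restrict _).isEvenLatticeIn.nondegenerate hΛ.unimodular J, hJa]
      intro x
      rw [hJ]
      simp only [orbitSum_two_apply, LinearMap.sub_apply, LinearMap.id_apply, LinearEquiv.coe_coe]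
      constructor
      · rintro ⟨y, hy⟩
        refine ⟨y - g x, ?_⟩
        rw [smul_sub, ← hy, two_smul]
        abel
      · rintro ⟨y, hy⟩
        refine ⟨y + g x, ?_⟩
        rw [smul_add, ← hy, two_smul]
        abel
    have hblN := hΛ.le_natCard_discGroup (negSublattice g) (n := 4) hr2 (by norm_num)
    rw [hcardN] at hblN
    -- In rank 8 the bound is about 168 > 2⁷; applied to the fixed lattice of rank 16 it would not
    -- suffice.
    have ha8 : a = 8 := by
      by_contra hne
      have h7 : a ≤ 7 := by omega
      have h1 : ((2 ^ a : ℕ) : ℝ) ≤ 2 ^ 7 := by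
        exact_mod_cast Nat.pow_le_pow_right (by norm_num) h7
      norm_num [Nat.factorial] at hblN
      norm_num at h1
      linarith
    subst ha8
    exact ⟨hcard, fun _ => even_apply_of_natCard hΛ hg hgp hr2 hcardN⟩
  · refine ⟨?_, fun h => by omega⟩
    rw [hcard]
    have h5 : a ≠ 5 := by
      rintro rfl
      exact natCard_discGroup_ne_of_finrank_eq_twelve (hΛ.isEvenLattice_restrict K)
        (hΛ.restrict_pos K) hrank
        (fun x hx => exists_mul_norm_eq hΛ hp hg hgp (fun h => by omega) hx) hcard
    -- In rank 12 the bound is about 148, between 3⁴ and 3⁵, so 3⁵ had to be excluded separately.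
    have h6 : ¬ a ≤ 4 := by
      intro h4
      have h1 : ((3 ^ a : ℕ) : ℝ) ≤ 3 ^ 4 := by
        exact_mod_cast Nat.pow_le_pow_right (by norm_num) h4
      norm_num [Nat.factorial] at hbl
      norm_num at h1
      linarith
    rw [show a = 6 by omega]
  · refine ⟨?_, fun h2 => by omega⟩
    rw [hcard]
    congr 1
    by_contra hne
    have h3 : a ≤ m - 1 := by omega
    have h1 : ((p ^ a : ℕ) : ℝ) ≤ p ^ (m - 1) := by
      exact_mod_cast Nat.pow_le_pow_right hp.pos h3
    rcases h with ⟨rfl, rfl⟩ | ⟨rfl, rfl⟩ | ⟨rfl, rfl⟩ | ⟨rfl, rfl⟩ <;>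
    · norm_num [Nat.factorial] at hbl h1
      linarith

end FixedSublattice

/-! ### The lattice M: determinant, signature and dual. -/

section OrthoSum

lemma det_toMatrix_orthoSum {L₁ L₂ ι₁ ι₂ : Type*} [AddCommGroup L₁] [AddCommGroup L₂] [Fintype ι₁]
    [Fintype ι₂] [DecidableEq ι₁] [DecidableEq ι₂] (B₁ : LinearMap.BilinForm ℤ L₁)
    (B₂ : LinearMap.BilinForm ℤ L₂) (v₁ : Module.Basis ι₁ ℤ L₁) (v₂ : Module.Basis ι₂ ℤ L₂) :
    (LinearMap.BilinForm.toMatrix (v₁.prod v₂) (orthoSum B₁ B₂)).det =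
      (LinearMap.BilinForm.toMatrix v₁ B₁).det * (LinearMap.BilinForm.toMatrix v₂ B₂).det := by
  rw [← Matrix.det_fromBlocks_zero₂₁ _ 0]
  congr 1
  ext (i | i) (j | j) <;> simp [LinearMap.BilinForm.toMatrix_apply, orthoSum]

lemma det_toMatrix_scaled {L ι : Type*} [AddCommGroup L] [Fintype ι] [DecidableEq ι]
    (n : ℤ) (B : LinearMap.BilinForm ℤ L) (v : Module.Basis ι ℤ L) :
    (LinearMap.BilinForm.toMatrix v (scaled n B)).det =
      n ^ Fintype.card ι * (LinearMap.BilinForm.toMatrix v B).det := by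
  rw [scaled, map_smul, Matrix.det_smul]

lemma det_toMatrix_hyperbolicPlane :
    (LinearMap.BilinForm.toMatrix (Module.Basis.finTwoProd ℤ) hyperbolicPlane).det = -1 := by
  simp [Matrix.det_fin_two, LinearMap.BilinForm.toMatrix_apply, hyperbolicPlane]

end OrthoSum

section LatticeM

variable {Λ : Type*} [AddCommGroup Λ] {B : LinearMap.BilinForm ℤ Λ} {p m : ℕ} {g : Λ ≃ₗ[ℤ] Λ}

lemma latticeM_apply (x y : fixedSublattice g × (ℤ × ℤ) × (ℤ × ℤ)) :
    latticeM B g p x y = -B x.1 y.1 - p * (x.2.1.1 * y.2.1.2 + x.2.1.2 * y.2.1.1) -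
      (x.2.2.1 * y.2.2.2 + x.2.2.2 * y.2.2.1) := by
  have h1 : (B.restrict (fixedSublattice g)) x.1 y.1 = B x.1 y.1 := rfl
  simp only [latticeM, orthoSum, scaled, hyperbolicPlane, LinearMap.add_apply,
    LinearMap.compl₁₂_apply, LinearMap.smul_apply, LinearMap.fst_apply, LinearMap.snd_apply,
    LinearMap.mk₂_apply, smul_eq_mul, h1]
  ring

variable [Module.Free ℤ Λ] [Module.Finite ℤ Λ]

lemma isEvenLattice_latticeM (hΛ : IsLeechLattice B) (hp : p ≠ 0) :
    IsEvenLattice (latticeM B g p) := by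
  have hsymm : ∀ x y, latticeM B g p x y = latticeM B g p y x := fun x y => by
    rw [latticeM_apply, latticeM_apply, hΛ.symm]
    ring
  have hnd : ∀ x, (∀ y, latticeM B g p x y = 0) → x = 0 := by
    rintro ⟨k, ⟨a, b⟩, ⟨c, d⟩⟩ h
    have h1 := h (k, 0, 0)
    have h2 := h (0, (1, 0), 0)
    have h3 := h (0, (0, 1), 0)
    have h4 := h (0, 0, (1, 0))
    have h5 := h (0, 0, (0, 1))
    simp [latticeM_apply] at h1 h2 h3 h4 h5
    have hk : k = 0 := by
      by_contra h0
      exact (hΛ.posDef k fun h => h0 (Subtype.ext h)).ne' h1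
    rw [hk, h2.resolve_left hp, h3.resolve_left hp, h4, h5]
    rfl
  refine ⟨hsymm, fun x => ?_, hnd, fun y hy => hnd y fun x => ?_⟩
  · obtain ⟨k, hk⟩ := hΛ.even x.1
    refine ⟨-k - p * (x.2.1.1 * x.2.1.2) - x.2.2.1 * x.2.2.2, ?_⟩
    rw [latticeM_apply, hk]
    ring
  · rw [hsymm]
    exact hy x

/-- The order of the discriminant group of `M`. -/
lemma natCard_discGroup_latticeM (hΛ : IsLeechLattice B) (hp : p ≠ 0)
    (hcard : Nat.card (DiscGroup (B.restrict (fixedSublattice g))) = p ^ m) :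
    Nat.card (DiscGroup (latticeM B g p)) = p ^ (m + 2) := by
  have h1 := (isEvenLattice_latticeM (g := g) hΛ hp).natCard_discGroup
    ((Module.finBasis ℤ (fixedSublattice g)).prod
      ((Module.Basis.finTwoProd ℤ).prod (Module.Basis.finTwoProd ℤ)))
  have h2 := (hΛ.isEvenLattice_restrict (fixedSublattice g)).natCard_discGroup
    (Module.finBasis ℤ (fixedSublattice g))
  rw [hcard] at h2
  rw [latticeM, det_toMatrix_orthoSum, det_toMatrix_orthoSum, det_toMatrix_scaled,
    det_toMatrix_scaled, det_toMatrix_hyperbolicPlane, abs_mul, abs_mul, abs_pow, abs_neg, abs_one,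
    one_pow, one_mul, ← h2, Fintype.card_fin] at h1
  have h3 : |(p : ℤ) ^ 2 * -1 * -1| = (p : ℤ) ^ 2 := by
    rw [show (p : ℤ) ^ 2 * -1 * -1 = (p : ℤ) ^ 2 by ring, abs_of_nonneg (by positivity)]
  rw [h3] at h1
  rw [pow_add]
  exact_mod_cast h1

/-- The signature of `M`. -/
lemma bMinus_sub_bPlus_latticeM (hΛ : IsLeechLattice B) (hp : p ≠ 0)
    (hrank : Module.finrank ℤ (fixedSublattice g) = 2 * m) :
    bPlus (latticeM B g p) = 2 ∧ bMinus (latticeM B g p) = 2 * m + 2 := by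
  have hp' : (0 : ℤ) < p := by exact_mod_cast Nat.pos_of_ne_zero hp
  have hsq : ∀ {a : ℤ}, a ≠ 0 → 0 < a * a := fun h => mul_self_pos.2 h
  have h1 : Module.finrank ℤ (ℤ × ℤ) ≤ bPlus (latticeM B g p) := by
    -- The vectors (a, -a) and (b, -b) of the two planes have norms 2pa² and 2b².
    refine finrank_le_sigPos
      ((0 : ℤ × ℤ →ₗ[ℤ] fixedSublattice g).prod (LinearMap.prodMap
        (LinearMap.id.prod (-LinearMap.id)) (LinearMap.id.prod (-LinearMap.id)))) ?_
    rintro ⟨a, b⟩ hab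
    rw [latticeM_apply]
    change 0 < -B (0 : Λ) 0 - p * (a * -a + -a * a) - (b * -b + -b * b)
    rw [map_zero]
    by_cases ha : a = 0
    · have hb : b ≠ 0 := fun hb => hab (by rw [ha, hb]; rfl)
      subst ha
      nlinarith [hsq hb]
    · nlinarith [mul_pos hp' (hsq ha), mul_self_nonneg b]
  have h2 : Module.finrank ℤ (fixedSublattice g × (ℤ × ℤ)) ≤ bMinus (latticeM B g p) := by
    -- The fixed lattice with reversed sign, together with the diagonals (a, a) and (b, b) of the
    -- two planes.
    refine finrank_le_sigNeg
      ((LinearMap.id : fixedSublattice g →ₗ[ℤ] fixedSublattice g).prodMap (LinearMap.prodMap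
        (LinearMap.id.prod LinearMap.id) (LinearMap.id.prod LinearMap.id))) ?_
    rintro ⟨k, a, b⟩ hab
    rw [latticeM_apply]
    change -B k k - p * (a * a + a * a) - (b * b + b * b) < 0
    have ha := mul_nonneg hp'.le (mul_self_nonneg a)
    have hb := mul_self_nonneg b
    by_cases hk : k = 0
    · subst hk
      simp only [ZeroMemClass.coe_zero, map_zero]
      by_cases ha : a = 0
      · have hb : b ≠ 0 := fun hb => hab (by rw [ha, hb]; rfl)
        subst ha
        nlinarith [hsq hb]
      · nlinarith [mul_pos hp' (hsq ha)]
    · have := hΛ.restrict_pos _ k hk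
      change 0 < B k k at this
      nlinarith
  have h3 := sigPos_add_sigNeg_le (latticeM B g p)
  change bPlus (latticeM B g p) + bMinus (latticeM B g p) ≤ _ at h3
  simp only [Module.finrank_prod, hrank, Module.finrank_self] at h1 h2 h3
  omega

/-- Vectors of `M'` in coordinates. -/
lemma exists_eq_of_mem_dualLattice_latticeM (hΛ : IsLeechLattice B) (hp : p ≠ 0)
    {x : ℚ ⊗[ℤ] (fixedSublattice g × (ℤ × ℤ) × (ℤ × ℤ))} (hx : x ∈ dualLattice (latticeM B g p)) :
    ∃ y ∈ dualLattice (B.restrict (fixedSublattice g)), ∃ u v s t : ℤ,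
      x = (LinearMap.inl ℤ (fixedSublattice g) ((ℤ × ℤ) × (ℤ × ℤ))).baseChange ℚ y +
        (1 / p : ℚ) ⊗ₜ[ℤ] (0, (u, v), 0) + (1 : ℚ) ⊗ₜ[ℤ] (0, 0, (s, t)) ∧
      ratForm (latticeM B g p) x x =
        -ratForm (B.restrict (fixedSublattice g)) y y - 2 * (u * v / p) - 2 * (s * t) := by
  have hp' : (p : ℚ) ≠ 0 := by exact_mod_cast hp
  have hM := isEvenLattice_latticeM (g := g) hΛ hp
  have hK := hΛ.isEvenLattice_restrict (fixedSublattice g)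
  set ι : ℚ ⊗[ℤ] fixedSublattice g →ₗ[ℚ] ℚ ⊗[ℤ] (fixedSublattice g × (ℤ × ℤ) × (ℤ × ℤ)) :=
    (LinearMap.inl ℤ (fixedSublattice g) ((ℤ × ℤ) × (ℤ × ℤ))).baseChange ℚ with hι
  choose f hf using mem_dualLattice_iff.1 hx
  have hadd : ∀ y z, f (y + z) = f y + f z := fun y z => by
    have := hf (y + z)
    rw [TensorProduct.tmul_add, map_add, hf, hf] at this
    exact_mod_cast this.symm
  let φ : (fixedSublattice g × (ℤ × ℤ) × (ℤ × ℤ)) →ₗ[ℤ] ℤ :=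
    (AddMonoidHom.mk' f hadd).toIntLinearMap
  have hφ : ∀ l, ratForm (latticeM B g p) x (1 ⊗ₜ[ℤ] l) = φ l := hf
  obtain ⟨y, hy⟩ := exists_ratForm_eq hK.isEvenLatticeIn.nondegenerate
    (((Algebra.linearMap ℤ ℚ).comp φ).comp (-LinearMap.inl ℤ (fixedSublattice g) ((ℤ × ℤ) × (ℤ × ℤ))))
  have hymem : y ∈ dualLattice (B.restrict (fixedSublattice g)) := mem_dualLattice_iff.2 fun l => ⟨φ (-(l, 0)), hy l⟩
  have hιpair : ∀ (z : ℚ ⊗[ℤ] (fixedSublattice g)) (r : ℚ) (k : fixedSublattice g) (w : (ℤ × ℤ) × (ℤ × ℤ)),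
      ratForm (latticeM B g p) (ι z) (r ⊗ₜ[ℤ] (k, w)) =
        -ratForm (B.restrict (fixedSublattice g)) z (r ⊗ₜ[ℤ] k) := by
    intro z r k w
    induction z using TensorProduct.induction_on with
    | zero => simp
    | add z z' hz hz' => simp only [map_add, LinearMap.add_apply, hz, hz']; ring
    | tmul s l =>
      rw [hι, LinearMap.baseChange_tmul, ratForm_tmul, ratForm_tmul, latticeM_apply]
      simp only [LinearMap.inl_apply, Prod.fst_zero, Prod.snd_zero, zero_mul, add_zero, mul_zero,
        sub_zero, Int.cast_neg]
      change _ = -(_ * ((B l k : ℤ) : ℚ))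
      ring
  have hιι : ∀ z w : ℚ ⊗[ℤ] fixedSublattice g, ratForm (latticeM B g p) (ι z) (ι w) =
      -ratForm (B.restrict (fixedSublattice g)) z w := by
    intro z w
    induction w using TensorProduct.induction_on with
    | zero => simp
    | add w w' hw hw' => simp only [map_add, hw, hw']; ring
    | tmul s l => rw [hι, LinearMap.baseChange_tmul, ← hι]; exact hιpair z s l 0
  -- Pairing with a basis vector of a plane reads off minus the other coordinate, scaled by p in the
  -- first plane; this explains the swapped indices and the signs.
  refine ⟨y, hymem, -φ (0, (0, 1), 0), -φ (0, (1, 0), 0), -φ (0, 0, (0, 1)), -φ (0, 0, (1, 0)), ?_⟩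
  have hxeq : x = ι y + (1 / p : ℚ) ⊗ₜ[ℤ] (0, (-φ (0, (0, 1), 0), -φ (0, (1, 0), 0)), 0) +
      (1 : ℚ) ⊗ₜ[ℤ] (0, 0, (-φ (0, 0, (0, 1)), -φ (0, 0, (1, 0)))) := by
    refine ratForm_ext hM.isEvenLatticeIn.nondegenerate ?_
    rintro ⟨k, ⟨a, b⟩, ⟨c, d⟩⟩
    have hdec : ((k, (a, b), (c, d)) : fixedSublattice g × (ℤ × ℤ) × (ℤ × ℤ)) =
        -(-(k, 0, 0)) + a • (0, (1, 0), 0) + b • (0, (0, 1), 0) + c • (0, 0, (1, 0)) +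
          d • (0, 0, (0, 1)) := by
      ext <;> simp
    have hφk : φ (k, (a, b), (c, d)) = -φ (-(k, 0, 0)) + a * φ (0, (1, 0), 0) +
        b * φ (0, (0, 1), 0) + c * φ (0, 0, (1, 0)) + d * φ (0, 0, (0, 1)) := by
      rw [hdec]
      simp only [map_add, map_neg, map_smul, smul_eq_mul]
    rw [hφ, hφk, map_add, map_add, LinearMap.add_apply, LinearMap.add_apply, hιpair, hy,
      ratForm_tmul, ratForm_tmul, latticeM_apply, latticeM_apply]
    change _ = -((φ (-(k, 0, 0)) : ℤ) : ℚ) + _ + _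
    simp only [ZeroMemClass.coe_zero, map_zero, LinearMap.zero_apply, Prod.fst_zero, Prod.snd_zero]
    push_cast
    field_simp
    ring
  refine ⟨hxeq, ?_⟩
  set u := -φ (0, (0, 1), 0)
  set v := -φ (0, (1, 0), 0)
  set s := -φ (0, 0, (0, 1))
  set t := -φ (0, 0, (1, 0))
  have hsymm := ratForm_symm hM.symm
  have hz : ∀ (r : ℚ) (w : (ℤ × ℤ) × (ℤ × ℤ)),
      ratForm (latticeM B g p) (ι y) (r ⊗ₜ[ℤ] (0, w)) = 0 := fun r w => by
    rw [hιpair, TensorProduct.tmul_zero, map_zero, neg_zero]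
  have hz' : ∀ (r : ℚ) (w : (ℤ × ℤ) × (ℤ × ℤ)),
      ratForm (latticeM B g p) (r ⊗ₜ[ℤ] (0, w)) (ι y) = 0 := fun r w => by
    rw [hsymm, hz]
  rw [hxeq]
  simp only [map_add, LinearMap.add_apply, hz, hz', hιι, ratForm_tmul, latticeM_apply]
  simp only [ZeroMemClass.coe_zero, map_zero, Prod.fst_zero, Prod.snd_zero]
  push_cast
  field_simp
  ring

/-- On the two planes half the norm is -uv/p and -st, so the level p is inherited from the fixed
lattice. -/
lemma exists_mul_norm_eq_latticeM (hΛ : IsLeechLattice B) (hp : p ≠ 0)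
    (hK : ∀ y ∈ dualLattice (B.restrict (fixedSublattice g)),
      ∃ k : ℤ, p * (ratForm (B.restrict (fixedSublattice g)) y y / 2) = k)
    {x : ℚ ⊗[ℤ] (fixedSublattice g × (ℤ × ℤ) × (ℤ × ℤ))} (hx : x ∈ dualLattice (latticeM B g p)) :
    ∃ k : ℤ, p * (ratForm (latticeM B g p) x x / 2) = k := by
  have hp' : (p : ℚ) ≠ 0 := by exact_mod_cast hp
  obtain ⟨y, hy, u, v, s, t, -, hnorm⟩ := exists_eq_of_mem_dualLattice_latticeM hΛ hp hx
  obtain ⟨k, hk⟩ := hK y hy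
  refine ⟨-k - u * v - p * (s * t), ?_⟩
  rw [hnorm]
  push_cast
  rw [← hk]
  field_simp

end LatticeM

/-! ### Gauss sums over the discriminant group -/

section GaussSums

variable {p : ℕ} [NeZero p] {D : Type*} [Fintype D]

/-- An integral character sum is invariant under Galois conjugation. -/
lemma sum_stdAddChar_mul_of_int (hp : p.Prime) (q : D → ZMod p) {c : ℤ}
    (hc : ∑ δ, ZMod.stdAddChar (q δ) = (c : ℂ)) {t : ZMod p} (ht : t ≠ 0) :
    ∑ δ, ZMod.stdAddChar (q δ * t) = (c : ℂ) := by
  have : Fact p.Prime := ⟨hp⟩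
  set ζ : ℂ := ZMod.stdAddChar (1 : ZMod p) with hζ
  have hpow : ∀ n : ℕ, ZMod.stdAddChar (n : ZMod p) = ζ ^ n := fun n => by
    rw [hζ, ← AddChar.map_nsmul_eq_pow, nsmul_one]
  have hprim : IsPrimitiveRoot ζ p := by
    have h := Complex.isPrimitiveRoot_exp p hp.ne_zero
    convert h using 1
    have := stdAddChar_intCast (p := p) 1
    rw [Int.cast_one] at this
    rw [hζ, this, e]
    congr 1
    push_cast
    ring
  -- The equation for the sum says that ζ is a root of P. Then so is ζ^t, which has the same minimal
  -- polynomial.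
  let P : Polynomial ℤ := ∑ δ, Polynomial.X ^ (q δ).val - Polynomial.C c
  have hP : ∀ z : ℂ, Polynomial.aeval z P = ∑ δ, z ^ (q δ).val - c := fun z => by simp [P]
  have hdvd : minpoly ℤ ζ ∣ P := by
    refine minpoly.isIntegrallyClosed_dvd (hprim.isIntegral hp.pos) ?_
    rw [hP, ← hc, sub_eq_zero]
    refine Finset.sum_congr rfl fun δ _ => ?_
    rw [← hpow, ZMod.natCast_zmod_val]
  have hcop : Nat.Coprime t.val p := by
    refine (hp.coprime_iff_not_dvd.2 fun h => ht ?_).symm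
    rw [← ZMod.natCast_zmod_val t]
    exact (ZMod.natCast_eq_zero_iff _ _).2 h
  rw [hprim.minpoly_eq_pow_coprime hcop] at hdvd
  have h0 : Polynomial.aeval (ζ ^ t.val) P = 0 := by
    obtain ⟨Q, hQ⟩ := hdvd
    rw [hQ, map_mul, minpoly.aeval, zero_mul]
  rw [hP, sub_eq_zero] at h0
  rw [← h0]
  refine Finset.sum_congr rfl fun δ _ => ?_
  rw [← pow_mul, ← hpow, Nat.cast_mul, ZMod.natCast_zmod_val, ZMod.natCast_zmod_val, mul_comm]

lemma star_sum_stdAddChar_mul (q : D → ZMod p) (t : ZMod p) :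
    ∑ δ, ZMod.stdAddChar (q δ * -t) = (starRingEnd ℂ) (∑ δ, ZMod.stdAddChar (q δ * t)) := by
  rw [map_sum]
  refine Finset.sum_congr rfl fun δ _ => ?_
  rw [mul_neg, AddChar.map_neg_eq_conj]

variable [AddCommGroup D]

/-- Multiplication by u permutes D, whose order is prime to u, and multiplies q by u². -/
lemma sum_stdAddChar_mul_sq (hp : p.Prime) (q : QuadraticMap ℤ D (ZMod p)) {r : ℕ}
    (hcard : Nat.card D = p ^ r) {u : ZMod p} (hu : u ≠ 0) (t : ZMod p) :
    ∑ δ, ZMod.stdAddChar (q δ * (u * u * t)) = ∑ δ, (ZMod.stdAddChar (q δ * t) : ℂ) := by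
  have hcop : (Nat.card D).Coprime u.val := by
    rw [hcard]
    refine Nat.Coprime.pow_left _ (hp.coprime_iff_not_dvd.2 fun h => hu ?_)
    rw [← ZMod.natCast_zmod_val u]
    exact (ZMod.natCast_eq_zero_iff _ _).2 h
  refine Fintype.sum_equiv (nsmulCoprime hcop) _ _ fun δ => ?_
  rw [nsmulCoprime_apply, ← natCast_zsmul, QuadraticMap.map_smul, zsmul_eq_mul]
  push_cast
  rw [ZMod.natCast_zmod_val]
  congr 1
  ring

/-- Completing the square. -/
lemma sum_stdAddChar_polar (hp : p.Prime) (q : QuadraticMap ℤ D (ZMod p)) (γ : D) {k : ZMod p}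
    (hk : k ≠ 0) :
    ∑ δ, ZMod.stdAddChar (-QuadraticMap.polar q γ δ) * ZMod.stdAddChar (-(q δ * k)) =
      ZMod.stdAddChar (q γ * k⁻¹) * ∑ δ, (ZMod.stdAddChar (q δ * -k) : ℂ) := by
  have : Fact p.Prime := ⟨hp⟩
  rw [Finset.mul_sum]
  symm
  -- The substitution is δ = ε - k⁻¹γ, with k⁻¹ lifted to an integer.
  refine Fintype.sum_equiv (Equiv.subRight (((k⁻¹).val : ℤ) • γ)) _ _ fun ε => ?_
  rw [Equiv.subRight_apply, ← AddChar.map_add_eq_mul, ← AddChar.map_add_eq_mul]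
  congr 1
  have h1 : QuadraticMap.polar q γ (ε - ((k⁻¹).val : ℤ) • γ) =
      QuadraticMap.polar q γ ε - k⁻¹ * (2 * q γ) := by
    rw [QuadraticMap.polar_sub_right, QuadraticMap.polar_smul_right, QuadraticMap.polar_self,
      zsmul_eq_mul]
    push_cast
    rw [ZMod.natCast_zmod_val, two_nsmul, two_mul]
  have h2 : q (ε - ((k⁻¹).val : ℤ) • γ) =
      q ε + k⁻¹ * k⁻¹ * q γ - k⁻¹ * QuadraticMap.polar q γ ε := by
    rw [sub_eq_add_neg, ← neg_smul, QuadraticMap.map_add ⇑q, QuadraticMap.map_smul,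
      QuadraticMap.polar_smul_right, zsmul_eq_mul, zsmul_eq_mul, QuadraticMap.polar_comm]
    push_cast
    rw [ZMod.natCast_zmod_val]
    ring
  rw [h1, h2]
  field_simp
  ring

/-- For even m the value at 1 is a rational integer, so Galois conjugation does not change it. For
odd m one has p = 7 or 23, so exactly the nonsquares t have -t a square: squares keep the value, and
nonsquares give its conjugate, which is its negative because (-i)^m is purely imaginary. -/
lemma sum_stdAddChar_mul_eq_etaChar {m : ℕ} (hp : p.Prime) (hm : m * (p + 1) = 24)
    (q : QuadraticMap ℤ D (ZMod p)) (hcard : Nat.card D = p ^ (m + 2))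
    (h1 : ∑ δ, ZMod.stdAddChar (q δ) = (Real.sqrt p : ℂ) ^ (m + 2) * (-Complex.I) ^ m)
    {t : ZMod p} (ht : t ≠ 0) :
    ∑ δ, ZMod.stdAddChar (q δ * t) =
      etaChar p m t * ((Real.sqrt p : ℂ) ^ (m + 2) * (-Complex.I) ^ m) := by
  have hsq : (Real.sqrt p : ℂ) ^ 2 = p := by
    rw [← Complex.ofReal_pow, Real.sq_sqrt (Nat.cast_nonneg p)]
    simp
  rcases Nat.even_or_odd m with ⟨n, rfl⟩ | hodd
  · have hc : (Real.sqrt p : ℂ) ^ (n + n + 2) * (-Complex.I) ^ (n + n) =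
        ((p ^ (n + 1) * (-1) ^ n : ℤ) : ℂ) := by
      rw [show n + n + 2 = 2 * (n + 1) by ring, ← two_mul, pow_mul, pow_mul, hsq, neg_sq,
        Complex.I_sq]
      push_cast
      rfl
    rw [etaChar, if_pos (Or.inl (by omega)), one_mul, hc]
    exact sum_stdAddChar_mul_of_int hp q (by rw [h1, hc]) ht
  · have hsquare : IsSquare t ∨ IsSquare (-t) := by
      rcases prime_cases hp hm with ⟨rfl, rfl⟩ | ⟨rfl, rfl⟩ | ⟨rfl, rfl⟩ | ⟨rfl, rfl⟩ |
        ⟨rfl, rfl⟩ | ⟨rfl, rfl⟩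
      all_goals first | (exfalso; revert hodd; decide) | (revert t; decide)
    have hm2 : m % 2 ≠ 0 := by rw [Nat.odd_iff.1 hodd]; decide
    have hS : ∀ s : ZMod p, s ≠ 0 → IsSquare s → ∑ δ, ZMod.stdAddChar (q δ * s) =
        (Real.sqrt p : ℂ) ^ (m + 2) * (-Complex.I) ^ m := by
      rintro s hs ⟨u, rfl⟩
      rw [← mul_one (u * u), sum_stdAddChar_mul_sq hp q hcard (left_ne_zero_of_mul hs), ← h1]
      simp_rw [mul_one]
    by_cases hsq' : IsSquare t
    · rw [etaChar, if_pos (Or.inr hsq'), one_mul, hS t ht hsq']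
    · rw [etaChar, if_neg (by tauto), ← neg_neg t, star_sum_stdAddChar_mul,
        hS (-t) (neg_ne_zero.2 ht) (hsquare.resolve_left hsq')]
      rw [map_mul, map_pow, map_pow, map_neg, Complex.conj_I, Complex.conj_ofReal, neg_neg,
        hodd.neg_pow]
      ring

end GaussSums

/-! ### The discriminant form as a quadratic map to ℤ/p. -/

namespace IsEvenLatticeIn

variable {V : Type*} [AddCommGroup V] [Module ℚ V] {b : LinearMap.BilinForm ℚ V}
  {Γ Γ' : Submodule ℤ V} {p : ℕ} [NeZero p]

lemma eNorm_zsmul (h : IsEvenLatticeIn b Γ Γ') (n : ℤ) (γ : Disc Γ Γ') :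
    eNorm b (n • γ) = eNorm b γ ^ (n * n) := by
  obtain ⟨x, hx, rfl⟩ := γ.exists_mk
  have : (n • Disc.mk x hx : Disc Γ Γ') = Disc.mk (n • x) (Submodule.smul_mem _ n hx) := rfl
  rw [this, h.eNorm_mk, h.eNorm_mk, e_zpow]
  congr 1
  rw [← Int.cast_smul_eq_zsmul ℚ]
  simp only [map_smul, LinearMap.smul_apply, smul_eq_mul]
  push_cast
  ring

lemma ePair_zsmul_right (h : IsEvenLatticeIn b Γ Γ') (n : ℤ) (γ δ : Disc Γ Γ') :
    ePair b γ (n • δ) = ePair b γ δ ^ n := by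
  obtain ⟨x, hx, rfl⟩ := γ.exists_mk
  obtain ⟨y, hy, rfl⟩ := δ.exists_mk
  have : (n • Disc.mk y hy : Disc Γ Γ') = Disc.mk (n • y) (Submodule.smul_mem _ n hy) := rfl
  rw [this, h.ePair_mk, h.ePair_mk, e_zpow]
  congr 1
  rw [← Int.cast_smul_eq_zsmul ℚ]
  simp only [map_smul, smul_eq_mul]
  push_cast
  ring

/-- The discriminant form, if it takes values in `(1/p)ℤ/ℤ`. -/
lemma exists_quadraticMap (h : IsEvenLatticeIn b Γ Γ')
    (hnorm : ∀ x ∈ Γ', ∃ k : ℤ, p * (b x x / 2) = k) :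
    ∃ q : QuadraticMap ℤ (Disc Γ Γ') (ZMod p),
      (∀ γ, ∃ k : ℤ, (k : ZMod p) = q γ ∧ b (γ.out : Γ') (γ.out : Γ') / 2 = k / p) ∧
      (∀ γ, ZMod.stdAddChar (q γ) = eNorm b γ) ∧
      ∀ γ δ, ZMod.stdAddChar (QuadraticMap.polar q γ δ) = ePair b γ δ := by
  have hp' : (p : ℚ) ≠ 0 := by exact_mod_cast NeZero.ne p
  choose k hk using fun γ : Disc Γ Γ' => hnorm (γ.out : Γ') γ.out.2
  have hN : ∀ γ, ZMod.stdAddChar ((k γ : ℤ) : ZMod p) = eNorm b γ := fun γ => by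
    rw [stdAddChar_intCast, eNorm, eq_div_of_mul_eq hp' ((mul_comm _ _).trans (hk γ))]
    push_cast
    rfl
  have hN0 : ∀ γ : Disc Γ Γ', eNorm b γ ≠ 0 := fun γ => e_ne_zero _
  have hP : ∀ γ δ, ZMod.stdAddChar (QuadraticMap.polar (fun γ => ((k γ : ℤ) : ZMod p)) γ δ) =
      ePair b γ δ := fun γ δ => by
    rw [QuadraticMap.polar, AddChar.map_sub_eq_div, AddChar.map_sub_eq_div, hN, hN, hN, h.eNorm_add]
    field_simp [hN0 γ, hN0 δ]
  -- The axioms of a quadratic map are checked after applying the injective standard character,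
  -- where they become identities between values of `eNorm` and `ePair`.
  have hinj := ZMod.injective_stdAddChar (N := p)
  refine ⟨QuadraticMap.ofPolar (fun γ => ((k γ : ℤ) : ZMod p)) (fun n γ => hinj ?_)
    (fun γ γ' δ => hinj ?_) (fun n γ δ => hinj ?_), fun γ => ⟨k γ, rfl, ?_⟩, hN, hP⟩
  · rw [hN, h.eNorm_zsmul, AddChar.map_zsmul_eq_zpow, hN]
  · rw [AddChar.map_add_eq_mul, hP, hP, hP, h.ePair_comm, h.ePair_add_right, h.ePair_comm δ,
      h.ePair_comm δ]
  · rw [AddChar.map_zsmul_eq_zpow, hP, hP, h.ePair_comm, h.ePair_zsmul_right, h.ePair_comm δ]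
  · exact eq_div_of_mul_eq hp' ((mul_comm _ _).trans (hk γ))

end IsEvenLatticeIn

lemma etaPart_add_one {p m : ℕ} (hp : p ≠ 0) (hm : m * (p + 1) = 24) {j : ℕ} (hj : j < p) (τ : ℍ) :
    etaPart p m j ((τ : ℂ) + 1) = e (j / p) * etaPart p m j τ := by
  obtain ⟨a, ha⟩ := (isExponentDecomposition_etaPart hp hm).2 j hj
  have h1 := ha ((1 : ℝ) +ᵥ τ)
  have h2 : (((1 : ℝ) +ᵥ τ : ℍ) : ℂ) = τ + 1 := by
    rw [UpperHalfPlane.coe_vadd, add_comm, Complex.ofReal_one]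
  rw [h2] at h1
  have h3 : (fun n : ℤ => a n * e ((n + j / p) * ((τ : ℂ) + 1))) =
      fun n : ℤ => e (j / p) * (a n * e ((n + j / p) * (τ : ℂ))) := by
    ext n
    rw [mul_add, mul_one, e_add, e_add n, e_int]
    ring
  rw [h3] at h1
  exact h1.unique ((ha τ).mul_left (e (j / p)))

/-! ### The vector valued form F. -/

section VectorF

variable {L : Type*} [AddCommGroup L] {B : LinearMap.BilinForm ℤ L} {p m : ℕ}

lemma exists_discHalfNorm_eq (hp : p ≠ 0)
    (hnorm : ∀ x ∈ dualLattice B, ∃ k : ℤ, p * (ratForm B x x / 2) = k) (γ : DiscGroup B) :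
    ∃ j < p, ∃ n : ℤ, discHalfNorm B γ = (j : ℚ) / p + n := by
  have hp' : (p : ℚ) ≠ 0 := by exact_mod_cast hp
  have hpz : (0 : ℤ) < p := by exact_mod_cast Nat.pos_of_ne_zero hp
  obtain ⟨k, hk⟩ := hnorm _ γ.out.2
  have hmod : (((k % p).toNat : ℕ) : ℤ) = k % p := Int.toNat_of_nonneg (Int.emod_nonneg k hpz.ne')
  have hlt := Int.emod_lt_of_pos k hpz
  refine ⟨(k % p).toNat, by omega, k / p, ?_⟩
  have h1 : (((k % p).toNat : ℕ) : ℚ) + p * ((k / p : ℤ) : ℚ) = k := by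
    have := Int.emod_add_mul_ediv k p
    rw [← hmod] at this
    exact_mod_cast this
  rw [discHalfNorm, discPair, eq_div_of_mul_eq hp' ((mul_comm _ _).trans hk), ← h1]
  field_simp

lemma eq_of_div_add_int_eq (hp : p ≠ 0) {i j : ℕ} (hi : i < p) (hj : j < p) {n k : ℤ}
    (h : (i : ℚ) / p + n = (j : ℚ) / p + k) : i = j := by
  have hp' : (p : ℚ) ≠ 0 := by exact_mod_cast hp
  field_simp at h
  have h1 : (i : ℤ) + p * n = j + p * k := by exact_mod_cast h
  have h2 : ((i : ℤ) + p * n) % p = (j + p * k) % p := by rw [h1]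
  rw [Int.add_mul_emod_self_left, Int.add_mul_emod_self_left, Int.emod_eq_of_lt (by omega) (by omega),
    Int.emod_eq_of_lt (by omega) (by omega)] at h2
  omega

variable [Module.Free ℤ L] [Module.Finite ℤ L]

open Classical in
-- γ = 0 has j = 0, so the two cases in the definition of F merge into one formula.
lemma vectorF_eq (hB : IsEvenLattice B) (hp : p ≠ 0) {γ : DiscGroup B} {j : ℕ} (hj : j < p) {n : ℤ}
    (hγ : discHalfNorm B γ = (j : ℚ) / p + n) (τ : ℍ) :
    vectorF B p m γ τ = (if γ = 0 then etaProduct p m τ else 0) + etaPart p m j τ := by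
  rw [vectorF]
  split_ifs with h0
  · subst h0
    obtain ⟨k, hk⟩ := discHalfNorm_discMk hB 0
    have h2 : discMk B 0 = 0 := rfl
    rw [h2, hγ] at hk
    have hj0 : j = 0 := by
      refine eq_of_div_add_int_eq hp hj (Nat.pos_of_ne_zero hp) (n := n) (k := k) ?_
      rw [hk]
      simp
    rw [hj0]
  · rw [zero_add, Finset.sum_eq_single j]
    · rw [if_pos ⟨n, hγ⟩]
    · rintro i hi hij
      refine if_neg ?_
      rintro ⟨k, hk⟩
      exact hij (eq_of_div_add_int_eq hp (Finset.mem_range.1 hi) hj (hk.symm.trans hγ))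
    · exact fun h => absurd (Finset.mem_range.2 hj) h

lemma vectorF_T_smul (hB : IsEvenLattice B) (hp : p ≠ 0) (hm : m * (p + 1) = 24)
    (hnorm : ∀ x ∈ dualLattice B, ∃ k : ℤ, p * (ratForm B x x / 2) = k) (γ : DiscGroup B) (τ : ℍ) :
    vectorF B p m γ (ModularGroup.T • τ) = e (discHalfNorm B γ) * vectorF B p m γ τ := by
  classical
  obtain ⟨j, hj, n, hγ⟩ := exists_discHalfNorm_eq hp hnorm γ
  have he : e (discHalfNorm B γ : ℂ) = e (j / p) := by
    rw [hγ]
    push_cast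
    exact e_add_int _ _
  have hT : ((ModularGroup.T • τ : ℍ) : ℂ) = τ + 1 := by
    rw [UpperHalfPlane.modular_T_smul, UpperHalfPlane.coe_vadd, add_comm, Complex.ofReal_one]
  rw [vectorF_eq hB hp hj hγ, vectorF_eq hB hp hj hγ, hT, etaPart_add_one hp hm hj, mul_add, he]
  congr 1
  split_ifs with h0
  · have h1 : e (discHalfNorm B γ : ℂ) = 1 := by
      obtain ⟨k, hk⟩ := discHalfNorm_discMk hB 0
      rw [e_ratCast_eq_one_iff]
      refine ⟨k, ?_⟩
      rw [h0]
      refine hk.trans ?_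
      simp
    rw [← he, h1, one_mul]
    have := etaProduct_add_int hm (τ : ℂ) 1
    rwa [Int.cast_one] at this
  · rw [mul_zero]

/-- The signature (2, 2m+2) turns Milgram's formula into √p^{m+2} (-i)^m, and this feeds the Gauss
sum hypotheses of `vector_neg_inv`. The prefactor e(1/8)^{b⁻-b⁺} is i^m. -/
lemma vectorF_S_smul (hB : IsEvenLattice B) (hp : p.Prime) (hm : m * (p + 1) = 24)
    (hnorm : ∀ x ∈ dualLattice B, ∃ k : ℤ, p * (ratForm B x x / 2) = k)
    (hcard : Nat.card (DiscGroup B) = p ^ (m + 2)) (hplus : bPlus B = 2)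
    (hminus : bMinus B = 2 * m + 2) (γ : DiscGroup B) (τ : ℍ) :
    vectorF B p m γ (ModularGroup.S • τ) =
      e (1 / 8) ^ ((bMinus B : ℤ) - (bPlus B : ℤ)) / (Real.sqrt (Nat.card (DiscGroup B)) : ℂ) *
        (τ : ℂ) ^ (-(m : ℤ)) * ∑ᶠ δ, e (-(discPair B γ δ : ℂ)) * vectorF B p m δ τ := by
  classical
  have : NeZero p := ⟨hp.ne_zero⟩
  have h := hB.isEvenLatticeIn
  have hfin : Finite (DiscGroup B) := h.finite_disc
  have := Fintype.ofFinite (DiscGroup B)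
  obtain ⟨q, hq, hqN, hqP⟩ := h.exists_quadraticMap hnorm
  have hsqrt : Real.sqrt (Nat.card (DiscGroup B)) = Real.sqrt p ^ (m + 2) := by
    rw [hcard, Nat.cast_pow, Real.sqrt_eq_iff_mul_self_eq (by positivity) (by positivity),
      ← mul_pow, Real.mul_self_sqrt (Nat.cast_nonneg p)]
  have hG : ∑ δ, ZMod.stdAddChar (q δ) = (Real.sqrt p : ℂ) ^ (m + 2) * (-Complex.I) ^ m := by
    rw [Finset.sum_congr rfl fun δ _ => hqN δ, h.sum_eNorm, ← Nat.card_eq_fintype_card, hsqrt]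
    change _ * e ((bPlus B - bMinus B) / 8) = _
    rw [hplus, hminus, ← Complex.ofReal_pow]
    congr 1
    have h4 : -Complex.I = e (-(1 / 4)) := by
      rw [e_neg, e_quarter, Complex.inv_I]
    rw [h4, e_pow]
    congr 1
    push_cast
    ring
  have hE : ∀ γ δ, e (-(discPair B γ δ : ℂ)) = ZMod.stdAddChar (-QuadraticMap.polar q γ δ) :=
    fun γ δ => by
    rw [AddChar.map_neg_eq_inv, hqP, e_neg]
    rfl
  have key := vector_neg_inv hp hm (D := DiscGroup B) q (fun γ δ => e (-(discPair B γ δ : ℂ)))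
    (fun γ => by rw [hE, QuadraticMap.polar_zero_right, neg_zero, AddChar.map_zero_eq_one])
    (fun γ => by
      have h1 := h.sum_ePair γ
      rw [← Nat.card_eq_fintype_card, hcard, Nat.cast_pow] at h1
      rw [← h1]
      refine Fintype.sum_equiv (Equiv.neg _) _ _ fun δ => ?_
      rw [hE, ← QuadraticMap.polar_neg_right, hqP]
      rfl)
    (fun γ k hk => by
      simp_rw [hE]
      rw [sum_stdAddChar_polar hp q γ hk,
        sum_stdAddChar_mul_eq_etaChar hp hm q hcard hG (neg_ne_zero.2 hk), ← mul_assoc, mul_assoc,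
        div_eq_mul_inv, ← inv_pow, Complex.inv_I, mul_assoc])
    (F := fun γ τ => (if γ = 0 then etaProduct p m τ else 0) +
      1 / p * ∑ k : ZMod p, ZMod.stdAddChar (-(q γ * k)) * etaFiber p m τ k)
    (fun _ _ => rfl) γ τ.im_pos
  have hF : ∀ γ (τ : ℍ), vectorF B p m γ τ = (if γ = 0 then etaProduct p m τ else 0) +
      1 / p * ∑ k : ZMod p, ZMod.stdAddChar (-(q γ * k)) * etaFiber p m τ k := fun γ τ => by
    have hp' : (p : ℚ) ≠ 0 := by exact_mod_cast hp.ne_zero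
    obtain ⟨j, hj, n, hγ⟩ := exists_discHalfNorm_eq hp.ne_zero hnorm γ
    obtain ⟨k, hk, hkγ⟩ := hq γ
    have hjk : q γ = j := by
      have h1 : (k : ℚ) / p = j / p + n := hkγ.symm.trans hγ
      field_simp at h1
      have h2 : k = j + p * n := by exact_mod_cast h1
      rw [← hk, h2]
      simp
    rw [vectorF_eq hB hp.ne_zero hj hγ, etaPart_eq, hjk]
  have hS : ((ModularGroup.S • τ : ℍ) : ℂ) = -1 / τ := by
    rw [UpperHalfPlane.modular_S_smul]
    change (-(τ : ℂ))⁻¹ = _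
    rw [neg_div, one_div, inv_neg]
  rw [finsum_eq_sum_of_fintype, hF, hS]
  simp_rw [hF]
  rw [key, hsqrt, hplus, hminus, Complex.ofReal_pow]
  congr 3
  have h2 : ((2 * m + 2 : ℕ) : ℤ) - (2 : ℕ) = ((2 * m : ℕ) : ℤ) := by push_cast; ring
  rw [h2, zpow_natCast, pow_mul, ← e_quarter, e_pow (1 / 8) 2]
  congr 2
  push_cast
  ring

lemma isHolomorphicOnH_vectorF (hB : IsEvenLattice B) (hp : p ≠ 0)
    (hnorm : ∀ x ∈ dualLattice B, ∃ k : ℤ, p * (ratForm B x x / 2) = k) :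
    IsHolomorphicOnH (vectorF B p m) := by
  classical
  intro γ
  obtain ⟨j, hj, n, hγ⟩ := exists_discHalfNorm_eq hp hnorm γ
  refine mdifferentiable_of_differentiableAt
    (G := fun τ => (if γ = 0 then etaProduct p m τ else 0) + etaPart p m j τ)
    (vectorF_eq hB hp hj hγ) fun τ hτ => ?_
  refine DifferentiableAt.add ?_ (differentiableAt_etaPart hp j hτ)
  split_ifs
  · exact differentiableAt_etaProduct hp hτ
  · exact differentiableAt_const _

lemma isMeromorphicAtCusps_vectorF (hB : IsEvenLattice B) (hp : p ≠ 0) (hm : m * (p + 1) = 24)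
    (hnorm : ∀ x ∈ dualLattice B, ∃ k : ℤ, p * (ratForm B x x / 2) = k) :
    IsMeromorphicAtCusps (vectorF B p m) := by
  classical
  intro γ
  obtain ⟨j, hj, n, hγ⟩ := exists_discHalfNorm_eq hp hnorm γ
  have h : HasPuiseuxExpansion fun τ : ℍ =>
      (if γ = 0 then etaProduct p m τ else 0) + etaPart p m j τ := by
    refine HasPuiseuxExpansion.add ?_ (hasPuiseuxExpansion_etaPart hp hm j)
    split_ifs
    · exact hasPuiseuxExpansion_etaProduct hp hm
    · exact hasPuiseuxExpansion_zero
  rw [← funext (vectorF_eq hB hp hj hγ)] at h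
  exact h

end VectorF

end FakeMonster

end

/-! ### The main theorem. -/

theorem mainTheorem4 {Λ : Type*} [AddCommGroup Λ] [Module.Free ℤ Λ] [Module.Finite ℤ Λ]
    (B : LinearMap.BilinForm ℤ Λ) (hΛ : FakeMonster.IsLeechLattice B)
    (p m : ℕ) (hp : p.Prime) (hm : m * (p + 1) = 24)
    (g : Λ ≃ₗ[ℤ] Λ) (hg : ∀ x y, B (g x) (g y) = B x y)
    (hshape : FakeMonster.HasCycleShape g (Multiset.replicate m 1 + Multiset.replicate m p)) :
    FakeMonster.IsExponentDecomposition p (FakeMonster.etaProduct p m)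
      (FakeMonster.etaPart p m) ∧
    FakeMonster.IsEvenLattice (FakeMonster.latticeM B g p) ∧
    Finite (FakeMonster.DiscGroup (FakeMonster.latticeM B g p)) ∧
    (∀ γ, ∃ j < p, ∃ n : ℤ,
      FakeMonster.discHalfNorm (FakeMonster.latticeM B g p) γ = (j : ℚ) / p + n) ∧
    FakeMonster.IsModularFormOfType (FakeMonster.latticeM B g p) (-(m : ℤ))
      (FakeMonster.vectorF (FakeMonster.latticeM B g p) p m) ∧
    FakeMonster.IsHolomorphicOnH (FakeMonster.vectorF (FakeMonster.latticeM B g p) p m) ∧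
    FakeMonster.IsMeromorphicAtCusps (FakeMonster.vectorF (FakeMonster.latticeM B g p) p m) := by
  have hgp := FakeMonster.pow_eq_one_of_hasCycleShape hΛ.posDef hg hshape
  obtain ⟨hcardK, h2⟩ := FakeMonster.natCard_discGroup_fixedSublattice hΛ hp hm hg hshape
  have hrank := (FakeMonster.finrank_fixedSublattice_and_index hp.ne_zero hg hgp hshape
    ((AddMonoidHom.range (nsmulAddMonoidHom (α := Λ) p)).comap
      (FakeMonster.orbitSum g p).toAddMonoidHom) fun x => exists_congr fun y => eq_comm).1
  have hM := FakeMonster.isEvenLattice_latticeM (g := g) hΛ hp.ne_zero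
  have hcard := FakeMonster.natCard_discGroup_latticeM hΛ hp.ne_zero hcardK
  obtain ⟨hplus, hminus⟩ := FakeMonster.bMinus_sub_bPlus_latticeM hΛ hp.ne_zero hrank
  have hnorm : ∀ x ∈ FakeMonster.dualLattice (FakeMonster.latticeM B g p),
      ∃ k : ℤ, p * (FakeMonster.ratForm (FakeMonster.latticeM B g p) x x / 2) = k := fun x hx =>
    FakeMonster.exists_mul_norm_eq_latticeM hΛ hp.ne_zero
      (fun y hy => FakeMonster.exists_mul_norm_eq hΛ hp hg hgp h2 hy) hx
  exact ⟨FakeMonster.isExponentDecomposition_etaPart hp.ne_zero hm, hM,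
    hM.isEvenLatticeIn.finite_disc, FakeMonster.exists_discHalfNorm_eq hp.ne_zero hnorm,
    ⟨FakeMonster.vectorF_T_smul hM hp.ne_zero hm hnorm,
      FakeMonster.vectorF_S_smul hM hp hm hnorm hcard hplus hminus⟩,
    FakeMonster.isHolomorphicOnH_vectorF hM hp.ne_zero hnorm,
    FakeMonster.isMeromorphicAtCusps_vectorF hM hp.ne_zero hm hnorm⟩
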